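/- Let $\Gamma$ be a Euclidean cycle: a compact metric graph with finitely many vertices and edges, without loops or multiple edges, whose combinatorial graph is a cycle (with at least three vertices), and such that for every edge $e$ with length $l_e>0$ the geodesic distance between its two end points equals $l_e$. Let $d$ be the geodesic metric on $\Gamma$, $\ell=\sum_e l_e$ the total edge length, and $d_R$ the resistance metric, i.e. $d_R(s,s')=\operatorname{Var}(Z_\Gamma(s)-Z_\Gamma(s'))$, where $Z_\Gamma=Z_\mu+\sum_e Z_e$ is a sum of independent centred Gaussian fields: $Z_e$ is a Brownian bridge on the edge $e$, extended by $0$, and $Z_\mu$ is linear along edges with law $N(0,L^{-1})$ on the vertices, where $L$ is the graph Laplacian with conductances $1/d(v,w)$ between adjacent vertices, with $1$ added to the diagonal entry of an arbitrary fixed vertex $v_0$. Let $X$ be a Gaussian random field on $\Gamma$ (defined on a probability space $(\Omega,\mathcal F,\mathbb P)$) that is isotropic in the resistance metric, i.e. $\operatorname{Cov}(X(s),X(s'))=r(d_R(s,s'))$ for all $s,s'\in\Gamma$ and some function $r:\mathbb R\to\mathbb R$, and whose increments are not all degenerate: $\operatorname{Var}(X(s)-X(s'))\neq 0$ for some $s,s'\in\Gamma$.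 Suppose that $X$ is Markov of order 1: it is continuous in $L_2(\Omega)$, and for every open $S\subset\Gamma$ the $\sigma$-algebras $\mathcal F^X_+(\overline S)$ and $\mathcal F^X_+(\Gamma\setminus S)$ are conditionally independent given $\sigma(X(s):s\in\partial S)$, where $\mathcal F^X_+(A)=\bigcap_{\varepsilon>0}\sigma(X(s):d(s,A)<\varepsilon)$. Then there are $\kappa,\tau>0$ such that $X-\mathbb E X$ (hence $X$ itself if $X$ is centred) is a Whittle–Matérn field with $\alpha=1$, i.e. a solution of $(\kappa^2-\Delta_\Gamma)^{\alpha/2}(\tau u)=\mathcal W$ with $\alpha=1$, where $\Delta_\Gamma$ is the Kirchhoff Laplacian on $\Gamma$ and $\mathcal W$ is Gaussian white noise on $L_2(\Gamma)$, and for all $s,s'\in\Gamma$ $$r(d_R(s,s'))=r_{1,\ell}(d(s,s')),\qquad r_{1,\ell}(h)=\frac{\cosh(\kappa(h-\ell/2))}{2\kappa\tau^2\sinh(\kappa\ell/2)}.$$ -/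

import Mathlib

open MeasureTheory ProbabilityTheory Set Filter Topology

/-- A finite connected metric graph without loops and multiple edges, with vertex set `V` and edge
set `E`.  The edge `e` is a curve of length `len e > 0` from `src e` to `tgt e`; the orientation is
only used to parametrise the edge by arc length. -/
structure MetricGraph (V E : Type*) where
  src : E → V
  tgt : E → V
  len : E → ℝ
  len_pos : ∀ e, 0 < len e
  src_ne_tgt : ∀ e, src e ≠ tgt e
  edge_ext : ∀ e e', s(src e, tgt e) = s(src e', tgt e') → e = e'
  connected : (SimpleGraph.fromEdgeSet (Set.range fun e => s(src e, tgt e))).Connected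

namespace MetricGraph

variable {V E : Type*}

/-- The underlying combinatorial graph. -/
def toSimpleGraph (Γ : MetricGraph V E) : SimpleGraph V :=
  SimpleGraph.fromEdgeSet (Set.range fun e => s(Γ.src e, Γ.tgt e))

open Classical in
/-- Barycentric coordinates of the location at arc length `t` from `src e` on the edge `e`. -/
noncomputable def coord (Γ : MetricGraph V E) (e : E) (t : ℝ) : V → ℝ := fun v =>
  if v = Γ.src e then 1 - t / Γ.len e else if v = Γ.tgt e then t / Γ.len e else 0

/-- The points (locations) of the metric graph: pairs `(t, e)` with `0 ≤ t ≤ len e`, the end points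
of the edges being glued at the vertices.  A location is recorded by its barycentric coordinates,
so that two pairs `(t, e)` give the same point exactly when they are the same location. -/
def Point (Γ : MetricGraph V E) : Type _ :=
  {x : V → ℝ // ∃ e, ∃ t ∈ Icc 0 (Γ.len e), x = Γ.coord e t}

/-- The location `(t, e)`; values of `t` outside `[0, len e]` are clamped to this interval. -/
noncomputable def loc (Γ : MetricGraph V E) (e : E) (t : ℝ) : Γ.Point :=
  ⟨Γ.coord e (projIcc 0 (Γ.len e) (Γ.len_pos e).le t), e, _, Subtype.coe_prop _, rfl⟩

/-- `Γ.IsPathLength x y L`: there is a path of length `L` from `x` to `y` in `Γ`, composed of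
finitely many moves along single edges. -/
inductive IsPathLength (Γ : MetricGraph V E) : Γ.Point → Γ.Point → ℝ → Prop
  | refl (x : Γ.Point) : IsPathLength Γ x x 0
  | step (e : E) {t t' : ℝ} (ht : t ∈ Icc 0 (Γ.len e)) (ht' : t' ∈ Icc 0 (Γ.len e))
      {y : Γ.Point} {L : ℝ} (h : IsPathLength Γ (Γ.loc e t') y L) :
      IsPathLength Γ (Γ.loc e t) y (|t - t'| + L)

/-- The geodesic distance: the length of the shortest path. -/
noncomputable def geodDist (Γ : MetricGraph V E) (x y : Γ.Point) : ℝ :=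
  sInf {L | Γ.IsPathLength x y L}

/-! ### The geodesic distance is a metric -/

theorem loc_val (Γ : MetricGraph V E) (e : E) {t : ℝ} (ht : t ∈ Icc 0 (Γ.len e)) :
    (Γ.loc e t).1 = Γ.coord e t := by
  simp [loc, projIcc_of_mem _ ht]

theorem exists_loc (Γ : MetricGraph V E) (x : Γ.Point) :
    ∃ e, ∃ t ∈ Icc 0 (Γ.len e), x = Γ.loc e t := by
  obtain ⟨e, t, ht, h⟩ := x.2
  exact ⟨e, t, ht, Subtype.ext (by rw [h, loc_val Γ e ht])⟩

theorem IsPathLength.nonneg {Γ : MetricGraph V E} {x y : Γ.Point} {L : ℝ}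
    (h : Γ.IsPathLength x y L) : 0 ≤ L := by
  induction h with
  | refl => exact le_rfl
  | step e ht ht' h ih => positivity

theorem IsPathLength.trans {Γ : MetricGraph V E} {x y z : Γ.Point} {L M : ℝ}
    (h : Γ.IsPathLength x y L) (h' : Γ.IsPathLength y z M) : Γ.IsPathLength x z (L + M) := by
  induction h with
  | refl => simpa using h'
  | step e ht ht' h ih => rw [add_assoc]; exact .step e ht ht' (ih h')

theorem IsPathLength.symm {Γ : MetricGraph V E} {x y : Γ.Point} {L : ℝ}
    (h : Γ.IsPathLength x y L) : Γ.IsPathLength y x L := by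
  induction h with
  | refl => exact .refl _
  | @step e t t' ht ht' y L h ih =>
    have h1 := ih.trans (.step e ht' ht (.refl _))
    rwa [add_zero, abs_sub_comm, add_comm] at h1

open Classical in
theorem loc_zero_val (Γ : MetricGraph V E) (e : E) (v : V) :
    (Γ.loc e 0).1 v = if v = Γ.src e then 1 else 0 := by
  rw [loc_val Γ e ⟨le_rfl, (Γ.len_pos e).le⟩]
  simp [coord]

open Classical in
theorem loc_len_val (Γ : MetricGraph V E) (e : E) (v : V) :
    (Γ.loc e (Γ.len e)).1 v = if v = Γ.tgt e then 1 else 0 := by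
  rw [loc_val Γ e ⟨(Γ.len_pos e).le, le_rfl⟩]
  have h := Γ.src_ne_tgt e
  simp only [coord, div_self (Γ.len_pos e).ne', sub_self]
  split_ifs with h1 h2 <;> simp_all

open Classical in
theorem exists_isPathLength_of_walk (Γ : MetricGraph V E) {v w : V}
    (p : (SimpleGraph.fromEdgeSet (Set.range fun e => s(Γ.src e, Γ.tgt e))).Walk v w) :
    ∀ x y : Γ.Point, (∀ u, x.1 u = if u = v then 1 else 0) →
      (∀ u, y.1 u = if u = w then 1 else 0) → ∃ L, Γ.IsPathLength x y L := by
  induction p with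
  | nil =>
    intro x y hx hy
    have : x = y := Subtype.ext (funext fun u => by rw [hx, hy])
    exact this ▸ ⟨0, .refl _⟩
  | @cons a b c hab p ih =>
    intro x y hx hy
    rw [SimpleGraph.fromEdgeSet_adj] at hab
    obtain ⟨⟨e, he⟩, -⟩ := hab
    have h0 : (0 : ℝ) ∈ Icc 0 (Γ.len e) := ⟨le_rfl, (Γ.len_pos e).le⟩
    have h1 : Γ.len e ∈ Icc 0 (Γ.len e) := ⟨(Γ.len_pos e).le, le_rfl⟩
    rcases Sym2.eq_iff.1 he with ⟨rfl, rfl⟩ | ⟨rfl, rfl⟩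
    · obtain ⟨L, hL⟩ := ih (Γ.loc e (Γ.len e)) y (fun u => by rw [loc_len_val]) hy
      have : x = Γ.loc e 0 := Subtype.ext (funext fun u => by rw [hx, loc_zero_val])
      exact this ▸ ⟨_, .step e h0 h1 hL⟩
    · obtain ⟨L, hL⟩ := ih (Γ.loc e 0) y (fun u => by rw [loc_zero_val]) hy
      have : x = Γ.loc e (Γ.len e) :=
        Subtype.ext (funext fun u => by rw [hx, loc_len_val])
      exact this ▸ ⟨_, .step e h1 h0 hL⟩

theorem exists_isPathLength (Γ : MetricGraph V E) (x y : Γ.Point) :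
    ∃ L, Γ.IsPathLength x y L := by
  classical
  obtain ⟨e, t, ht, rfl⟩ := Γ.exists_loc x
  obtain ⟨e', t', ht', rfl⟩ := Γ.exists_loc y
  obtain ⟨p⟩ := Γ.connected.preconnected (Γ.src e) (Γ.src e')
  obtain ⟨L, hL⟩ := Γ.exists_isPathLength_of_walk p (Γ.loc e 0) (Γ.loc e' 0)
    (fun u => by rw [loc_zero_val]) (fun u => by rw [loc_zero_val])
  have h0 : (0 : ℝ) ∈ Icc 0 (Γ.len e) := ⟨le_rfl, (Γ.len_pos e).le⟩
  have h0' : (0 : ℝ) ∈ Icc 0 (Γ.len e') := ⟨le_rfl, (Γ.len_pos e').le⟩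
  exact ⟨_, .step e ht h0 (hL.trans (.step e' h0' ht' (.refl _)))⟩

theorem IsPathLength.coord_le {Γ : MetricGraph V E} {x y : Γ.Point} {L c : ℝ}
    (hc : ∀ e, c ≤ Γ.len e) (h : Γ.IsPathLength x y L) (v : V) : c * |x.1 v - y.1 v| ≤ L := by
  classical
  induction h with
  | refl => simp
  | @step e t t' ht ht' y L h ih =>
    rcases le_or_gt c 0 with hc0 | hc0
    · exact (mul_nonpos_of_nonpos_of_nonneg hc0 (abs_nonneg _)).trans
        (add_nonneg (abs_nonneg _) h.nonneg)
    have hl := Γ.len_pos e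
    have h1 : c * |(Γ.loc e t).1 v - (Γ.loc e t').1 v| ≤ |t - t'| := by
      have h2 : |(Γ.loc e t).1 v - (Γ.loc e t').1 v| ≤ |t - t'| / Γ.len e := by
        rw [loc_val Γ e ht, loc_val Γ e ht', show |t - t'| / Γ.len e = |(t - t') / Γ.len e| by rw [abs_div, abs_of_pos hl]]
        simp only [coord]
        split_ifs
        · rw [show 1 - t / Γ.len e - (1 - t' / Γ.len e) = -((t - t') / Γ.len e) by ring, abs_neg]
        · rw [sub_div]
        · simp
      calc _ ≤ Γ.len e * (|t - t'| / Γ.len e) := by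
            gcongr
            exact hc e
        _ = |t - t'| := by field_simp
    calc c * |(Γ.loc e t).1 v - y.1 v|
        ≤ c * (|(Γ.loc e t).1 v - (Γ.loc e t').1 v| + |(Γ.loc e t').1 v - y.1 v|) := by
          gcongr
          exact abs_sub_le _ _ _
      _ ≤ _ := by rw [mul_add]; exact add_le_add h1 ih

theorem geodDist_le {Γ : MetricGraph V E} {x y : Γ.Point} {L : ℝ} (h : Γ.IsPathLength x y L) :
    Γ.geodDist x y ≤ L :=
  csInf_le ⟨0, fun _ h => h.nonneg⟩ h

/-- `Γ` is equipped with the geodesic metric. -/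
noncomputable instance [Finite E] (Γ : MetricGraph V E) : MetricSpace Γ.Point where
  dist := Γ.geodDist
  dist_self x := le_antisymm (geodDist_le (.refl x)) (Real.sInf_nonneg fun _ h => h.nonneg)
  dist_comm x y := by
    have : {L | Γ.IsPathLength x y L} = {L | Γ.IsPathLength y x L} :=
      Set.ext fun L => ⟨fun h => h.symm, fun h => h.symm⟩
    simp only [geodDist, this]
  dist_triangle x y z := by
    have h : ∀ L, Γ.IsPathLength x y L → Γ.geodDist x z - L ≤ Γ.geodDist y z := fun L hL =>
      le_csInf (Γ.exists_isPathLength y z) fun M hM => by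
        have := geodDist_le (hL.trans hM)
        linarith
    have h' : Γ.geodDist x z - Γ.geodDist y z ≤ Γ.geodDist x y :=
      le_csInf (Γ.exists_isPathLength x y) fun L hL => by
        have := h L hL
        linarith
    linarith
  eq_of_dist_eq_zero {x y} hxy := by
    obtain ⟨e₀, -⟩ := x.2
    have : Nonempty E := ⟨e₀⟩
    obtain ⟨e, he⟩ := Finite.exists_min Γ.len
    refine Subtype.ext (funext fun v => ?_)
    have h1 : Γ.len e * |x.1 v - y.1 v| ≤ Γ.geodDist x y :=
      le_csInf (Γ.exists_isPathLength x y) fun L hL => hL.coord_le he v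
    have hxy' : Γ.geodDist x y = 0 := hxy
    have h2 : |x.1 v - y.1 v| ≤ 0 := by
      by_contra h
      have := mul_pos (Γ.len_pos e) (not_le.1 h)
      linarith
    exact sub_eq_zero.1 (abs_eq_zero.1 (le_antisymm h2 (abs_nonneg _)))

theorem continuous_loc [Finite E] (Γ : MetricGraph V E) (e : E) : Continuous (Γ.loc e) := by
  have h : Γ.loc e = (fun t : Icc 0 (Γ.len e) => Γ.loc e t) ∘
      projIcc 0 (Γ.len e) (Γ.len_pos e).le := by
    funext t
    exact Subtype.ext (by rw [Function.comp_apply, loc_val Γ e (Subtype.coe_prop _)]; rfl)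
  rw [h]
  refine Continuous.comp ?_ continuous_projIcc
  refine (LipschitzWith.of_dist_le_mul (K := 1) fun t t' => ?_).continuous
  have := geodDist_le (IsPathLength.step e t.2 t'.2 (.refl (Γ.loc e t')))
  rw [add_zero] at this
  rw [NNReal.coe_one, one_mul]
  exact this

noncomputable instance [Finite E] (Γ : MetricGraph V E) : MeasurableSpace Γ.Point := borel _

instance [Finite E] (Γ : MetricGraph V E) : BorelSpace Γ.Point := ⟨rfl⟩

/-- Lebesgue (arc length) measure on `Γ`.  `L₂(Γ)` is `Lp ℝ 2 Γ.lebesgue`. -/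
noncomputable def lebesgue [Fintype E] (Γ : MetricGraph V E) : Measure Γ.Point :=
  ∑ e, (volume.restrict (Icc 0 (Γ.len e))).map (Γ.loc e)

/-! ### Euclidean cycles -/

/-- Distance consistency: the geodesic distance between the end points of an edge is the length of
the edge.  (Finiteness, connectedness and absence of loops and multiple edges, the other conditions
on a graph with Euclidean edges, are part of `MetricGraph` and of the finiteness of `V`, `E`.) -/
def HasEuclideanEdges [Finite E] (Γ : MetricGraph V E) : Prop :=
  ∀ e, dist (Γ.loc e 0) (Γ.loc e (Γ.len e)) = Γ.len e

/-- A Euclidean cycle: a graph with Euclidean edges whose combinatorial graph is a cycle. -/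
def IsEuclideanCycle [Finite E] (Γ : MetricGraph V E) : Prop :=
  Γ.HasEuclideanEdges ∧
    ∃ n, 3 ≤ n ∧ Nonempty (Γ.toSimpleGraph ≃g SimpleGraph.cycleGraph n)

/-- The total edge length. -/
noncomputable def totalLength [Fintype E] (Γ : MetricGraph V E) : ℝ := ∑ e, Γ.len e

/-! ### The resistance metric -/

open Classical in
/-- The conductance `c(v, w)`: the inverse of the geodesic distance of `v` and `w` if they are
joined by an edge, and `0` otherwise. -/
noncomputable def conductance [Fintype E] (Γ : MetricGraph V E) (v w : V) : ℝ :=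
  ∑ e, if s(Γ.src e, Γ.tgt e) = s(v, w) then 1 / dist (Γ.loc e 0) (Γ.loc e (Γ.len e)) else 0

open Classical in
/-- The matrix `L`, with base vertex `v₀`. -/
noncomputable def resistMatrix [Fintype V] [Fintype E] (Γ : MetricGraph V E) (v₀ : V) :
    Matrix V V ℝ :=
  Matrix.of fun v w =>
    if v = w then (if v = v₀ then 1 else 0) + ∑ w', Γ.conductance v w' else -Γ.conductance v w

open Classical in
/-- The covariance function of the Gaussian field `Z_μ`, which is `N(0, L⁻¹)` on the vertices and is
interpolated linearly along the edges. -/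
noncomputable def vertexFieldCov [Fintype V] [Fintype E] (Γ : MetricGraph V E) (v₀ : V)
    (x y : Γ.Point) : ℝ :=
  ∑ v, ∑ w, x.1 v * (Γ.resistMatrix v₀)⁻¹ v w * y.1 w

/-- The location `x` lies on the edge `e`. -/
def OnEdge (Γ : MetricGraph V E) (e : E) (x : Γ.Point) : Prop :=
  ∃ t ∈ Icc 0 (Γ.len e), x = Γ.loc e t

/-- The arc length parameter of a location on the edge `e`. -/
noncomputable def edgeParam (Γ : MetricGraph V E) (e : E) (x : Γ.Point) : ℝ :=
  Γ.len e * x.1 (Γ.tgt e)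

open Classical in
/-- The covariance function of the field `Z_e`, a Brownian bridge on the edge `e` that is extended
by zero to the other edges. -/
noncomputable def bridgeCov (Γ : MetricGraph V E) (e : E) (x y : Γ.Point) : ℝ :=
  if Γ.OnEdge e x ∧ Γ.OnEdge e y then
    min (Γ.edgeParam e x) (Γ.edgeParam e y) - Γ.edgeParam e x * Γ.edgeParam e y / Γ.len e
  else 0

/-- The covariance function of `Z_Γ = Z_μ + ∑ e, Z_e`, a sum of independent Gaussian fields. -/
noncomputable def auxFieldCov [Fintype V] [Fintype E] (Γ : MetricGraph V E) (v₀ : V)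
    (x y : Γ.Point) : ℝ :=
  Γ.vertexFieldCov v₀ x y + ∑ e, Γ.bridgeCov e x y

/-- The resistance metric: the variogram `Var (Z_Γ(x) - Z_Γ(y))`. -/
noncomputable def resistDist [Fintype V] [Fintype E] (Γ : MetricGraph V E) (v₀ : V)
    (x y : Γ.Point) : ℝ :=
  Γ.auxFieldCov v₀ x x + Γ.auxFieldCov v₀ y y - 2 * Γ.auxFieldCov v₀ x y

/-! ### Whittle--Matérn fields -/

open Classical in
/-- `φ` lies in the domain of the Kirchhoff Laplacian `Δ_Γ`, and `Δ_Γ φ = g`: `φ` is continuous on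
`Γ`, on each edge it is an `H²` function with first derivative `φ'` and second derivative
`g ∈ L₂`, and at each vertex the derivatives in the directions away from the vertex sum to zero. -/
def IsKirchhoffLaplacian [Fintype E] (Γ : MetricGraph V E) (φ g : Γ.Point → ℝ) : Prop :=
  Continuous φ ∧ ∃ φ' : E → ℝ → ℝ,
    (∀ e, MemLp (fun t => g (Γ.loc e t)) 2 (volume.restrict (Icc 0 (Γ.len e)))) ∧
    (∀ e, ∀ t ∈ Icc 0 (Γ.len e), φ (Γ.loc e t) = φ (Γ.loc e 0) + ∫ s in (0 : ℝ)..t, φ' e s) ∧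
    (∀ e, ∀ t ∈ Icc 0 (Γ.len e), φ' e t = φ' e 0 + ∫ s in (0 : ℝ)..t, g (Γ.loc e s)) ∧
    ∀ v, (∑ e, if Γ.src e = v then φ' e 0 else 0) -
      (∑ e, if Γ.tgt e = v then φ' e (Γ.len e) else 0) = 0

/-- `φ` is an eigenfunction (or zero) of `L = κ² - Δ_Γ` with eigenvalue `lam`. -/
def IsEigenfunction [Fintype E] (Γ : MetricGraph V E) (κ lam : ℝ) (φ : Γ.Point → ℝ) : Prop :=
  Γ.IsKirchhoffLaplacian φ (fun s => κ ^ 2 * φ s - lam * φ s)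

/-- `φ` lies in the domain of the fractional power `L ^ β` of `L = κ² - Δ_Γ`, and `L ^ β φ = ψ`, in
the spectral sense: the coefficients with respect to the eigenfunctions are multiplied by
`lam ^ β`. -/
def IsFracPower [Fintype E] (Γ : MetricGraph V E) (κ β : ℝ) (φ ψ : Lp ℝ 2 Γ.lebesgue) : Prop :=
  ∀ (f : Γ.Point → ℝ) (lam : ℝ), Γ.IsEigenfunction κ lam f →
    ∫ s, ψ s * f s ∂Γ.lebesgue = lam ^ β * ∫ s, φ s * f s ∂Γ.lebesgue

/-- Gaussian white noise on `L₂(Γ)`, as a family of random variables on `(Ω, P)`. -/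
structure IsWhiteNoise [Fintype E] (Γ : MetricGraph V E) {Ω : Type*} [MeasurableSpace Ω]
    (P : Measure Ω) (W : Lp ℝ 2 Γ.lebesgue → Ω → ℝ) : Prop where
  gaussian : IsGaussianProcess W P
  centered : ∀ h, ∫ ω, W h ω ∂P = 0
  covariance : ∀ h g, ∫ ω, W h ω * W g ω ∂P = inner ℝ h g

/-- `X` is a Whittle--Matérn field with parameters `κ, τ, α`, that is, a solution of
`(κ² - Δ_Γ)^(α/2) (τ X) = 𝓦`, with `𝓦` Gaussian white noise: `X` has a jointly measurable
modification `u`, which is in `L₂(Ω, L₂(Γ))` and satisfies the equation in duality with every `φ`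
in the domain of `(κ² - Δ_Γ)^(α/2)`. -/
def IsWhittleMatern [Fintype E] (Γ : MetricGraph V E) (κ τ α : ℝ) {Ω : Type*} [MeasurableSpace Ω]
    (P : Measure Ω) (X : Γ.Point → Ω → ℝ) : Prop :=
  ∃ u : Γ.Point → Ω → ℝ,
    Measurable (Function.uncurry u) ∧ (∀ s, u s =ᵐ[P] X s) ∧
    MemLp (Function.uncurry u) 2 (Γ.lebesgue.prod P) ∧
    ∃ W : Lp ℝ 2 Γ.lebesgue → Ω → ℝ, Γ.IsWhiteNoise P W ∧
      ∀ φ ψ : Lp ℝ 2 Γ.lebesgue, Γ.IsFracPower κ (α / 2) φ ψ →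
        ∀ᵐ ω ∂P, ∫ s, (τ * u s ω) * ψ s ∂Γ.lebesgue = W φ ω

end MetricGraph

/-! ### Markov random fields -/

/-- `𝓒` splits `𝓐` and `𝓑`: these are conditionally independent given `𝓒`. -/
def Splits {Ω : Type*} {mΩ : MeasurableSpace Ω} (P : Measure Ω)
    (𝓒 𝓐 𝓑 : MeasurableSpace Ω) : Prop :=
  ∀ A B : Set Ω, MeasurableSet[𝓐] A → MeasurableSet[𝓑] B →
    P⟦A ∩ B | 𝓒⟧ =ᵐ[P] fun ω => (P⟦A | 𝓒⟧) ω * (P⟦B | 𝓒⟧) ω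

/-- `𝓕(S) = σ(X(s) : s ∈ S)`. -/
abbrev fieldSigma {T Ω : Type*} (X : T → Ω → ℝ) (S : Set T) : MeasurableSpace Ω :=
  ⨆ s ∈ S, MeasurableSpace.comap (X s) inferInstance

/-- `𝓕₊(S) = ⋂_{ε > 0} 𝓕(S_ε)`, with `S_ε` the open `ε`-neighbourhood of `S`. -/
abbrev fieldSigmaPlus {T Ω : Type*} [MetricSpace T] (X : T → Ω → ℝ) (S : Set T) :
    MeasurableSpace Ω :=
  ⨅ (ε : ℝ) (_ : 0 < ε), fieldSigma X (Metric.thickening ε S)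

/-- `X` is Markov of order 1: it is continuous in `L₂(Ω)` (a differentiable field of order 0), and
for every open `S` the values of `X` on `∂S` split `𝓕₊(closure S)` and `𝓕₊(Sᶜ)`. -/
structure IsMarkovOfOrderOne {T Ω : Type*} [MetricSpace T] {mΩ : MeasurableSpace Ω}
    (P : Measure Ω) (X : T → Ω → ℝ) : Prop where
  memLp : ∀ s, MemLp (X s) 2 P
  continuous : ∀ s, Tendsto (fun t => eLpNorm (X t - X s) 2 P) (𝓝 s) (𝓝 0)
  splits : ∀ S : Set T, IsOpen S →
    Splits P (fieldSigma X (frontier S)) (fieldSigmaPlus X (closure S)) (fieldSigmaPlus X Sᶜ)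

/-! A cycle of total length `ℓ` is isometric to the circle `ℝ/ℓℤ` (`circleEquiv`). Two points at
distance `h` are joined by parallel arcs of lengths `h` and `ℓ - h`, so their resistance is `h (ℓ -
h)/ℓ = h - h²/ℓ` (`resistDist_eq`). Isotropy in `d_R` thus makes the covariance an even,
`ℓ`-periodic, continuous function `ρ` of the difference of positions.

Apply the Markov property to the open arc `(0, 2h)`. Regressing the value at the midpoint `h` on the
two end values leaves a residual uncorrelated with the boundary. By Gaussianity and splitting it is
uncorrelated with the field off the arc, whence `ρ w = k (ρ (w + h) + ρ (w - h))` with `k = ρ h / (ρ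
0 + ρ (2h))`. Recentred at `ℓ/2` this is d'Alembert's functional equation, so `ρ` is a multiple of
`cosh (κ (w - ℓ/2))` or of `cos (κ (w - ℓ/2))` (`cosh_or_cos_of_markov_relation`). In the second
case `|ρ| ≤ ρ 0` forces `ρ w = ρ 0 cos (κ w)`.

The cosine satisfies the covariance relation, so excluding it takes more. If `κ = 0`, all increments
are degenerate. If `κ > 0`, the centred field is `A cos + B sin` with random `A`, `B`. Values
arbitrarily close to one point determine `B`, so up to null sets `{B > 0}` lies in both germ fields
split by the value at that point, and it is independent of that value. It is therefore independent
of itself, although `B` is a nondegenerate Gaussian variable (`not_covariance_cos`).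

With the `cosh` kernel, the covariance operator is diagonal in the basis `cos + sin` of
eigenfunctions of the Kirchhoff Laplacian, with eigenvalues `(τ² (κ² + ω²))⁻¹`; it is `τ⁻² (κ² -
Δ)⁻¹`. Normalising the integrals of the centred field against this basis gives an isometry from
`L₂(Γ)` into the closed Gaussian span of the field (`exists_isometry_integral_smul_eq`). This
isometry is a white noise, and comparing coefficients gives the equation with `α = 1`. -/

namespace MetricGraph

/-! ### Cyclic numbering and parametrisation of the cycle -/

variable {V E : Type*}

/-- A numbering of the vertices and edges of a cycle with `n` vertices in cyclic order. -/
structure CyclicOrder (Γ : MetricGraph V E) (n : ℕ) where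
  three_le : 3 ≤ n
  vert : ℕ → V
  edge : ℕ → E
  vert_period : vert n = vert 0
  vert_inj : ∀ i < n, ∀ j < n, vert i = vert j → i = j
  vert_surj : ∀ w, ∃ k < n, vert k = w
  edge_inj : ∀ i < n, ∀ j < n, edge i = edge j → i = j
  edge_surj : ∀ e, ∃ k < n, edge k = e
  ends : ∀ k < n, s(Γ.src (edge k), Γ.tgt (edge k)) = s(vert k, vert (k + 1))

theorem IsEuclideanCycle.exists_cyclicOrder [Finite E] {Γ : MetricGraph V E}
    (h : Γ.IsEuclideanCycle) : ∃ n, Nonempty (Γ.CyclicOrder n) := by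
  obtain ⟨-, n, hn, ⟨φ⟩⟩ := h
  refine ⟨n, ?_⟩
  obtain ⟨m, rfl⟩ : ∃ m, n = m + 3 := ⟨n - 3, by omega⟩
  have hadj : ∀ u v, Γ.toSimpleGraph.Adj u v ↔ (φ u - φ v = 1 ∨ φ v - φ u = 1) := fun u v => by
    rw [← φ.map_adj_iff]
    exact SimpleGraph.cycleGraph_adj
  have hedge : ∀ u v, Γ.toSimpleGraph.Adj u v ↔ ∃ e, s(Γ.src e, Γ.tgt e) = s(u, v) := fun u v => by
    unfold toSimpleGraph
    rw [SimpleGraph.fromEdgeSet_adj]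
    constructor
    · rintro ⟨⟨e, he⟩, -⟩
      exact ⟨e, he⟩
    · rintro ⟨e, he⟩
      refine ⟨⟨e, he⟩, ?_⟩
      rintro rfl
      have := Γ.src_ne_tgt e
      rcases Sym2.eq_iff.1 he with ⟨h1, h2⟩ | ⟨h1, h2⟩ <;> exact this (h1.trans h2.symm)
  let vert : ℕ → V := fun k => φ.symm (Fin.ofNat (m + 3) k)
  have hv : ∀ k, φ (vert k) = Fin.ofNat (m + 3) k := fun k => φ.apply_symm_apply _
  have hsucc : ∀ k, Fin.ofNat (m + 3) (k + 1) = Fin.ofNat (m + 3) k + 1 := fun k => by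
    simp [Fin.ext_iff, Fin.val_add]
  have hE : ∀ k, ∃ e, s(Γ.src e, Γ.tgt e) = s(vert k, vert (k + 1)) := fun k => by
    rw [← hedge, hadj, hv, hv, hsucc]
    right
    simp
  choose edge hedge' using hE
  have hinj : ∀ i < m + 3, ∀ j < m + 3, vert i = vert j → i = j := fun i hi j hj hij => by
    have := congrArg φ hij
    rw [hv, hv, Fin.ext_iff] at this
    simpa [Nat.mod_eq_of_lt hi, Nat.mod_eq_of_lt hj] using this
  have hper : vert (m + 3) = vert 0 := by
    have : Fin.ofNat (m + 3) (m + 3) = Fin.ofNat (m + 3) 0 := by simp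
    simp only [vert, this]
  have hsurj : ∀ w, ∃ k < m + 3, vert k = w := fun w =>
    ⟨φ w, (φ w).2, by
      apply φ.injective
      rw [hv]
      simp⟩
  refine ⟨⟨by omega, vert, edge, hper, hinj, hsurj, ?_, ?_, fun k _ => hedge' k⟩⟩
  · intro i hi j hj hij
    have h1 := hedge' i
    rw [hij, hedge' j] at h1
    rcases Sym2.eq_iff.1 h1 with ⟨h2, -⟩ | ⟨h2, h3⟩
    · exact (hinj _ hj _ hi h2).symm
    · have h4 := congrArg φ h2
      have h5 := congrArg φ h3
      rw [hv, hv, hsucc] at h4 h5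
      rw [h4] at h5
      -- If edges `i` and `j` coincide with swapped ends, then `i + 2 = i` modulo the number of
      -- vertices, which is at least three.
      have h6 : Fin.ofNat (m + 3) i + (1 + 1) = Fin.ofNat (m + 3) i + 0 := by
        rw [← add_assoc, h5, add_zero]
      have h7 := add_left_cancel h6
      simp only [Fin.ext_iff, Fin.val_add, Fin.val_one, Fin.val_zero] at h7
      rw [Nat.mod_eq_of_lt (by omega)] at h7
      omega
  · intro e
    have h1 : Γ.toSimpleGraph.Adj (Γ.src e) (Γ.tgt e) := (hedge _ _).2 ⟨e, rfl⟩
    rw [hadj] at h1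
    have key : ∀ u v, φ v - φ u = 1 → ∃ k < m + 3, s(vert k, vert (k + 1)) = s(u, v) := by
      intro u v huv
      refine ⟨φ u, (φ u).2, ?_⟩
      have h2 : vert (φ u) = u := by
        apply φ.injective
        rw [hv]
        simp
      have h3 : vert (φ u + 1) = v := by
        apply φ.injective
        rw [hv, hsucc, eq_add_of_sub_eq huv]
        simp [add_comm]
      rw [h2, h3]
    have : ∃ k < m + 3, s(vert k, vert (k + 1)) = s(Γ.src e, Γ.tgt e) := by
      rcases h1 with h1 | h1
      · obtain ⟨k, hk, h⟩ := key _ _ h1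
        exact ⟨k, hk, h.trans Sym2.eq_swap⟩
      · exact key _ _ h1
    obtain ⟨k, hk, h⟩ := this
    exact ⟨k, hk, Γ.edge_ext _ _ ((hedge' k).trans h)⟩

namespace CyclicOrder

variable {Γ : MetricGraph V E} {n : ℕ} (c : Γ.CyclicOrder n)

theorem vert_eq_iff {i j : ℕ} (hi : i < n) (hj : j ≤ n) :
    c.vert j = c.vert i ↔ j = i ∨ (j = n ∧ i = 0) := by
  have h3 := c.three_le
  rcases hj.lt_or_eq with hj | rfl
  · constructor
    · exact fun h => .inl (c.vert_inj _ hj _ hi h)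
    · rintro (rfl | ⟨rfl, rfl⟩)
      · rfl
      · exact c.vert_period
  · rw [c.vert_period]
    constructor
    · exact fun h => .inr ⟨rfl, (c.vert_inj _ (by omega) _ hi h).symm⟩
    · rintro (rfl | ⟨-, rfl⟩)
      · exact absurd hi (lt_irrefl _)
      · rfl

/-- The length of the edge number `k`. -/
def len (k : ℕ) : ℝ := Γ.len (c.edge k)

theorem len_pos (k : ℕ) : 0 < c.len k := Γ.len_pos _

/-- The position of the vertex number `k` on the cycle. -/
noncomputable def pos (k : ℕ) : ℝ := ∑ j ∈ Finset.range k, c.len j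

@[simp] theorem pos_zero : c.pos 0 = 0 := by simp [pos]

theorem pos_succ (k : ℕ) : c.pos (k + 1) = c.pos k + c.len k := Finset.sum_range_succ _ _

theorem pos_strictMono : StrictMono c.pos :=
  strictMono_nat_of_lt_succ fun k => by
    rw [pos_succ]
    linarith [c.len_pos k]

theorem pos_nonneg (k : ℕ) : 0 ≤ c.pos k := Finset.sum_nonneg fun _ _ => (c.len_pos _).le

theorem sum_edge [Fintype E] {M : Type*} [AddCommMonoid M] (f : E → M) :
    ∑ e, f e = ∑ k ∈ Finset.range n, f (c.edge k) := by
  symm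
  refine Finset.sum_bij (fun k _ => c.edge k) (fun _ _ => Finset.mem_univ _) ?_ ?_
    (fun _ _ => rfl)
  · intro i hi j hj h
    exact c.edge_inj _ (Finset.mem_range.1 hi) _ (Finset.mem_range.1 hj) h
  · intro e _
    obtain ⟨k, hk, h⟩ := c.edge_surj e
    exact ⟨k, Finset.mem_range.2 hk, h⟩

theorem totalLength_eq [Fintype E] : Γ.totalLength = c.pos n := c.sum_edge _

theorem pos_n_pos : 0 < c.pos n := by
  have h := c.pos_strictMono (show 0 < n by have := c.three_le; omega)
  rwa [pos_zero] at h

open Classical in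
/-- The point of the edge number `k` at distance `t` from the vertex number `k`. -/
noncomputable def point (k : ℕ) (t : ℝ) : Γ.Point :=
  if Γ.src (c.edge k) = c.vert k then Γ.loc (c.edge k) t else Γ.loc (c.edge k) (c.len k - t)

/-- An edge may run with or against the cyclic order; in the second case its arc length parameter is
reversed. Orientations are eliminated through this case split. -/
theorem ends_cases {k : ℕ} (hk : k < n) :
    (Γ.src (c.edge k) = c.vert k ∧ Γ.tgt (c.edge k) = c.vert (k + 1) ∧
      ∀ t, c.point k t = Γ.loc (c.edge k) t) ∨
    (Γ.src (c.edge k) = c.vert (k + 1) ∧ Γ.tgt (c.edge k) = c.vert k ∧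
      ∀ t, c.point k t = Γ.loc (c.edge k) (c.len k - t)) := by
  rcases Sym2.eq_iff.1 (c.ends k hk) with ⟨h1, h2⟩ | ⟨h1, h2⟩
  · exact .inl ⟨h1, h2, fun t => by simp [point, h1]⟩
  · refine .inr ⟨h1, h2, fun t => ?_⟩
    have : Γ.src (c.edge k) ≠ c.vert k := h2 ▸ Γ.src_ne_tgt _
    simp [point, this]

theorem vert_ne_succ {k : ℕ} (hk : k < n) : c.vert k ≠ c.vert (k + 1) := by
  rcases c.ends_cases hk with ⟨h1, h2, -⟩ | ⟨h1, h2, -⟩ <;> rw [← h1, ← h2]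
  · exact Γ.src_ne_tgt _
  · exact (Γ.src_ne_tgt _).symm

-- The orientation drops out: in either case the barycentric coordinates move affinely from vertex
-- number `k` to vertex number `k + 1`.
open Classical in
theorem point_val {k : ℕ} (hk : k < n) {t : ℝ} (ht : t ∈ Icc 0 (c.len k)) (w : V) :
    (c.point k t).1 w = (1 - t / c.len k) * (if c.vert k = w then 1 else 0) +
      t / c.len k * (if c.vert (k + 1) = w then 1 else 0) := by
  have hl := c.len_pos k
  have hne := c.vert_ne_succ hk
  rcases c.ends_cases hk with ⟨h1, h2, h3⟩ | ⟨h1, h2, h3⟩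
  · rw [h3, loc_val Γ _ ht, coord, h1, h2]
    by_cases ha : w = c.vert k
    · subst ha
      simp [hne.symm, len]
    · by_cases hb : w = c.vert (k + 1)
      · subst hb
        simp [ha, hne, len]
      · simp [ha, hb, Ne.symm ha, Ne.symm hb]
  · rw [h3, loc_val Γ _ ⟨by linarith [ht.2], by simpa [len] using ht.1⟩, coord, h1, h2]
    by_cases hb : w = c.vert (k + 1)
    · subst hb
      simp only [if_true, hne, if_false]
      rw [show Γ.len (c.edge k) = c.len k from rfl]
      field_simp
      ring
    · by_cases ha : w = c.vert k
      · subst ha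
        simp only [hne, if_true, hne.symm, if_false]
        rw [show Γ.len (c.edge k) = c.len k from rfl]
        field_simp
        ring
      · simp [ha, hb, Ne.symm ha, Ne.symm hb]

theorem exists_point (x : Γ.Point) : ∃ k < n, ∃ t ∈ Icc 0 (c.len k), x = c.point k t := by
  obtain ⟨e, t, ht, rfl⟩ := Γ.exists_loc x
  obtain ⟨k, hk, rfl⟩ := c.edge_surj e
  refine ⟨k, hk, ?_⟩
  rcases c.ends_cases hk with ⟨-, -, h3⟩ | ⟨-, -, h3⟩
  · exact ⟨t, ht, (h3 t).symm⟩
  · exact ⟨c.len k - t, ⟨sub_nonneg.2 ht.2, by linarith [ht.1]⟩, by rw [h3, sub_sub_cancel]⟩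

theorem isPathLength_point {k : ℕ} (hk : k < n) {t t' : ℝ} (ht : t ∈ Icc 0 (c.len k))
    (ht' : t' ∈ Icc 0 (c.len k)) : Γ.IsPathLength (c.point k t) (c.point k t') |t - t'| := by
  rcases c.ends_cases hk with ⟨-, -, h3⟩ | ⟨-, -, h3⟩
  · rw [h3, h3]
    simpa using IsPathLength.step (c.edge k) ht ht' (.refl _)
  · rw [h3, h3]
    have := IsPathLength.step (Γ := Γ) (c.edge k) (t := c.len k - t) (t' := c.len k - t')
      ⟨sub_nonneg.2 ht.2, by simpa [len] using ht.1⟩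
      ⟨sub_nonneg.2 ht'.2, by simpa [len] using ht'.1⟩ (.refl _)
    rwa [sub_sub_sub_cancel_left, add_zero, abs_sub_comm] at this

theorem point_len {k : ℕ} (hk : k + 1 < n) : c.point k (c.len k) = c.point (k + 1) 0 := by
  have hl := c.len_pos k
  refine Subtype.ext (funext fun w => ?_)
  classical
  rw [c.point_val (by omega) ⟨hl.le, le_rfl⟩, c.point_val hk ⟨le_rfl, (c.len_pos _).le⟩]
  simp [hl.ne']

theorem point_last (m : ℕ) (hm : m + 1 = n) : c.point m (c.len m) = c.point 0 0 := by
  have hl := c.len_pos m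
  refine Subtype.ext (funext fun w => ?_)
  classical
  rw [c.point_val (by omega) ⟨hl.le, le_rfl⟩,
    c.point_val (by have := c.three_le; omega) ⟨le_rfl, (c.len_pos _).le⟩]
  simp [hl.ne', hm, c.vert_period]

end CyclicOrder

end MetricGraph

/-! ### Isometry of the cycle with a circle -/

/-- At most one shift by the period brings `x` into `[-p/2, p/2]`, where the quotient norm is the
absolute value. The bound `|x| ≤ p` fits differences of two positions in `[0, ℓ]`. -/
theorem AddCircle.norm_coe_eq_min {p x : ℝ} (hp : 0 < p) (hx : |x| ≤ p) :
    ‖(x : AddCircle p)‖ = min |x| (p - |x|) := by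
  rcases le_total |x| (p / 2) with h | h
  · rw [(AddCircle.norm_coe_eq_abs_iff p hp.ne').2 (by rwa [abs_of_pos hp]),
      min_eq_left (by linarith)]
  · rw [min_eq_right (by linarith)]
    rcases le_total 0 x with h0 | h0
    · rw [abs_of_nonneg h0] at *
      have h1 : (x : AddCircle p) = ((x - p : ℝ) : AddCircle p) := by
        rw [AddCircle.coe_sub, AddCircle.coe_period, sub_zero]
      have h2 : |x - p| = p - x := by rw [abs_of_nonpos (by linarith), neg_sub]
      rw [h1, (AddCircle.norm_coe_eq_abs_iff p hp.ne').2 (by rw [h2, abs_of_pos hp]; linarith), h2]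
    · rw [abs_of_nonpos h0] at *
      have h1 : (x : AddCircle p) = ((x + p : ℝ) : AddCircle p) := by
        rw [AddCircle.coe_add_period]
      have h2 : |x + p| = p - -x := by rw [abs_of_nonneg (by linarith)]; ring
      rw [h1, (AddCircle.norm_coe_eq_abs_iff p hp.ne').2 (by rw [h2, abs_of_pos hp]; linarith), h2]

namespace MetricGraph

variable {V E : Type*}

namespace CyclicOrder

variable [Fintype E] {Γ : MetricGraph V E} {n : ℕ} (c : Γ.CyclicOrder n)

include c in
theorem totalLength_pos : 0 < Γ.totalLength := c.totalLength_eq ▸ c.pos_n_pos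

theorem pos_add_mem {k : ℕ} (hk : k < n) {t : ℝ} (ht : t ∈ Icc 0 (c.len k)) :
    c.pos k + t ∈ Icc 0 Γ.totalLength := by
  refine ⟨add_nonneg (c.pos_nonneg k) ht.1, ?_⟩
  have h1 := c.pos_strictMono.monotone (show k + 1 ≤ n from hk)
  rw [c.totalLength_eq]
  rw [pos_succ] at h1
  linarith [ht.2]

/-- Two representations of the same point have the same position modulo the total length. -/
theorem coe_pos_add_eq {k k' : ℕ} (hk : k < n) (hk' : k' < n) {t t' : ℝ}
    (ht : t ∈ Icc 0 (c.len k)) (ht' : t' ∈ Icc 0 (c.len k')) (h : c.point k t = c.point k' t') :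
    ((c.pos k + t : ℝ) : AddCircle Γ.totalLength) = ((c.pos k' + t' : ℝ) : AddCircle _) := by
  wlog hkk : k ≤ k' generalizing k k' t t'
  · exact (this hk' hk ht' ht h.symm (le_of_not_ge hkk)).symm
  classical
  have hl := c.len_pos k
  have hl' := c.len_pos k'
  have hval : ∀ w, _ := fun w => congrArg (fun x : Γ.Point => x.1 w) h
  simp only [c.point_val hk ht, c.point_val hk' ht'] at hval
  have h3 := c.three_le
  have hper : c.vert n = c.vert 0 := c.vert_period
  have key : ∀ i j, i ≤ n → j ≤ n → (c.vert i = c.vert j ↔ i = j ∨ (i = 0 ∧ j = n) ∨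
      (i = n ∧ j = 0)) := by
    intro i j hi hj
    rcases hi.lt_or_eq with hi | rfl
    · rw [eq_comm, c.vert_eq_iff hi hj]
      omega
    · rcases hj.lt_or_eq with hj | rfl
      · rw [c.vert_eq_iff hj le_rfl]
        omega
      · simp
  have h1 := hval (c.vert k)
  have h2 := hval (c.vert (k + 1))
  have h4 := hval (c.vert k')
  have h5 := hval (c.vert (k' + 1))
  rw [key _ _ (by omega) (by omega), key _ _ (by omega) (by omega), key _ _ (by omega) (by omega),
    key _ _ (by omega) (by omega)] at h1 h2 h4 h5
  -- On a common edge the coordinates determine the parameter. Consecutive edges, the last and the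
  -- first included, meet only in their common vertex. Otherwise both end coordinates of the first
  -- point would vanish, although they sum to one.
  rcases hkk.eq_or_lt with rfl | hlt
  · have a1 : ¬ (k = k + 1 ∨ k = 0 ∧ k + 1 = n ∨ k = n ∧ k + 1 = 0) := by omega
    simp only [a1, if_false, true_or, if_true, mul_zero, zero_add, mul_one] at h2
    rw [div_left_inj' hl.ne'] at h2
    rw [h2]
  · by_cases hs : k + 1 = k'
    · subst hs
      rw [if_pos (by omega), if_neg (by omega), if_neg (by omega)] at h1
      rw [if_neg (by omega), if_pos (by omega), if_neg (by omega)] at h2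
      have ht1 : t = c.len k := by
        have : t / c.len k = 1 := by linarith
        rwa [div_eq_one_iff_eq hl.ne'] at this
      have ht2 : t' = 0 := by
        have : t' / c.len (k + 1) = 0 := by
          rw [ht1, div_self hl.ne'] at h2
          linarith
        simpa [hl'.ne'] using this
      rw [ht1, ht2, pos_succ, add_zero]
    · by_cases hw : k = 0 ∧ k' + 1 = n
      · obtain ⟨rfl, hw⟩ := hw
        rw [if_pos (by omega), if_neg (by omega), if_neg (by omega), if_pos (by omega)] at h1
        rw [if_neg (by omega), if_pos (by omega), if_neg (by omega), if_neg (by omega)] at h2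
        have ht1 : t = 0 := by
          have : t / c.len 0 = 0 := by linarith
          simpa [hl.ne'] using this
        have ht2 : t' = c.len k' := by
          have : t' / c.len k' = 1 := by
            rw [ht1, zero_div] at h1
            linarith
          rwa [div_eq_one_iff_eq hl'.ne'] at this
        rw [ht1, ht2, ← pos_succ, hw, ← c.totalLength_eq, AddCircle.coe_period]
        simp
      · exfalso
        rw [if_pos (by omega), if_neg (by omega), if_neg (by omega), if_neg (by omega)] at h1
        rw [if_neg (by omega), if_pos (by omega), if_neg (by omega), if_neg (by omega)] at h2
        linarith

/-- The index of an edge that contains the point `x`. -/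
noncomputable def idx (x : Γ.Point) : ℕ := (c.exists_point x).choose

omit [Fintype E] in
theorem idx_lt (x : Γ.Point) : c.idx x < n := (c.exists_point x).choose_spec.1

/-- The distance of the point `x` from the beginning of the edge number `idx x`. -/
noncomputable def offset (x : Γ.Point) : ℝ := (c.exists_point x).choose_spec.2.choose

omit [Fintype E] in
theorem offset_mem (x : Γ.Point) : c.offset x ∈ Icc 0 (c.len (c.idx x)) :=
  (c.exists_point x).choose_spec.2.choose_spec.1

omit [Fintype E] in
theorem point_idx_offset (x : Γ.Point) : c.point (c.idx x) (c.offset x) = x :=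
  (c.exists_point x).choose_spec.2.choose_spec.2.symm

/-- The position of a point on the circle of length `Γ.totalLength`. -/
noncomputable def toCircle (x : Γ.Point) : AddCircle Γ.totalLength :=
  ((c.pos (c.idx x) + c.offset x : ℝ) : AddCircle Γ.totalLength)

theorem toCircle_point {k : ℕ} (hk : k < n) {t : ℝ} (ht : t ∈ Icc 0 (c.len k)) :
    c.toCircle (c.point k t) = ((c.pos k + t : ℝ) : AddCircle Γ.totalLength) :=
  c.coe_pos_add_eq (c.idx_lt _) hk (c.offset_mem _) ht (c.point_idx_offset _)

/-- A move along one edge changes the position by its parameter difference, which bounds the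
quotient norm, and moves add up by the triangle inequality. This bounds the geodesic distance from
below. -/
theorem norm_toCircle_sub_le_of_isPathLength {x y : Γ.Point} {L : ℝ} (h : Γ.IsPathLength x y L) :
    ‖c.toCircle x - c.toCircle y‖ ≤ L := by
  induction h with
  | refl => simp
  | @step e t t' ht ht' y L h ih =>
    have key : ‖c.toCircle (Γ.loc e t) - c.toCircle (Γ.loc e t')‖ ≤ |t - t'| := by
      obtain ⟨k, hk, rfl⟩ := c.edge_surj e
      have hnorm : ∀ a b : ℝ, ‖(a : AddCircle Γ.totalLength) - (b : AddCircle _)‖ ≤ |a - b| := by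
        intro a b
        rw [← AddCircle.coe_sub]
        exact QuotientAddGroup.norm_mk_le_norm
      rcases c.ends_cases hk with ⟨-, -, h3⟩ | ⟨-, -, h3⟩
      · rw [← h3, ← h3, c.toCircle_point hk ht, c.toCircle_point hk ht']
        exact (hnorm _ _).trans_eq (by rw [add_sub_add_left_eq_sub])
      · have hmem : ∀ {s : ℝ}, s ∈ Icc 0 (c.len k) → c.len k - s ∈ Icc 0 (c.len k) := fun hs =>
          ⟨sub_nonneg.2 hs.2, by linarith [hs.1]⟩
        rw [← sub_sub_cancel (c.len k) t, ← sub_sub_cancel (c.len k) t', ← h3, ← h3,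
          c.toCircle_point hk (hmem ht), c.toCircle_point hk (hmem ht')]
        exact (hnorm _ _).trans_eq (by rw [abs_sub_comm]; congr 1; ring)
    calc _ = ‖(c.toCircle (Γ.loc e t) - c.toCircle (Γ.loc e t')) +
          (c.toCircle (Γ.loc e t') - c.toCircle y)‖ := by congr 1; abel
      _ ≤ _ := (norm_add_le _ _).trans (add_le_add key ih)

omit [Fintype E] in
theorem isPathLength_vert {i j : ℕ} (hij : i ≤ j) (hj : j < n) :
    Γ.IsPathLength (c.point i 0) (c.point j 0) (c.pos j - c.pos i) := by
  induction j, hij using Nat.le_induction with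
  | base => simpa using IsPathLength.refl _
  | succ j hij ih =>
    have h1 := (ih (by omega)).trans (c.isPathLength_point (k := j) (by omega)
      ⟨le_rfl, (c.len_pos j).le⟩ ⟨(c.len_pos j).le, le_rfl⟩)
    rw [c.point_len hj, zero_sub, abs_neg, abs_of_pos (c.len_pos j)] at h1
    rwa [pos_succ, add_sub_right_comm]

omit [Fintype E] in
theorem isPathLength_forward {k k' : ℕ} (hk' : k' < n) {t t' : ℝ}
    (ht : t ∈ Icc 0 (c.len k)) (ht' : t' ∈ Icc 0 (c.len k')) (hkk : k ≤ k')
    (h : c.pos k + t ≤ c.pos k' + t') :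
    Γ.IsPathLength (c.point k t) (c.point k' t') (c.pos k' + t' - (c.pos k + t)) := by
  rcases hkk.eq_or_lt with rfl | hlt
  · have h1 := c.isPathLength_point hk' ht ht'
    rw [abs_sub_comm, abs_of_nonneg (by linarith)] at h1
    convert h1 using 1
    ring
  · have h1 := c.isPathLength_point (k := k) (by omega) ht ⟨(c.len_pos k).le, le_rfl⟩
    rw [c.point_len (by omega)] at h1
    have h2 := c.isPathLength_vert (show k + 1 ≤ k' from hlt) hk'
    have h3 := c.isPathLength_point hk' ⟨le_rfl, (c.len_pos k').le⟩ ht'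
    have h4 := h1.trans (h2.trans h3)
    rw [abs_sub_comm, abs_of_nonneg (by linarith [ht.2]), zero_sub, abs_neg,
      abs_of_nonneg ht'.1] at h4
    convert h4 using 1
    rw [pos_succ]
    ring

theorem isPathLength_to_end {k : ℕ} (hk : k < n) {t : ℝ} (ht : t ∈ Icc 0 (c.len k)) :
    Γ.IsPathLength (c.point k t) (c.point 0 0) (Γ.totalLength - (c.pos k + t)) := by
  obtain ⟨m, rfl⟩ : ∃ m, n = m + 1 := ⟨n - 1, by omega⟩
  have h1 := c.isPathLength_forward (k' := m) (by omega) ht ⟨(c.len_pos m).le, le_rfl⟩ (by omega)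
    (by
      rw [← pos_succ, ← c.totalLength_eq]
      exact (c.pos_add_mem hk ht).2)
  rwa [c.point_last m rfl, ← pos_succ, ← c.totalLength_eq] at h1

/-- The quotient norm is the length of the shorter of two arcs. Both are lengths of actual paths:
one runs forward, the other passes through vertex number `0`. -/
theorem geodDist_le_norm (x y : Γ.Point) : Γ.geodDist x y ≤ ‖c.toCircle x - c.toCircle y‖ := by
  obtain ⟨k, hk, t, ht, rfl⟩ := c.exists_point x
  obtain ⟨k', hk', t', ht', rfl⟩ := c.exists_point y
  wlog hkk : c.pos k + t ≤ c.pos k' + t' generalizing k k' t t'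
  · have h1 := this k' hk' t' ht' k hk t ht (le_of_not_ge hkk)
    rw [norm_sub_rev]
    exact (dist_comm (α := Γ.Point) _ _).trans_le h1
  have hle : Γ.IsPathLength (c.point k t) (c.point k' t') (c.pos k' + t' - (c.pos k + t)) := by
    rcases le_or_gt k k' with h | h
    · exact c.isPathLength_forward hk' ht ht' h hkk
    -- The first point lies on a later edge but not at a later position, so both positions agree and
    -- the path has length zero.
    · have h1 := c.pos_strictMono.monotone (show k' + 1 ≤ k from h)
      rw [pos_succ] at h1
      have h2 := c.isPathLength_forward hk ht' ht h.le (by linarith [ht.1, ht'.2])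
      have : c.pos k + t = c.pos k' + t' := le_antisymm hkk (by linarith [ht.1, ht'.2])
      rw [this, sub_self] at h2 ⊢
      exact h2.symm
  have m1 := c.pos_add_mem hk ht
  have m2 := c.pos_add_mem hk' ht'
  have habs : |c.pos k + t - (c.pos k' + t')| = c.pos k' + t' - (c.pos k + t) := by
    rw [abs_of_nonpos (by linarith), neg_sub]
  rw [c.toCircle_point hk ht, c.toCircle_point hk' ht', ← AddCircle.coe_sub,
    AddCircle.norm_coe_eq_min c.totalLength_pos (by rw [habs]; linarith [m1.1, m2.2]), habs]
  refine le_min (geodDist_le hle) (geodDist_le ?_)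
  have h0 : 0 < n := by omega
  have h1 := c.isPathLength_forward hk (t := 0) (k := 0) ⟨le_rfl, (c.len_pos 0).le⟩ ht (by omega)
    (by simpa using m1.1)
  have h2 := ((c.isPathLength_to_end hk' ht').trans h1).symm
  convert h2 using 1
  simp
  ring

theorem isometry_toCircle : Isometry c.toCircle := by
  refine Isometry.of_dist_eq fun x y => ?_
  rw [dist_eq_norm]
  exact le_antisymm (le_csInf (Γ.exists_isPathLength x y) fun L hL =>
    c.norm_toCircle_sub_le_of_isPathLength hL) (c.geodDist_le_norm x y)

theorem exists_pos_add_eq {a : ℝ} (ha : a ∈ Icc 0 Γ.totalLength) :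
    ∃ k < n, ∃ t ∈ Icc 0 (c.len k), a = c.pos k + t := by
  have key : ∀ m, 0 < m → a ≤ c.pos m → ∃ k < m, ∃ t ∈ Icc 0 (c.len k), a = c.pos k + t := by
    intro m hm h
    induction m with
    | zero => omega
    | succ m ih =>
      rcases le_or_gt (c.pos m) a with h1 | h1
      · rw [pos_succ] at h
        exact ⟨m, by omega, a - c.pos m, ⟨by linarith, by linarith⟩, by ring⟩
      · rcases Nat.eq_zero_or_pos m with rfl | hm
        · rw [pos_zero] at h1
          linarith [ha.1]
        · obtain ⟨k, hk, h2⟩ := ih hm h1.le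
          exact ⟨k, by omega, h2⟩
  exact key n (by have := c.three_le; omega) (c.totalLength_eq ▸ ha.2)

theorem surjective_toCircle : Function.Surjective c.toCircle := by
  have : Fact (0 < Γ.totalLength) := ⟨c.totalLength_pos⟩
  intro y
  obtain ⟨a, ha, rfl⟩ := AddCircle.eq_coe_Ico y
  obtain ⟨k, hk, t, ht, rfl⟩ := c.exists_pos_add_eq ⟨ha.1, ha.2.le⟩
  exact ⟨_, c.toCircle_point hk ht⟩

/-- A cycle is isometric to the circle of the same length. -/
noncomputable def circleEquiv : Γ.Point ≃ᵢ AddCircle Γ.totalLength :=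
  ⟨Equiv.ofBijective _ ⟨c.isometry_toCircle.injective, c.surjective_toCircle⟩, c.isometry_toCircle⟩

theorem circleEquiv_point {k : ℕ} (hk : k < n) {t : ℝ} (ht : t ∈ Icc 0 (c.len k)) :
    c.circleEquiv (c.point k t) = ((c.pos k + t : ℝ) : AddCircle Γ.totalLength) :=
  c.toCircle_point hk ht

/-- Up to a reflection of reversed edges, each edge is translated onto an interval. Dropping end
points, which are null, these intervals tile the fundamental domain `(0, ℓ]`. -/
theorem measurePreserving_circleEquiv (h : Fact (0 < Γ.totalLength)) :
    MeasurePreserving c.circleEquiv Γ.lebesgue volume := by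
  refine ⟨c.circleEquiv.continuous.measurable, ?_⟩
  have hcont : ∀ k, Continuous (c.point k) := fun k => by
    by_cases h : Γ.src (c.edge k) = c.vert k
    · rw [show c.point k = Γ.loc (c.edge k) from funext fun t => if_pos h]
      exact Γ.continuous_loc _
    · rw [show c.point k = Γ.loc (c.edge k) ∘ fun t => c.len k - t from funext fun t => if_neg h]
      exact (Γ.continuous_loc _).comp (continuous_const.sub continuous_id)
  have h1 : ∀ k < n, ((volume.restrict (Icc 0 (Γ.len (c.edge k)))).map (Γ.loc (c.edge k))) =
      (volume.restrict (Icc 0 (c.len k))).map (c.point k) := by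
    intro k hk
    rcases c.ends_cases hk with ⟨-, -, h3⟩ | ⟨-, -, h3⟩
    · rw [show c.point k = Γ.loc (c.edge k) from funext h3]
      rfl
    · have hmp : MeasurePreserving (fun t : ℝ => c.len k - t) (volume.restrict (Icc 0 (c.len k)))
          (volume.restrict (Icc 0 (c.len k))) := by
        have := (Measure.measurePreserving_sub_left (volume : Measure ℝ) (c.len k)).restrict_preimage
          (measurableSet_Icc (a := 0) (b := c.len k))
        simpa using this
      rw [show c.point k = Γ.loc (c.edge k) ∘ (fun t => c.len k - t) from funext h3,
        ← Measure.map_map (Γ.continuous_loc _).measurable hmp.measurable, hmp.map_eq]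
      rfl
  have h2 : ∀ k < n, ((volume.restrict (Icc 0 (c.len k))).map (c.point k)).map c.circleEquiv =
      (volume.restrict (Ioc (c.pos k) (c.pos (k + 1)))).map
        ((↑) : ℝ → AddCircle Γ.totalLength) := by
    intro k hk
    rw [Measure.map_map c.circleEquiv.continuous.measurable (hcont k).measurable]
    have h3 : (volume.restrict (Icc 0 (c.len k))).map (c.circleEquiv ∘ c.point k) =
        (volume.restrict (Icc 0 (c.len k))).map
          (((↑) : ℝ → AddCircle Γ.totalLength) ∘ fun t => c.pos k + t) := by
      refine Measure.map_congr ?_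
      filter_upwards [ae_restrict_mem measurableSet_Icc] with t ht
      exact c.circleEquiv_point hk ht
    have hmp : MeasurePreserving (fun t : ℝ => c.pos k + t) (volume.restrict (Icc 0 (c.len k)))
        (volume.restrict (Icc (c.pos k) (c.pos (k + 1)))) := by
      have := (measurePreserving_add_left (volume : Measure ℝ) (c.pos k)).restrict_preimage
          (measurableSet_Icc (a := c.pos k) (b := c.pos (k + 1)))
      simpa [pos_succ] using this
    rw [h3, ← Measure.map_map AddCircle.measurable_mk' hmp.measurable, hmp.map_eq,
      Measure.restrict_congr_set Ioc_ae_eq_Icc]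
  have h3 : ∀ m ≤ n, ∑ k ∈ Finset.range m, (volume.restrict (Ioc (c.pos k) (c.pos (k + 1)))).map
        ((↑) : ℝ → AddCircle Γ.totalLength) = (volume.restrict (Ioc 0 (c.pos m))).map
        ((↑) : ℝ → AddCircle Γ.totalLength) := by
    intro m hm
    induction m with
    | zero => simp
    | succ m ih =>
      rw [Finset.sum_range_succ, ih (by omega), ← Measure.map_add _ _ AddCircle.measurable_mk',
        ← Measure.restrict_union (Ioc_disjoint_Ioc_of_le le_rfl) measurableSet_Ioc,
        Ioc_union_Ioc_eq_Ioc (c.pos_nonneg m) (c.pos_strictMono.monotone (by omega))]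
  rw [lebesgue, c.sum_edge, Finset.sum_congr rfl fun k hk => h1 k (Finset.mem_range.1 hk)]
  have h4 : ∀ s : Finset ℕ, (∑ k ∈ s, (volume.restrict (Icc 0 (c.len k))).map (c.point k)).map
      c.circleEquiv = ∑ k ∈ s, ((volume.restrict (Icc 0 (c.len k))).map (c.point k)).map
      c.circleEquiv := by
    intro s
    induction s using Finset.cons_induction with
    | empty => simp
    | cons a s ha ih =>
      rw [Finset.sum_cons, Finset.sum_cons, Measure.map_add _ _
        c.circleEquiv.continuous.measurable, ih]
  rw [h4, Finset.sum_congr rfl fun k hk => h2 k (Finset.mem_range.1 hk), h3 n le_rfl,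
    ← c.totalLength_eq]
  have := (AddCircle.measurePreserving_mk Γ.totalLength 0).map_eq
  rwa [zero_add] at this

end CyclicOrder

end MetricGraph

/-! ### The resistance metric of a cycle -/

namespace MetricGraph

variable {V E : Type*}

/-- The resistance between two points at distance `h` on a circle of length `ℓ`. -/
noncomputable def circleResistance (ℓ h : ℝ) : ℝ := h - h ^ 2 / ℓ

/-- `h - h²/ℓ` is invariant under `h ↦ ℓ - h`, so either of the two arcs may be used. -/
theorem circleResistance_norm {ℓ a : ℝ} (hℓ : 0 < ℓ) (ha : |a| ≤ ℓ) :
    circleResistance ℓ ‖(a : AddCircle ℓ)‖ = circleResistance ℓ |a| := by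
  rw [AddCircle.norm_coe_eq_min hℓ ha]
  rcases min_choice |a| (ℓ - |a|) with h | h
  · rw [h]
  · rw [h, circleResistance, circleResistance]
    field_simp
    ring

namespace CyclicOrder

variable [Fintype V] [Fintype E] {Γ : MetricGraph V E} {n : ℕ} (c : Γ.CyclicOrder n)

/-- The position of a vertex. -/
noncomputable def posV (v : V) : ℝ := c.pos (c.vert_surj v).choose

/-- The resistance between two vertices. -/
noncomputable def res (v w : V) : ℝ := circleResistance Γ.totalLength |c.posV v - c.posV w|

omit [Fintype V] in
theorem res_comm (v w : V) : c.res v w = c.res w v := by rw [res, res, abs_sub_comm]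

omit [Fintype V] in
theorem res_self (v : V) : c.res v v = 0 := by simp [res, circleResistance]

-- The index chosen in `posV` is below `n`, so vertex number `n` gets position `0` instead of `ℓ`.
omit [Fintype V] [Fintype E] in
theorem posV_vert {i : ℕ} (hi : i ≤ n) :
    c.posV (c.vert i) = c.pos i ∨ i = n ∧ c.posV (c.vert i) = 0 := by
  have h := (c.vert_surj (c.vert i)).choose_spec
  rw [eq_comm, c.vert_eq_iff h.1 hi] at h
  rcases h.2 with h2 | ⟨h2, h3⟩
  · left
    rw [posV, ← h2]
  · right
    rw [posV, h3, pos_zero]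
    exact ⟨h2, rfl⟩

omit [Fintype V] in
theorem pos_mem {i : ℕ} (hi : i ≤ n) : c.pos i ∈ Icc 0 Γ.totalLength :=
  ⟨c.pos_nonneg i, c.totalLength_eq ▸ c.pos_strictMono.monotone hi⟩

-- The index `n` is allowed: the symmetry `h ↦ ℓ - h` makes positions `0` and `ℓ` interchangeable.
omit [Fintype V] in
theorem res_vert {i j : ℕ} (hi : i ≤ n) (hj : j ≤ n) :
    c.res (c.vert i) (c.vert j) = circleResistance Γ.totalLength |c.pos i - c.pos j| := by
  have key : ∀ b ∈ Icc 0 Γ.totalLength, circleResistance Γ.totalLength |0 - b| =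
      circleResistance Γ.totalLength |Γ.totalLength - b| := by
    intro b hb
    have := c.totalLength_pos
    rw [abs_of_nonneg (sub_nonneg.2 hb.2), zero_sub, abs_neg, abs_of_nonneg hb.1,
      circleResistance, circleResistance]
    field_simp
    ring
  have hm := c.pos_mem hi
  have hm' := c.pos_mem hj
  have hn := c.totalLength_eq
  have := c.totalLength_pos
  rcases c.posV_vert hi with h1 | ⟨rfl, h1⟩ <;> rcases c.posV_vert hj with h2 | ⟨rfl, h2⟩
  · rw [res, h1, h2]
  · rw [res, h1, h2, abs_sub_comm, key _ hm, abs_sub_comm, hn]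
  · rw [res, h1, h2, key _ hm', hn]
  · simp [res]

-- Distance consistency enters here: it turns the inverse geodesic distance in the conductance into
-- an inverse edge length.
omit [Fintype V] in
open Classical in
theorem conductance_eq (h : Γ.HasEuclideanEdges) (v w : V) :
    Γ.conductance v w = ∑ k ∈ Finset.range n, 1 / c.len k *
      ((if c.vert k = v then if c.vert (k + 1) = w then 1 else 0 else 0) +
        if c.vert (k + 1) = v then if c.vert k = w then 1 else 0 else 0) := by
  rw [conductance, c.sum_edge]
  refine Finset.sum_congr rfl fun k hk => ?_
  rw [Finset.mem_range] at hk
  have hne := c.vert_ne_succ hk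
  rw [h, c.ends k hk, show Γ.len (c.edge k) = c.len k from rfl]
  by_cases h1 : c.vert k = v
  · subst h1
    simp [hne.symm]
  · by_cases h2 : c.vert (k + 1) = v
    · subst h2
      simp [hne]
    · simp [h1, h2]

include c in
omit [Fintype V] in
theorem conductance_self (h : Γ.HasEuclideanEdges) (v : V) : Γ.conductance v v = 0 := by
  classical
  rw [c.conductance_eq h]
  refine Finset.sum_eq_zero fun k hk => ?_
  have hne := c.vert_ne_succ (Finset.mem_range.1 hk)
  by_cases h1 : c.vert k = v
  · subst h1
    simp [hne.symm]
  · simp [h1]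

-- The graph Laplacian is minus the divergence of the slopes: at a vertex, the slope on the incoming
-- edge minus the slope on the outgoing one.
open Classical in
theorem sum_conductance_mul (h : Γ.HasEuclideanEdges) (f : V → ℝ) (v : V) :
    ∑ w, Γ.conductance v w * (f v - f w) = ∑ k ∈ Finset.range n,
      ((if c.vert (k + 1) = v then 1 else 0) - if c.vert k = v then 1 else 0) *
        ((f (c.vert (k + 1)) - f (c.vert k)) / c.len k) := by
  simp_rw [c.conductance_eq h, Finset.sum_mul]
  rw [Finset.sum_comm]
  refine Finset.sum_congr rfl fun k hk => ?_
  have hne := c.vert_ne_succ (Finset.mem_range.1 hk)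
  by_cases h1 : c.vert k = v
  · subst h1
    simp [hne.symm, mul_ite, ite_mul]
    ring
  · by_cases h2 : c.vert (k + 1) = v
    · subst h2
      simp [hne, mul_ite, ite_mul]
      ring
    · simp [h1, h2]

-- The absolute value contributes slope `±1`, the quadratic term its mean slope. The jump by `2` at
-- vertex number `m` is the point mass that makes the resistance behave like a Green function.
omit [Fintype V] in
theorem slope_res {m k : ℕ} (hm : m < n) (hk : k < n) :
    (c.res (c.vert (k + 1)) (c.vert m) - c.res (c.vert k) (c.vert m)) / c.len k =
      (if m ≤ k then 2 else 0) - 1 - (c.pos (k + 1) + c.pos k - 2 * c.pos m) / Γ.totalLength := by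
  have hl := c.len_pos k
  have hL := c.totalLength_pos
  rw [c.res_vert hk hm.le, c.res_vert hk.le hm.le, circleResistance, circleResistance,
    sq_abs, sq_abs]
  split_ifs with h
  · have h1 := c.pos_strictMono.monotone h
    rw [pos_succ, abs_of_nonneg (by linarith), abs_of_nonneg (by linarith)]
    field_simp
    ring
  · have h1 := c.pos_strictMono.monotone (show k + 1 ≤ m by omega)
    rw [pos_succ] at *
    rw [abs_of_nonpos (by linarith), abs_of_nonpos (by linarith)]
    field_simp
    ring

-- In a difference of two resistance functions the quadratic terms contribute the same constant to
-- every slope. Taking the divergence removes it and leaves only the two jumps.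
open Classical in
theorem sum_conductance_res (h : Γ.HasEuclideanEdges) (u v w : V) :
    ∑ z, Γ.conductance v z * ((c.res v u - c.res z u) - (c.res v w - c.res z w)) =
      2 * ((if v = w then 1 else 0) - if v = u then 1 else 0) := by
  obtain ⟨a, ha, rfl⟩ := c.vert_surj u
  obtain ⟨b, hb, rfl⟩ := c.vert_surj w
  obtain ⟨j, hj, rfl⟩ := c.vert_surj v
  have h3 := c.three_le
  have h1 := c.sum_conductance_mul h (fun z => c.res z (c.vert a) - c.res z (c.vert b)) (c.vert j)
  -- The edge that ends at vertex number `j` has number `j - 1`, or `n - 1` if `j = 0`.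
  have h2 : ∀ k ∈ Finset.range n,
      ((if c.vert (k + 1) = c.vert j then 1 else 0) - if c.vert k = c.vert j then 1 else 0) *
        ((c.res (c.vert (k + 1)) (c.vert a) - c.res (c.vert (k + 1)) (c.vert b) -
          (c.res (c.vert k) (c.vert a) - c.res (c.vert k) (c.vert b))) / c.len k) =
      (if k = if j = 0 then n - 1 else j - 1 then ((if a ≤ k then 2 else 0) -
        (if b ≤ k then 2 else 0) + 2 * (c.pos a - c.pos b) / Γ.totalLength) else 0) -
      if k = j then ((if a ≤ k then 2 else 0) -
        (if b ≤ k then 2 else 0) + 2 * (c.pos a - c.pos b) / Γ.totalLength) else 0 := by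
    intro k hk
    rw [Finset.mem_range] at hk
    have h4 : (c.res (c.vert (k + 1)) (c.vert a) - c.res (c.vert (k + 1)) (c.vert b) -
          (c.res (c.vert k) (c.vert a) - c.res (c.vert k) (c.vert b))) / c.len k =
        (if a ≤ k then 2 else 0) -
        (if b ≤ k then 2 else 0) + 2 * (c.pos a - c.pos b) / Γ.totalLength := by
      rw [sub_sub_sub_comm, sub_div, c.slope_res ha hk, c.slope_res hb hk]
      ring
    rw [h4, c.vert_eq_iff hj hk, c.vert_eq_iff hj hk.le]
    have e1 : (k + 1 = j ∨ k + 1 = n ∧ j = 0) ↔ k = if j = 0 then n - 1 else j - 1 := by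
      split_ifs <;> omega
    have e2 : (k = j ∨ k = n ∧ j = 0) ↔ k = j := by omega
    simp only [e1, e2]
    rw [sub_mul, ite_mul, ite_mul, one_mul, zero_mul]
  rw [Finset.sum_congr rfl h2, Finset.sum_sub_distrib, Finset.sum_ite_eq', Finset.sum_ite_eq',
    if_pos (Finset.mem_range.2 hj), if_pos (Finset.mem_range.2 (by split_ifs <;> omega))] at h1
  refine (Finset.sum_congr rfl fun z _ => ?_).trans (h1.trans ?_)
  · ring
  · rw [c.vert_eq_iff hb hj.le, c.vert_eq_iff ha hj.le]
    have e1 : (j = a ∨ j = n ∧ a = 0) ↔ j = a := by omega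
    have e2 : (j = b ∨ j = n ∧ b = 0) ↔ j = b := by omega
    simp only [e1, e2]
    rcases Nat.eq_zero_or_pos j with rfl | hj0
    · simp only [if_true]
      rw [if_pos (by omega), if_pos (by omega)]
      simp only [Nat.le_zero, eq_comm (a := (0 : ℕ))]
      split_ifs <;> ring
    · simp only [hj0.ne', if_false]
      have e3 : ∀ m : ℕ, ((if m ≤ j then 2 else 0 : ℝ)) =
          (if m ≤ j - 1 then 2 else 0) + if j = m then 2 else 0 := by
        intro m
        rcases lt_trichotomy j m with h | h | h
        · rw [if_neg (by omega), if_neg (by omega), if_neg (by omega)]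
          norm_num
        · rw [if_pos (by omega), if_neg (by omega), if_pos (by omega)]
          norm_num
        · rw [if_pos (by omega), if_pos (by omega), if_neg (by omega)]
          norm_num
      rw [e3 a, e3 b]
      split_ifs <;> ring

/-- Half of `R(v, v₀) + R(w, v₀) - R(v, w)` is the Green function grounded at `v₀`: its Laplacian is
`δ_w - δ_{v₀}`, and it vanishes at `v = v₀`. The summand `1` meets the extra diagonal entry at `v₀`
and cancels `-δ_{v₀}`. -/
theorem inv_resistMatrix (h : Γ.HasEuclideanEdges) (v₀ : V) [DecidableEq V] :
    (Γ.resistMatrix v₀)⁻¹ =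
      Matrix.of fun v w => 1 + (c.res v v₀ + c.res w v₀ - c.res v w) / 2 := by
  refine Matrix.inv_eq_right_inv ?_
  ext v w
  rw [Matrix.mul_apply]
  simp only [resistMatrix, Matrix.of_apply]
  set G : V → V → ℝ := fun v w => 1 + (c.res v v₀ + c.res w v₀ - c.res v w) / 2 with hG
  have h1 : ∀ u, (if v = u then (if v = v₀ then 1 else 0) + ∑ w', Γ.conductance v w'
      else -Γ.conductance v u) * G u w =
      (if v = u then ((if v = v₀ then 1 else 0) + ∑ w', Γ.conductance v w') * G v w else 0) -
        Γ.conductance v u * G u w := by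
    intro u
    by_cases hu : v = u
    · subst hu
      simp [c.conductance_self h]
    · simp [hu]
  have h2 := c.sum_conductance_res h v₀ v w
  have h3 : ∑ z, Γ.conductance v z * ((c.res v v₀ - c.res z v₀) - (c.res v w - c.res z w)) =
      2 * ((∑ z, Γ.conductance v z) * G v w - ∑ z, Γ.conductance v z * G z w) := by
    rw [Finset.sum_mul, ← Finset.sum_sub_distrib, Finset.mul_sum]
    refine Finset.sum_congr rfl fun z _ => ?_
    simp only [hG]
    ring
  rw [h3] at h2
  have h4 := mul_left_cancel₀ (by norm_num) h2
  calc _ = ∑ u, ((if v = u then ((if v = v₀ then 1 else 0) + ∑ w', Γ.conductance v w') * G v w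
        else 0) - Γ.conductance v u * G u w) := by
        refine Finset.sum_congr rfl fun u _ => ?_
        rw [← h1]
        congr 1
        split_ifs <;> rfl
    _ = _ := by
      rw [Finset.sum_sub_distrib, Finset.sum_ite_eq, if_pos (Finset.mem_univ _), add_mul,
        add_sub_assoc, h4, Matrix.one_apply]
      by_cases hv : v = v₀
      · subst hv
        simp [hG, c.res_self, c.res_comm w v]
      · simp [hv]

omit [Fintype E] in
theorem sum_point {k : ℕ} (hk : k < n) {t : ℝ} (ht : t ∈ Icc 0 (c.len k)) (f : V → ℝ) :
    ∑ v, (c.point k t).1 v * f v =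
      (1 - t / c.len k) * f (c.vert k) + t / c.len k * f (c.vert (k + 1)) := by
  classical
  simp_rw [c.point_val hk ht, add_mul, Finset.sum_add_distrib, mul_assoc, ← Finset.mul_sum]
  simp

/-- The bilinear extension of the resistance between vertices. -/
noncomputable def resBilin (x y : Γ.Point) : ℝ := ∑ v, x.1 v * ∑ w, y.1 w * c.res v w

/-- Barycentric coordinates sum to one, so constants and terms in one vertex keep their form under
interpolation. These cancel in the variogram, leaving the bilinear part. -/
theorem vertexFieldCov_eq (h : Γ.HasEuclideanEdges) (v₀ : V) (x y : Γ.Point) :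
    Γ.vertexFieldCov v₀ x y = 1 + (∑ v, x.1 v * c.res v v₀) / 2 + (∑ v, y.1 v * c.res v v₀) / 2 -
      c.resBilin x y / 2 := by
  have hone : ∀ x : Γ.Point, ∑ v, x.1 v = 1 := fun x => by
    obtain ⟨k, hk, t, ht, rfl⟩ := c.exists_point x
    have := c.sum_point hk ht (fun _ => 1)
    simpa using this
  classical
  rw [vertexFieldCov, c.inv_resistMatrix h]
  simp only [Matrix.of_apply]
  have h1 : ∀ v, ∑ w, x.1 v * (1 + (c.res v v₀ + c.res w v₀ - c.res v w) / 2) * y.1 w =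
      x.1 v * (1 + c.res v v₀ / 2 + (∑ w, y.1 w * c.res w v₀) / 2 -
        (∑ w, y.1 w * c.res v w) / 2) := by
    intro v
    have h2 : ∀ w, x.1 v * (1 + (c.res v v₀ + c.res w v₀ - c.res v w) / 2) * y.1 w =
        x.1 v * ((1 + c.res v v₀ / 2) * y.1 w + (y.1 w * c.res w v₀) / 2 -
          (y.1 w * c.res v w) / 2) := fun w => by ring
    simp_rw [h2]
    rw [← Finset.mul_sum, Finset.sum_sub_distrib, Finset.sum_add_distrib, ← Finset.mul_sum, hone,
      Finset.sum_div, Finset.sum_div, mul_one]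
  simp_rw [h1, mul_sub, mul_add, mul_one]
  rw [Finset.sum_sub_distrib, Finset.sum_add_distrib, Finset.sum_add_distrib, hone,
    ← Finset.sum_mul, hone, one_mul, resBilin]
  simp_rw [← mul_div_assoc, ← Finset.sum_div]

-- The Brownian bridge covariance is invariant under time reversal, so the orientation of the edge
-- is irrelevant.
omit [Fintype V] [Fintype E] in
theorem bridgeCov_point_self {k : ℕ} (hk : k < n) {t t' : ℝ}
    (ht : t ∈ Icc 0 (c.len k)) (ht' : t' ∈ Icc 0 (c.len k)) :
    Γ.bridgeCov (c.edge k) (c.point k t) (c.point k t') = min t t' - t * t' / c.len k := by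
  classical
  have hl := c.len_pos k
  have hne := c.vert_ne_succ hk
  rcases c.ends_cases hk with ⟨h1, h2, h3⟩ | ⟨h1, h2, h3⟩
  · have hp : ∀ {s}, s ∈ Icc 0 (c.len k) → Γ.edgeParam (c.edge k) (c.point k s) = s := by
      intro s hs
      rw [edgeParam, h2, c.point_val hk hs, show Γ.len (c.edge k) = c.len k from rfl]
      simp [hne]
      field_simp
    rw [bridgeCov, if_pos ⟨⟨t, ht, h3 t⟩, ⟨t', ht', h3 t'⟩⟩, hp ht, hp ht']
    rfl
  · have hp : ∀ {s}, s ∈ Icc 0 (c.len k) →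
        Γ.edgeParam (c.edge k) (c.point k s) = c.len k - s := by
      intro s hs
      rw [edgeParam, h2, c.point_val hk hs, show Γ.len (c.edge k) = c.len k from rfl]
      simp [hne.symm]
      field_simp
    have hm : ∀ {s}, s ∈ Icc 0 (c.len k) → c.len k - s ∈ Icc 0 (c.len k) := fun hs =>
      ⟨sub_nonneg.2 hs.2, by linarith [hs.1]⟩
    rw [bridgeCov, if_pos ⟨⟨_, hm ht, h3 t⟩, ⟨_, hm ht', h3 t'⟩⟩, hp ht, hp ht',
      show Γ.len (c.edge k) = c.len k from rfl]
    rcases le_total t t' with h | h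
    · rw [min_eq_right (by linarith), min_eq_left h]
      field_simp
      ring
    · rw [min_eq_left (by linarith), min_eq_right h]
      field_simp
      ring

-- A point on two different edges is a vertex: an inner point of edge `j` has its position strictly
-- between `pos j` and `pos (j + 1)`, where no point of edge `k` lies.
omit [Fintype V] in
theorem edgeParam_of_ne {k j : ℕ} (hk : k < n) (hj : j < n) (hjk : j ≠ k) {t : ℝ}
    (ht : t ∈ Icc 0 (c.len k)) (h : Γ.OnEdge (c.edge j) (c.point k t)) :
    Γ.edgeParam (c.edge j) (c.point k t) = 0 ∨
      Γ.edgeParam (c.edge j) (c.point k t) = Γ.len (c.edge j) := by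
  classical
  have hl := c.len_pos j
  obtain ⟨s, hs, hx⟩ : ∃ s ∈ Icc 0 (c.len j), c.point k t = c.point j s := by
    obtain ⟨s, hs, hx⟩ := h
    rcases c.ends_cases hj with ⟨-, -, h3⟩ | ⟨-, -, h3⟩
    · exact ⟨s, hs, hx.trans (h3 s).symm⟩
    · exact ⟨c.len j - s, ⟨sub_nonneg.2 hs.2, by linarith [hs.1]⟩,
        by rw [h3, sub_sub_cancel, hx]⟩
  have hs' : s = 0 ∨ s = c.len j := by
    by_contra! hcon
    have h0 : 0 < s := hs.1.lt_of_ne' hcon.1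
    have h1 : s < c.len j := hs.2.lt_of_ne hcon.2
    have h2 := c.coe_pos_add_eq hk hj ht hs hx
    have m1 := c.pos_add_mem hk ht
    have m3 := c.pos_nonneg j
    have m4 := (c.pos_mem (show j + 1 ≤ n from hj)).2
    rw [pos_succ] at m4
    rw [← sub_eq_zero, ← AddCircle.coe_sub] at h2
    have h3 := AddCircle.norm_coe_eq_min (p := Γ.totalLength) (x := c.pos k + t - (c.pos j + s))
      c.totalLength_pos (abs_le.2 ⟨by linarith [m1.1], by linarith [m1.2]⟩)
    rw [h2, norm_zero] at h3
    have h4 : |c.pos k + t - (c.pos j + s)| < Γ.totalLength :=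
      abs_lt.2 ⟨by linarith [m1.1], by linarith [m1.2]⟩
    have h5 : |c.pos k + t - (c.pos j + s)| = 0 := by
      rcases min_choice |c.pos k + t - (c.pos j + s)|
        (Γ.totalLength - |c.pos k + t - (c.pos j + s)|) with h | h <;> linarith
    have h6 := abs_eq_zero.1 h5
    rcases lt_or_gt_of_ne hjk with h | h
    · have := c.pos_strictMono.monotone (show j + 1 ≤ k from h)
      rw [pos_succ] at this
      linarith [ht.1]
    · have := c.pos_strictMono.monotone (show k + 1 ≤ j from h)
      rw [pos_succ] at this
      linarith [ht.2]
  have hne := c.vert_ne_succ hj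
  rw [hx, edgeParam, c.point_val hj hs]
  rcases c.ends_cases hj with ⟨-, h2, -⟩ | ⟨-, h2, -⟩ <;> rcases hs' with rfl | rfl <;>
    simp [h2, hne, hne.symm, hl.ne']

omit [Fintype V] [Fintype E] in
theorem _root_.MetricGraph.bridgeCov_comm (Γ : MetricGraph V E) (e : E) (x y : Γ.Point) :
    Γ.bridgeCov e x y = Γ.bridgeCov e y x := by
  by_cases h : Γ.OnEdge e x ∧ Γ.OnEdge e y
  · rw [bridgeCov, bridgeCov, if_pos h, if_pos h.symm, min_comm, mul_comm (Γ.edgeParam e x)]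
  · rw [bridgeCov, bridgeCov, if_neg h, if_neg fun h' => h h'.symm]

-- A point of edge `k` can lie on edge `j` only as an end point of it, where the bridge vanishes.
omit [Fintype V] in
theorem bridgeCov_of_ne {k j : ℕ} (hk : k < n) (hj : j < n) (hjk : j ≠ k) {t : ℝ}
    (ht : t ∈ Icc 0 (c.len k)) (y : Γ.Point) :
    Γ.bridgeCov (c.edge j) (c.point k t) y = 0 := by
  classical
  have hl := Γ.len_pos (c.edge j)
  by_cases h : Γ.OnEdge (c.edge j) (c.point k t) ∧ Γ.OnEdge (c.edge j) y
  · rw [bridgeCov, if_pos h]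
    obtain ⟨s, hs, hy⟩ := h.2
    have hps : Γ.edgeParam (c.edge j) y = s := by
      have hne := Γ.src_ne_tgt (c.edge j)
      rw [edgeParam, hy, loc_val Γ _ hs, coord, if_neg hne.symm, if_pos rfl]
      field_simp
    rw [hps]
    rcases c.edgeParam_of_ne hk hj hjk ht h.1 with h0 | h0
    · rw [h0, min_eq_left hs.1]
      simp
    · rw [h0, min_eq_right hs.2]
      field_simp
      ring
  · rw [bridgeCov, if_neg h]

omit [Fintype V] in
theorem sum_bridgeCov {k k' : ℕ} (hk : k < n) (hk' : k' < n) {t t' : ℝ}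
    (ht : t ∈ Icc 0 (c.len k)) (ht' : t' ∈ Icc 0 (c.len k')) :
    ∑ e, Γ.bridgeCov e (c.point k t) (c.point k' t') =
      if k = k' then min t t' - t * t' / c.len k else 0 := by
  rw [c.sum_edge]
  split_ifs with h
  · subst h
    rw [Finset.sum_eq_single_of_mem k (Finset.mem_range.2 hk) fun j hj hjk =>
      c.bridgeCov_of_ne hk (Finset.mem_range.1 hj) hjk ht _, c.bridgeCov_point_self hk ht ht']
  · refine Finset.sum_eq_zero fun j hj => ?_
    rw [Finset.mem_range] at hj
    by_cases hjk : j = k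
    · rw [bridgeCov_comm, c.bridgeCov_of_ne hk' hj (hjk ▸ h) ht']
    · exact c.bridgeCov_of_ne hk hj hjk ht _

-- A field with variogram `h - h²/ℓ` splits into its linear interpolation between vertices and
-- independent bridges on the edges, as a Brownian bridge does. The check expands everything: the
-- order of the two edges fixes the signs inside the absolute values, and a rational identity
-- remains.
include c in
theorem resistDist_eq (h : Γ.HasEuclideanEdges) (v₀ : V) (x y : Γ.Point) :
    Γ.resistDist v₀ x y = circleResistance Γ.totalLength (dist x y) := by
  obtain ⟨k, hk, t, ht, rfl⟩ := c.exists_point x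
  obtain ⟨k', hk', t', ht', rfl⟩ := c.exists_point y
  have hL := c.totalLength_pos
  have hl := c.len_pos k
  have hl' := c.len_pos k'
  have m1 := c.pos_add_mem hk ht
  have m2 := c.pos_add_mem hk' ht'
  rw [← c.isometry_toCircle.dist_eq, dist_eq_norm, c.toCircle_point hk ht, c.toCircle_point hk' ht',
    ← AddCircle.coe_sub, circleResistance_norm hL
      (abs_le.2 ⟨by linarith [m1.1, m2.2], by linarith [m1.2, m2.1]⟩)]
  have h1 : Γ.resistDist v₀ (c.point k t) (c.point k' t') =
      c.resBilin (c.point k t) (c.point k' t') - c.resBilin (c.point k t) (c.point k t) / 2 -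
      c.resBilin (c.point k' t') (c.point k' t') / 2 + (t - t * t / c.len k) +
      (t' - t' * t' / c.len k') - 2 * if k = k' then min t t' - t * t' / c.len k else 0 := by
    rw [resistDist, auxFieldCov, auxFieldCov, auxFieldCov, c.vertexFieldCov_eq h,
      c.vertexFieldCov_eq h, c.vertexFieldCov_eq h, c.sum_bridgeCov hk hk ht ht,
      c.sum_bridgeCov hk hk' ht ht', c.sum_bridgeCov hk' hk' ht' ht', if_pos rfl, if_pos rfl,
      min_self, min_self]
    ring
  have h2 : ∀ {i j : ℕ} {a b : ℝ}, i < n → j < n → a ∈ Icc 0 (c.len i) → b ∈ Icc 0 (c.len j) →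
      c.resBilin (c.point i a) (c.point j b) =
        (1 - a / c.len i) * ((1 - b / c.len j) *
            circleResistance Γ.totalLength |c.pos i - c.pos j| +
          b / c.len j * circleResistance Γ.totalLength |c.pos i - (c.pos j + c.len j)|) +
        a / c.len i * ((1 - b / c.len j) *
            circleResistance Γ.totalLength |c.pos i + c.len i - c.pos j| +
          b / c.len j *
            circleResistance Γ.totalLength |c.pos i + c.len i - (c.pos j + c.len j)|) := by
    intro i j a b hi hj ha hb
    rw [resBilin, c.sum_point hi ha, c.sum_point hj hb, c.sum_point hj hb, c.res_vert hi.le hj.le,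
      c.res_vert hi.le hj, c.res_vert hi hj.le, c.res_vert hi hj, pos_succ, pos_succ]
  rw [h1, h2 hk hk' ht ht', h2 hk hk ht ht, h2 hk' hk' ht' ht']
  simp only [circleResistance, sq_abs, sub_self, abs_zero, sub_add_cancel_left, abs_neg,
    add_sub_cancel_left, abs_of_pos hl, abs_of_pos hl']
  rcases lt_trichotomy k k' with hlt | rfl | hlt
  · have h3 := c.pos_strictMono.monotone (show k + 1 ≤ k' from hlt)
    rw [pos_succ] at h3
    rw [if_neg hlt.ne, abs_of_nonpos (a := c.pos k - c.pos k') (by linarith),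
      abs_of_nonpos (a := c.pos k - (c.pos k' + c.len k')) (by linarith),
      abs_of_nonpos (a := c.pos k + c.len k - c.pos k') (by linarith),
      abs_of_nonpos (a := c.pos k + c.len k - (c.pos k' + c.len k')) (by linarith),
      abs_of_nonpos (a := c.pos k + t - (c.pos k' + t')) (by linarith [ht.2, ht'.1])]
    field_simp
    ring
  · simp only [if_true, sub_self, abs_zero, sub_add_cancel_left, abs_neg,
      add_sub_cancel_left, abs_of_pos hl, add_sub_add_left_eq_sub]
    rcases le_total t t' with h4 | h4
    · rw [min_eq_left h4, abs_of_nonpos (by linarith)]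
      field_simp
      ring
    · rw [min_eq_right h4, abs_of_nonneg (by linarith)]
      field_simp
      ring
  · have h3 := c.pos_strictMono.monotone (show k' + 1 ≤ k from hlt)
    rw [pos_succ] at h3
    rw [if_neg hlt.ne', abs_of_nonneg (a := c.pos k - c.pos k') (by linarith),
      abs_of_nonneg (a := c.pos k - (c.pos k' + c.len k')) (by linarith),
      abs_of_nonneg (a := c.pos k + c.len k - c.pos k') (by linarith),
      abs_of_nonneg (a := c.pos k + c.len k - (c.pos k' + c.len k')) (by linarith),
      abs_of_nonneg (a := c.pos k + t - (c.pos k' + t')) (by linarith [ht.1, ht'.2])]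
    field_simp
    ring

end CyclicOrder

end MetricGraph

/-! ### The functional equation for the covariance -/

/-- Uniqueness of solutions of d'Alembert's functional equation on a bounded interval, for small
increments. -/
theorem dAlembert_unique {M a : ℝ} (ha : 0 < a) (haM : a ≤ M) {f g : ℝ → ℝ}
    (hf : ContinuousOn f (Icc 0 M)) (hg : ContinuousOn g (Icc 0 M)) (hf0 : f 0 = 1) (hg0 : g 0 = 1)
    (hfpos : ∀ h ∈ Ioc 0 a, 0 ≤ f h) (hgpos : ∀ h ∈ Ioc 0 a, 0 ≤ g h)
    (hfeq : ∀ h ∈ Ioc 0 a, ∀ w, h ≤ w → w + h ≤ M → f (w + h) + f (w - h) = 2 * f h * f w)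
    (hgeq : ∀ h ∈ Ioc 0 a, ∀ w, h ≤ w → w + h ≤ M → g (w + h) + g (w - h) = 2 * g h * g w)
    (hfg : f a = g a) : ∀ x ∈ Icc 0 M, f x = g x := by
  have hmem : ∀ j : ℕ, a / 2 ^ j ∈ Ioc 0 a := fun j =>
    ⟨by positivity, div_le_self ha.le (one_le_pow₀ (by norm_num))⟩
  -- Repeated halving: with `w = h` the equation is the double angle formula `f (2h) + 1 = 2 (f
  -- h)²`, and nonnegativity selects the root.
  have h1 : ∀ j : ℕ, f (a / 2 ^ j) = g (a / 2 ^ j) := by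
    intro j
    induction j with
    | zero => simpa using hfg
    | succ j ih =>
      have h2 : a / 2 ^ (j + 1) + a / 2 ^ (j + 1) = a / 2 ^ j := by
        rw [pow_succ]
        field_simp
        norm_num
      have hle : a / 2 ^ (j + 1) + a / 2 ^ (j + 1) ≤ M := h2 ▸ (hmem j).2.trans haM
      have e1 := hfeq _ (hmem (j + 1)) _ le_rfl hle
      have e2 := hgeq _ (hmem (j + 1)) _ le_rfl hle
      rw [h2, sub_self, hf0, ih] at e1
      rw [h2, sub_self, hg0] at e2
      refine (sq_eq_sq₀ (hfpos _ (hmem _)) (hgpos _ (hmem _))).1 ?_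
      linarith [sq (f (a / 2 ^ (j + 1))), sq (g (a / 2 ^ (j + 1)))]
  -- With `h` fixed, the equation is a two-term recursion along the multiples of `h`. Such dyadic
  -- multiples of `a` are dense, and continuity does the rest.
  have h2 : ∀ j k : ℕ, k * (a / 2 ^ j) ≤ M → f (k * (a / 2 ^ j)) = g (k * (a / 2 ^ j)) := by
    intro j k
    induction k using Nat.twoStepInduction with
    | zero => simp [hf0, hg0]
    | one => simpa using fun _ => h1 j
    | more k ih ih' =>
      intro hk
      push_cast at hk ih' ⊢
      have hp := (hmem j).1
      have hle : a / 2 ^ j ≤ (k + 1) * (a / 2 ^ j) := le_mul_of_one_le_left hp.le (by simp)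
      have e1 := hfeq _ (hmem j) ((k + 1) * (a / 2 ^ j)) hle (by linarith)
      have e2 := hgeq _ (hmem j) ((k + 1) * (a / 2 ^ j)) hle (by linarith)
      rw [show (k + 1) * (a / 2 ^ j) + a / 2 ^ j = (k + 1 + 1) * (a / 2 ^ j) by ring,
        show (k + 1) * (a / 2 ^ j) - a / 2 ^ j = k * (a / 2 ^ j) by ring] at e1 e2
      rw [ih (by linarith), ih' (by linarith), h1] at e1
      rw [show (k : ℝ) + 2 = k + 1 + 1 by ring]
      linarith
  intro x hx
  have hlim : Tendsto (fun j : ℕ => (⌊x / (a / 2 ^ j)⌋₊ : ℝ) * (a / 2 ^ j)) atTop (𝓝 x) := by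
    have hz : Tendsto (fun j : ℕ => a / 2 ^ j) atTop (𝓝 0) :=
      tendsto_const_nhds.div_atTop (tendsto_pow_atTop_atTop_of_one_lt (by norm_num))
    refine tendsto_of_tendsto_of_tendsto_of_le_of_le (g := fun j : ℕ => x - a / 2 ^ j)
      (by simpa using tendsto_const_nhds.sub hz) (tendsto_const_nhds (x := x)) ?_ ?_
    · intro j
      have hp := (hmem j).1
      have h3 := Nat.lt_floor_add_one (x / (a / 2 ^ j))
      rw [div_lt_iff₀ hp] at h3
      change x - a / 2 ^ j ≤ _
      linarith
    · intro j
      have hp := (hmem j).1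
      have h3 := Nat.floor_le (div_nonneg hx.1 hp.le)
      rwa [le_div_iff₀ hp] at h3
  have hin : ∀ j : ℕ, (⌊x / (a / 2 ^ j)⌋₊ : ℝ) * (a / 2 ^ j) ∈ Icc 0 M := by
    intro j
    have hp := (hmem j).1
    have h3 := Nat.floor_le (div_nonneg hx.1 hp.le)
    rw [le_div_iff₀ hp] at h3
    exact ⟨by positivity, h3.trans hx.2⟩
  have hlim' := tendsto_nhdsWithin_iff.2 ⟨hlim, Eventually.of_forall hin⟩
  exact tendsto_nhds_unique ((hf x hx).tendsto.comp hlim')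
    (((hg x hx).tendsto.comp hlim').congr fun j => (h2 j _ (hin j).2).symm)

/-- Covariance functions on a circle that satisfy the Markov relation. -/
theorem cosh_or_cos_of_markov_relation {ρ : ℝ → ℝ} {ℓ : ℝ} (hℓ : 0 < ℓ)
    (hc : ContinuousOn ρ (Icc 0 ℓ)) (hsymm : ∀ w ∈ Icc 0 ℓ, ρ (ℓ - w) = ρ w) (h0 : 0 < ρ 0)
    (hle : ∀ w ∈ Icc 0 ℓ, |ρ w| ≤ ρ 0)
    (heq : ∀ h, 0 < h → 2 * h < ℓ → ρ 0 + ρ (2 * h) ≠ 0 → ∀ w, h ≤ w → w ≤ ℓ - h →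
      ρ w = ρ h / (ρ 0 + ρ (2 * h)) * (ρ (w + h) + ρ (w - h))) :
    (∃ A κ, 0 < A ∧ 0 < κ ∧ ∀ w ∈ Icc 0 ℓ, ρ w = A * Real.cosh (κ * (w - ℓ / 2))) ∨
      ∃ κ, 0 ≤ κ ∧ ∀ w ∈ Icc 0 ℓ, ρ w = ρ 0 * Real.cos (κ * w) := by
  obtain ⟨N, hN, hpos⟩ : ∃ N : ℕ, 2 ≤ N ∧ ∀ h ∈ Icc 0 (ℓ / N), 0 < ρ h := by
    have h1 : ∀ᶠ x in 𝓝[Icc 0 ℓ] (0 : ℝ), 0 < ρ x :=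
      (hc 0 ⟨le_rfl, hℓ.le⟩).eventually (lt_mem_nhds h0)
    obtain ⟨ε, hε, h2⟩ := Metric.mem_nhdsWithin_iff.1 h1
    obtain ⟨N, hN⟩ := exists_nat_gt (ℓ / ε)
    refine ⟨max N 2, le_max_right _ _, fun h hh => h2 ⟨?_, hh.1, ?_⟩⟩
    · have h3 : (0 : ℝ) < (max N 2 : ℕ) := by
        have : 0 < max N 2 := by omega
        exact_mod_cast this
      have h4 : (N : ℝ) ≤ (max N 2 : ℕ) := by exact_mod_cast le_max_left _ _
      rw [Metric.mem_ball, Real.dist_0_eq_abs, abs_of_nonneg hh.1]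
      refine hh.2.trans_lt ?_
      rw [div_lt_iff₀ h3]
      rw [div_lt_iff₀ hε] at hN
      nlinarith
    · refine hh.2.trans (div_le_self hℓ.le ?_)
      have : 1 ≤ max N 2 := by omega
      exact_mod_cast this
  have hN0 : (0 : ℝ) < N := by
    have : 0 < N := by omega
    exact_mod_cast this
  have hN2 : (2 : ℝ) ≤ N := by exact_mod_cast hN
  -- For `h ≤ a` both `h` and `2h` lie in `[0, ℓ/N]`, where `ρ` is positive. Moreover `N` steps of
  -- size `a` lead exactly from `ℓ/2` to `ℓ`.
  set a := ℓ / (2 * N) with ha_def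
  have ha : 0 < a := by positivity
  have h2a : 2 * a = ℓ / N := by
    rw [ha_def]
    field_simp
  have hNa : N * a = ℓ / 2 := by
    rw [ha_def]
    field_simp
  have haM : a ≤ ℓ / 2 := by nlinarith
  have h2aℓ : 2 * a < ℓ := by nlinarith
  have hkpos : ∀ h ∈ Ioc 0 a, 0 < ρ 0 + ρ (2 * h) ∧ 0 < ρ h / (ρ 0 + ρ (2 * h)) := by
    intro h hh
    have h1 : 0 < ρ h := hpos h ⟨hh.1.le, by rw [← h2a]; linarith [hh.2]⟩
    have h2 : 0 < ρ (2 * h) := hpos _ ⟨by linarith [hh.1], by rw [← h2a]; linarith [hh.2]⟩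
    exact ⟨by linarith, by positivity⟩
  have heq' : ∀ h ∈ Ioc 0 a, ∀ w, 0 ≤ w → w + h ≤ ℓ / 2 → ρ (ℓ / 2 + w) =
      ρ h / (ρ 0 + ρ (2 * h)) * (ρ (ℓ / 2 + (w + h)) + ρ (ℓ / 2 + (w - h))) := by
    intro h hh w hw hwh
    rw [heq h hh.1 (by linarith [hh.2]) (hkpos h hh).1.ne' (ℓ / 2 + w) (by linarith)
      (by linarith)]
    ring_nf
  have heq0 : ∀ h ∈ Ioc 0 a, ρ (ℓ / 2) = 2 * (ρ h / (ρ 0 + ρ (2 * h))) * ρ (ℓ / 2 + h) := by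
    intro h hh
    have h1 := heq' h hh 0 le_rfl (by linarith [hh.2])
    have h2 := hsymm (ℓ / 2 + h) ⟨by linarith [hh.1], by linarith [hh.2]⟩
    rw [show ℓ - (ℓ / 2 + h) = ℓ / 2 + (0 - h) by ring] at h2
    rw [h2, add_zero, zero_add] at h1
    linarith
  -- A zero at the midpoint would spread by the recursion with step `a` to `ℓ`, where `ρ ℓ = ρ 0 >
  -- 0`.
  have hhalf : ρ (ℓ / 2) ≠ 0 := by
    intro h3
    have hz : ∀ k : ℕ, k ≤ N → ρ (ℓ / 2 + k * a) = 0 := by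
      intro k
      induction k using Nat.twoStepInduction with
      | zero => simpa using h3
      | one =>
        intro _
        have h4 := heq0 a ⟨ha, le_rfl⟩
        rw [h3] at h4
        have h5 := (hkpos a ⟨ha, le_rfl⟩).2
        simpa [h5.ne'] using h4.symm
      | more k ih ih' =>
        intro hk
        have hk' : ((k + 2 : ℕ) : ℝ) ≤ N := by exact_mod_cast hk
        have h4 := heq' a ⟨ha, le_rfl⟩ ((k + 1 : ℕ) * a) (by positivity) (by
          push_cast at hk' ⊢
          nlinarith)
        rw [ih' (by omega)] at h4
        have h5 := (hkpos a ⟨ha, le_rfl⟩).2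
        have h6 := (mul_eq_zero.1 h4.symm).resolve_left h5.ne'
        push_cast at h6 ⊢
        rw [show (k + 1 : ℝ) * a - a = k * a by ring, ih (by omega),
          show (k + 1 : ℝ) * a + a = (k + 2) * a by ring] at h6
        linarith
    have h4 := hz N le_rfl
    rw [hNa, add_halves] at h4
    have h5 := hsymm 0 ⟨le_rfl, hℓ.le⟩
    rw [sub_zero] at h5
    linarith
  set f : ℝ → ℝ := fun w => ρ (ℓ / 2 + w) / ρ (ℓ / 2) with hf_def
  have hρf : ∀ w, ρ (ℓ / 2 + w) = ρ (ℓ / 2) * f w := fun w => by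
    simp only [hf_def]
    field_simp
  have hf0 : f 0 = 1 := by simp [hf_def, hhalf]
  -- At the midpoint the relation expresses the regression coefficient as `1 / (2 f h)`;
  -- substituting it yields d'Alembert's equation for `f`.
  have hfk : ∀ h ∈ Ioc 0 a, 2 * (ρ h / (ρ 0 + ρ (2 * h))) * f h = 1 := by
    intro h hh
    have h1 := heq0 h hh
    rw [hρf] at h1
    have h2 : ρ (ℓ / 2) * (2 * (ρ h / (ρ 0 + ρ (2 * h))) * f h) = ρ (ℓ / 2) * 1 := by linarith
    exact mul_left_cancel₀ hhalf h2
  have hfpos : ∀ h ∈ Ioc 0 a, 0 < f h := by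
    intro h hh
    have h1 := hfk h hh
    have h2 := (hkpos h hh).2
    by_contra! h3
    nlinarith
  have hfeq : ∀ h ∈ Ioc 0 a, ∀ w, h ≤ w → w + h ≤ ℓ / 2 →
      f (w + h) + f (w - h) = 2 * f h * f w := by
    intro h hh w hw hwh
    have h1 := heq' h hh w (hh.1.le.trans hw) hwh
    rw [hρf, hρf, hρf, ← mul_add, mul_left_comm] at h1
    have h2 := mul_left_cancel₀ hhalf h1
    rw [h2]
    linear_combination (-(f (w + h) + f (w - h))) * hfk h hh
  have hfc : ContinuousOn f (Icc 0 (ℓ / 2)) := by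
    refine ContinuousOn.div_const (hc.comp (by fun_prop) fun w hw => ?_) _
    exact ⟨by linarith [hw.1], by linarith [hw.2]⟩
  have hfa := hfpos a ⟨ha, le_rfl⟩
  have hext : ∀ φ : ℝ → ℝ, (∀ w, φ (-w) = φ w) → (∀ w ∈ Icc 0 (ℓ / 2), f w = φ w) →
      ∀ w ∈ Icc 0 ℓ, ρ w = ρ (ℓ / 2) * φ (w - ℓ / 2) := by
    intro φ hφ h1 w hw
    rcases le_total (ℓ / 2) w with h2 | h2
    · rw [← h1 _ ⟨by linarith, by linarith [hw.2]⟩, ← hρf]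
      congr 1
      ring
    · rw [← hsymm w hw, ← hφ, ← h1 _ ⟨by linarith, by linarith [hw.1]⟩, ← hρf]
      congr 1
      ring
  rcases lt_or_ge 1 (f a) with h1 | h1
  · left
    have hκ : Real.arcosh (f a) / a * a = Real.arcosh (f a) := by field_simp
    have h2 := dAlembert_unique ha haM hfc
      (g := fun w => Real.cosh (Real.arcosh (f a) / a * w))
      (by fun_prop) hf0 (by simp) (fun h hh => (hfpos h hh).le)
      (fun h _ => (Real.cosh_pos _).le) hfeq (fun h _ w _ _ => by
        simp only [mul_add, mul_sub, Real.cosh_add, Real.cosh_sub]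
        ring) (by simp only [hκ, Real.cosh_arcosh h1.le])
    have h3 := hext _ (fun w => by simp only [mul_neg, Real.cosh_neg]) h2
    refine ⟨ρ (ℓ / 2), Real.arcosh (f a) / a, ?_, div_pos (Real.arcosh_pos h1) ha, h3⟩
    have h4 := h3 0 ⟨le_rfl, hℓ.le⟩
    rw [h4] at h0
    exact pos_of_mul_pos_left h0 (Real.cosh_pos _).le
  · right
    -- Since `0 < f a ≤ 1`, `κ a ≤ π/2`, which makes the cosine nonnegative on `(0, a]` as
    -- uniqueness requires.
    set κ := Real.arccos (f a) / a with hκ_def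
    have hκ : κ * a = Real.arccos (f a) := by
      rw [hκ_def]
      field_simp
    have hκ0 : 0 ≤ κ := div_nonneg (Real.arccos_nonneg _) ha.le
    have h2 := dAlembert_unique ha haM hfc
      (g := fun w => Real.cos (κ * w))
      (by fun_prop) hf0 (by simp) (fun h hh => (hfpos h hh).le)
      (fun h hh => by
        refine Real.cos_nonneg_of_mem_Icc ⟨?_, ?_⟩
        · have := mul_nonneg hκ0 hh.1.le
          linarith [Real.pi_pos]
        · calc κ * h ≤ κ * a := by gcongr; exact hh.2
            _ ≤ Real.pi / 2 := by
              rw [hκ]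
              exact Real.arccos_le_pi_div_two.2 hfa.le)
      hfeq (fun h _ w _ _ => by
        simp only [mul_add, mul_sub, Real.cos_add, Real.cos_sub]
        ring) (by simp only [hκ, Real.cos_arccos (by linarith) h1])
    have h3 := hext _ (fun w => by simp only [mul_neg, Real.cos_neg]) h2
    have h4 := h3 0 ⟨le_rfl, hℓ.le⟩
    have h5 := hle (ℓ / 2) ⟨by linarith, by linarith⟩
    rw [zero_sub, mul_neg, Real.cos_neg] at h4
    -- The bound `|ρ (ℓ/2)| ≤ ρ 0` leaves only `|cos (κ ℓ/2)| = 1`; then the sine vanishes there and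
    -- the cosine can be recentred at `0`.
    have h6 : 1 ≤ |Real.cos (κ * (ℓ / 2))| := by
      have h7 : |ρ (ℓ / 2)| * 1 ≤ |ρ (ℓ / 2)| * |Real.cos (κ * (ℓ / 2))| := by
        rw [← abs_mul, ← h4, mul_one]
        exact h5.trans (le_abs_self _)
      exact le_of_mul_le_mul_left h7 (abs_pos.2 hhalf)
    have h7 : Real.sin (κ * (ℓ / 2)) = 0 := by
      have h8 := Real.sin_sq_add_cos_sq (κ * (ℓ / 2))
      have h9 : 1 ≤ Real.cos (κ * (ℓ / 2)) ^ 2 := by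
        rw [← sq_abs]
        exact one_le_pow₀ h6
      have : Real.sin (κ * (ℓ / 2)) ^ 2 = 0 := le_antisymm (by linarith) (sq_nonneg _)
      exact pow_eq_zero_iff (two_ne_zero) |>.1 this
    refine ⟨κ, hκ0, fun w hw => ?_⟩
    rw [h3 w hw, h4, mul_sub, Real.cos_sub, h7]
    ring

/-! ### From conditional independence to independence -/

section Splitting

variable {Ω : Type*} {mΩ : MeasurableSpace Ω} {P : Measure Ω} [IsProbabilityMeasure P]

/-- Independence of `A` from `𝓒` makes the conditional probability of `A` constant; integrating the
splitting identity then gives the product of the probabilities. -/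
theorem Splits.measure_inter_eq_mul {𝓒 𝓐 𝓑 : MeasurableSpace Ω} (h : Splits P 𝓒 𝓐 𝓑)
    (h𝓒 : 𝓒 ≤ mΩ) {A B : Set Ω} (hA : MeasurableSet[𝓐] A) (hB : MeasurableSet[𝓑] B)
    (hA' : MeasurableSet[mΩ] A) (hB' : MeasurableSet[mΩ] B)
    (hind : ∀ C, MeasurableSet[𝓒] C → P (A ∩ C) = P A * P C) : P (A ∩ B) = P A * P B := by
  have hInd : Indep (MeasurableSpace.generateFrom {A}) 𝓒 P := by
    refine IndepSets.indep (p1 := {A}) (p2 := {C | MeasurableSet[𝓒] C})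
      (MeasurableSpace.generateFrom_le (by simpa using hA')) h𝓒 (IsPiSystem.singleton A)
      (@MeasurableSpace.isPiSystem_measurableSet _ 𝓒) rfl
      (@MeasurableSpace.generateFrom_measurableSet _ 𝓒).symm ?_
    rw [IndepSets_iff]
    rintro _ C rfl hC
    exact hind C hC
  have h1 : P⟦A | 𝓒⟧ =ᵐ[P] fun _ => P.real A := by
    have hA1 : MeasurableSet[MeasurableSpace.generateFrom {A}] A :=
      MeasurableSpace.measurableSet_generateFrom rfl
    have := condExp_indep_eq (f := A.indicator fun _ => (1 : ℝ))
      (MeasurableSpace.generateFrom_le (by simpa using hA')) h𝓒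
      (stronglyMeasurable_const.indicator hA1) hInd
    refine this.trans (Eventually.of_forall fun _ => ?_)
    simp [integral_indicator_const _ hA']
  have h2 := h A B hA hB
  have h3 : ∫ ω, (P⟦A ∩ B | 𝓒⟧) ω ∂P = P.real (A ∩ B) := by
    rw [integral_condExp h𝓒]
    rw [integral_indicator_const _ (hA'.inter hB'), smul_eq_mul, mul_one]
  have h4 : ∫ ω, (P⟦B | 𝓒⟧) ω ∂P = P.real B := by
    rw [integral_condExp h𝓒]
    rw [integral_indicator_const _ hB', smul_eq_mul, mul_one]
  have h5 : P.real (A ∩ B) = P.real A * P.real B := by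
    rw [← h3, ← h4, ← integral_const_mul]
    refine integral_congr_ae ?_
    filter_upwards [h1, h2] with ω e1 e2
    rw [e2, e1]
  rw [← ENNReal.toReal_eq_toReal_iff' (measure_ne_top _ _)
    (ENNReal.mul_ne_top (measure_ne_top _ _) (measure_ne_top _ _)), ENNReal.toReal_mul]
  exact h5

end Splitting

/-! ### Sigma-algebras generated by a field -/

section Fields

variable {T Ω : Type*} {mΩ : MeasurableSpace Ω} {X : T → Ω → ℝ}

theorem fieldSigma_mono (X : T → Ω → ℝ) {S S' : Set T} (h : S ⊆ S') :
    fieldSigma X S ≤ fieldSigma X S' :=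
  biSup_mono h

theorem measurable_fieldSigma (X : T → Ω → ℝ) {S : Set T} {s : T} (hs : s ∈ S) :
    Measurable[fieldSigma X S] (X s) :=
  measurable_iff_comap_le.2 (le_biSup (fun s => MeasurableSpace.comap (X s) inferInstance) hs)

theorem fieldSigma_le (hX : ∀ s, Measurable (X s)) (S : Set T) : fieldSigma X S ≤ mΩ :=
  iSup₂_le fun s _ => (hX s).comap_le

theorem fieldSigma_eq_comap (X : T → Ω → ℝ) (S : Set T) :
    fieldSigma X S = MeasurableSpace.comap (fun ω (s : S) => X s ω) MeasurableSpace.pi := by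
  simp only [fieldSigma, MeasurableSpace.pi, MeasurableSpace.comap_iSup,
    MeasurableSpace.comap_comp, iSup_subtype]
  rfl

variable [MetricSpace T]

theorem fieldSigma_le_fieldSigmaPlus (X : T → Ω → ℝ) (S : Set T) :
    fieldSigma X S ≤ fieldSigmaPlus X S :=
  le_iInf₂ fun _ hε => fieldSigma_mono X (Metric.self_subset_thickening hε S)

theorem fieldSigmaPlus_mono (X : T → Ω → ℝ) {S S' : Set T} (h : S ⊆ S') :
    fieldSigmaPlus X S ≤ fieldSigmaPlus X S' :=
  iInf₂_mono fun _ _ => fieldSigma_mono X (Metric.thickening_subset_of_subset _ h)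

theorem fieldSigmaPlus_le (hX : ∀ s, Measurable (X s)) (S : Set T) : fieldSigmaPlus X S ≤ mΩ :=
  (iInf₂_le 1 one_pos).trans (fieldSigma_le hX _)

end Fields

/-! ### Gaussian Markov fields and their covariances -/

section Gaussian

variable {T Ω : Type*} {mΩ : MeasurableSpace Ω} {P : Measure Ω} {X : T → Ω → ℝ}

/-- Joint Gaussianity of the combination and the values on `S` is what turns zero covariance into
independence. -/
theorem ProbabilityTheory.IsGaussianProcess.sumElim_linearCombination
    (hgauss : IsGaussianProcess X P) {ι : Type*} [Fintype ι] (p : ι → T) (c : ι → ℝ) (S : Set T) :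
    IsGaussianProcess (Sum.elim (fun (_ : Unit) ω => ∑ i, c i * X (p i) ω) fun s : S => X s) P := by
  classical
  refine hgauss.of_isGaussianProcess ?_
  rintro (- | s)
  · refine ⟨Finset.univ.image p, LinearMap.toContinuousLinearMap
      (∑ i, c i • LinearMap.proj (R := ℝ)
        (⟨p i, Finset.mem_image_of_mem p (Finset.mem_univ i)⟩ : Finset.univ.image p)), ?_⟩
    intro ω
    simp [Finset.restrict]
  · exact ⟨{s.1}, ContinuousLinearMap.proj ⟨s.1, by simp⟩, fun ω => by simp [Finset.restrict]⟩

theorem ProbabilityTheory.IsGaussianProcess.indep_linearCombination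
    (hgauss : IsGaussianProcess X P) (hX : ∀ s, Measurable (X s)) {ι : Type*} [Fintype ι]
    (p : ι → T) (c : ι → ℝ) (S : Set T)
    (hcov : ∀ s ∈ S, cov[fun ω => ∑ i, c i * X (p i) ω, X s; P] = 0) :
    Indep (MeasurableSpace.comap (fun ω => ∑ i, c i * X (p i) ω) inferInstance)
      (fieldSigma X S) P := by
  have hZ : Measurable fun ω => ∑ i, c i * X (p i) ω :=
    Finset.measurable_sum _ fun i _ => (hX _).const_mul _
  have h1 := (hgauss.sumElim_linearCombination p c S).indepFun_of_covariance_eq_zero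
    (fun _ => hZ.aemeasurable) (fun s => (hX s).aemeasurable) fun _ s => hcov s.1 s.2
  have hφ : Measurable fun f : Unit → ℝ => f () := measurable_pi_apply ()
  have h2 := h1.comp hφ measurable_id
  rw [IndepFun_iff_Indep] at h2
  rw [fieldSigma_eq_comap]
  exact h2

theorem memLp_linearCombination (hX : ∀ s, MemLp (X s) 2 P) {ι : Type*} [Fintype ι]
    (p : ι → T) (c : ι → ℝ) : MemLp (fun ω => ∑ i, c i * X (p i) ω) 2 P :=
  memLp_finsetSum _ fun _ _ => (hX _).const_mul _

theorem covariance_linearCombination [IsFiniteMeasure P] (hX : ∀ s, MemLp (X s) 2 P) {ι : Type*}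
    [Fintype ι] (p : ι → T) (c : ι → ℝ) (s : T) :
    cov[fun ω => ∑ i, c i * X (p i) ω, X s; P] = ∑ i, c i * cov[X (p i), X s; P] := by
  rw [covariance_fun_sum_left (fun i => (hX _).const_mul _) (hX s)]
  simp_rw [covariance_const_mul_left]

/-- Let `S` be open. A linear combination of values of a Gaussian Markov field at points of the
closure of `S` that is uncorrelated with the field on the boundary of `S` is uncorrelated with the
field on the complement of `S`. -/
theorem IsMarkovOfOrderOne.covariance_eq_zero [MetricSpace T] [IsProbabilityMeasure P]
    (hM : IsMarkovOfOrderOne P X) (hgauss : IsGaussianProcess X P) (hX : ∀ s, Measurable (X s))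
    {S : Set T} (hS : IsOpen S) {ι : Type*} [Fintype ι] (p : ι → T) (c : ι → ℝ)
    (hp : ∀ i, p i ∈ closure S)
    (hcov : ∀ s ∈ frontier S, ∑ i, c i * cov[X (p i), X s; P] = 0) {v : T} (hv : v ∉ S) :
    ∑ i, c i * cov[X (p i), X v; P] = 0 := by
  have hind := hgauss.indep_linearCombination hX p c (frontier S) fun s hs => by
    rw [covariance_linearCombination hM.memLp, hcov s hs]
  have hZ : Measurable[fieldSigmaPlus X (closure S)] fun ω => ∑ i, c i * X (p i) ω :=
    Finset.measurable_sum _ fun i _ => ((measurable_fieldSigma X (hp i)).mono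
      (fieldSigma_le_fieldSigmaPlus X _) le_rfl).const_mul _
  have hV : Measurable[fieldSigmaPlus X Sᶜ] (X v) :=
    (measurable_fieldSigma X (show v ∈ Sᶜ from hv)).mono (fieldSigma_le_fieldSigmaPlus X _) le_rfl
  have hindep : IndepFun (fun ω => ∑ i, c i * X (p i) ω) (X v) P := by
    rw [indepFun_iff_measure_inter_preimage_eq_mul]
    intro A B hA hB
    refine (hM.splits S hS).measure_inter_eq_mul (fieldSigma_le hX _) (hZ hA) (hV hB)
      (fieldSigmaPlus_le hX _ _ (hZ hA)) (hX v hB) fun C hC => ?_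
    exact (Indep_iff _ _ _).1 hind _ _ ⟨A, hA, rfl⟩ hC
  rw [← covariance_linearCombination hM.memLp]
  exact hindep.covariance_eq_zero (memLp_linearCombination hM.memLp p c) (hM.memLp v)

/-- The centred values of a square integrable field, as elements of `L₂(Ω)`. -/
noncomputable def centeredLp [IsFiniteMeasure P] (hX : ∀ s, MemLp (X s) 2 P) (s : T) : Lp ℝ 2 P :=
  ((hX s).sub (memLp_const (∫ ω, X s ω ∂P))).toLp (fun ω => X s ω - ∫ ω, X s ω ∂P)

theorem coeFn_centeredLp [IsFiniteMeasure P] (hX : ∀ s, MemLp (X s) 2 P) (s : T) :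
    centeredLp hX s =ᵐ[P] fun ω => X s ω - ∫ ω, X s ω ∂P :=
  MemLp.coeFn_toLp _

theorem inner_centeredLp [IsFiniteMeasure P] (hX : ∀ s, MemLp (X s) 2 P) (s t : T) :
    inner ℝ (centeredLp hX s) (centeredLp hX t) = cov[X s, X t; P] := by
  rw [L2.inner_def, covariance]
  refine integral_congr_ae ?_
  filter_upwards [coeFn_centeredLp hX s, coeFn_centeredLp hX t] with ω h1 h2
  rw [h1, h2]
  simp [mul_comm]

/-- The mean is the inner product with the constant `1`, so it is as continuous as the field in
`L₂`. -/
theorem IsMarkovOfOrderOne.continuous_centeredLp [MetricSpace T] [IsProbabilityMeasure P]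
    (hM : IsMarkovOfOrderOne P X) : Continuous (centeredLp hM.memLp) := by
  have h1 : Continuous fun s => (hM.memLp s).toLp (X s) := by
    rw [continuous_iff_continuousAt]
    intro s
    exact (Lp.tendsto_Lp_iff_tendsto_eLpNorm'' _ _ _ _).2 (hM.continuous s)
  have h2 : ∀ s, inner ℝ ((memLp_const (1 : ℝ)).toLp (fun _ : Ω => (1 : ℝ)) : Lp ℝ 2 P)
      ((hM.memLp s).toLp (X s)) = ∫ ω, X s ω ∂P := by
    intro s
    rw [L2.inner_def]
    refine integral_congr_ae ?_
    filter_upwards [(hM.memLp s).coeFn_toLp,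
      (memLp_const (1 : ℝ) : MemLp (fun _ : Ω => (1 : ℝ)) 2 P).coeFn_toLp] with ω e1 e2
    rw [e1, e2]
    simp
  have h3 : ∀ s, centeredLp hM.memLp s = (hM.memLp s).toLp (X s) -
      (∫ ω, X s ω ∂P) • ((memLp_const (1 : ℝ)).toLp (fun _ : Ω => (1 : ℝ)) : Lp ℝ 2 P) := by
    intro s
    rw [← MemLp.toLp_const_smul, ← MemLp.toLp_sub]
    refine MemLp.toLp_congr _ _ (Eventually.of_forall fun ω => ?_)
    simp
  rw [show centeredLp hM.memLp = fun s => _ from funext h3]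
  have h4 : Continuous fun s => ∫ ω, X s ω ∂P := by
    simp_rw [← h2]
    exact continuous_const.inner h1
  fun_prop

end Gaussian

/-! ### Isotropic Gaussian Markov fields on a circle -/

section Circle

variable {T Ω : Type*} [MetricSpace T] {ℓ : ℝ} [hℓ : Fact (0 < ℓ)] (Φ : T ≃ᵢ AddCircle ℓ)

omit hℓ in
theorem IsometryEquiv.continuous_symm_coe : Continuous fun a : ℝ => Φ.symm (a : AddCircle ℓ) :=
  Φ.symm.continuous.comp (AddCircle.continuous_mk' ℓ)

omit hℓ in
theorem IsometryEquiv.dist_symm_coe (a b : ℝ) :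
    dist (Φ.symm (a : AddCircle ℓ)) (Φ.symm (b : AddCircle ℓ)) =
      ‖((a - b : ℝ) : AddCircle ℓ)‖ := by
  rw [Φ.symm.isometry.dist_eq, dist_eq_norm, AddCircle.coe_sub]

theorem IsometryEquiv.exists_symm_coe (s : T) : ∃ a ∈ Icc 0 ℓ, s = Φ.symm (a : AddCircle ℓ) := by
  obtain ⟨a, ha, h⟩ := AddCircle.eq_coe_Ico (Φ s)
  exact ⟨a, ⟨ha.1, ha.2.le⟩, by rw [h, Φ.symm_apply_apply]⟩

/-- The open arc from position `0` to position `b`. -/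
def IsometryEquiv.arc (b : ℝ) : Set T := (fun a : ℝ => Φ.symm (a : AddCircle ℓ)) '' Ioo 0 b

theorem IsometryEquiv.symm_coe_notMem_arc {b w : ℝ} (hb : b ≤ ℓ) (hb0 : 0 < b)
    (hw : w ∈ Icc b ℓ) : Φ.symm (w : AddCircle ℓ) ∉ Φ.arc b := by
  rintro ⟨a, ha, h⟩
  have h1 := Φ.symm.injective h
  rw [AddCircle.coe_eq_coe_iff_of_mem_Ioc (a := 0) ⟨ha.1, by linarith [ha.2]⟩
    ⟨by linarith [hw.1], by linarith [hw.2]⟩] at h1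
  linarith [ha.2, hw.1]

/-- The case `b = ℓ` matters: the arc is then the circle without one point. -/
theorem IsometryEquiv.compl_arc {b : ℝ} (hb : b ≤ ℓ) (hb0 : 0 < b) :
    (Φ.arc b)ᶜ = (fun a : ℝ => Φ.symm (a : AddCircle ℓ)) '' Icc b ℓ := by
  ext s
  constructor
  · intro hs
    obtain ⟨a, ha, rfl⟩ := Φ.exists_symm_coe s
    rcases lt_or_ge a b with h | h
    · rcases ha.1.eq_or_lt with rfl | h0
      · exact ⟨ℓ, ⟨hb, le_rfl⟩, by simp [AddCircle.coe_period]⟩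
      · exact absurd ⟨a, ⟨h0, h⟩, rfl⟩ hs
    · exact ⟨a, ⟨h, ha.2⟩, rfl⟩
  · rintro ⟨w, hw, rfl⟩
    exact Φ.symm_coe_notMem_arc hb hb0 hw

theorem IsometryEquiv.isOpen_arc {b : ℝ} (hb : b ≤ ℓ) (hb0 : 0 < b) : IsOpen (Φ.arc b) := by
  rw [← isClosed_compl_iff, Φ.compl_arc hb hb0]
  exact (isCompact_Icc.image Φ.continuous_symm_coe).isClosed

omit hℓ in
theorem IsometryEquiv.closure_arc {b : ℝ} (hb0 : 0 < b) :
    closure (Φ.arc b) = (fun a : ℝ => Φ.symm (a : AddCircle ℓ)) '' Icc 0 b := by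
  refine subset_antisymm (closure_minimal (image_mono Ioo_subset_Icc_self)
    (isCompact_Icc.image Φ.continuous_symm_coe).isClosed) ?_
  rw [← closure_Ioo hb0.ne]
  exact image_closure_subset_closure_image Φ.continuous_symm_coe

theorem IsometryEquiv.frontier_arc_subset {b : ℝ} (hb : b ≤ ℓ) (hb0 : 0 < b) :
    frontier (Φ.arc b) ⊆ {Φ.symm ((0 : ℝ) : AddCircle ℓ), Φ.symm (b : AddCircle ℓ)} := by
  rw [(Φ.isOpen_arc hb hb0).frontier_eq, Φ.closure_arc hb0]
  rintro _ ⟨⟨a, ha, rfl⟩, h⟩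
  rcases ha.1.eq_or_lt with rfl | h0
  · exact .inl rfl
  · rcases ha.2.eq_or_lt with rfl | h1
    · exact .inr rfl
    · exact absurd ⟨a, ⟨h0, h1⟩, rfl⟩ h

variable {mΩ : MeasurableSpace Ω} {P : Measure Ω} [IsProbabilityMeasure P] {X : T → Ω → ℝ}

/-- A Gaussian Markov field on the circle is not a random linear combination of `cos` and `sin`. -/
theorem IsMarkovOfOrderOne.not_covariance_cos (hM : IsMarkovOfOrderOne P X)
    (hgauss : IsGaussianProcess X P) (hX : ∀ s, Measurable (X s)) {σ κ : ℝ} (hσ : 0 < σ)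
    (hκ : 0 < κ) (hcov : ∀ a b : ℝ, a ∈ Icc 0 ℓ → b ∈ Icc 0 ℓ →
      cov[X (Φ.symm (a : AddCircle ℓ)), X (Φ.symm (b : AddCircle ℓ)); P] =
        σ * Real.cos (κ * (a - b))) : False := by
  have hℓ0 := hℓ.out
  set pt : ℝ → T := fun a => Φ.symm (a : AddCircle ℓ) with hpt
  set m : ℝ → ℝ := fun a => ∫ ω, X (pt a) ω ∂P with hm
  -- times decreasing to zero
  set t₀ : ℝ := min ℓ (1 / κ) with ht₀
  have ht₀pos : 0 < t₀ := lt_min hℓ0 (by positivity)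
  have hsin : ∀ t ∈ Ioc 0 t₀, 0 < Real.sin (κ * t) := fun t ht => by
    refine Real.sin_pos_of_pos_of_lt_pi (mul_pos hκ ht.1) ?_
    have h1 : t ≤ 1 / κ := ht.2.trans (min_le_right _ _)
    have h2 : κ * t ≤ 1 := by rwa [le_div_iff₀' hκ] at h1
    linarith [Real.pi_gt_three]
  set t : ℕ → ℝ := fun n => t₀ / (n + 1) with ht
  have htmem : ∀ n, t n ∈ Ioc 0 t₀ := fun n =>
    ⟨by positivity, div_le_self ht₀pos.le (by linarith [n.cast_nonneg (α := ℝ)])⟩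
  have htℓ : ∀ n, t n ∈ Icc 0 ℓ := fun n =>
    ⟨(htmem n).1.le, (htmem n).2.trans (min_le_left _ _)⟩
  have h0ℓ : (0 : ℝ) ∈ Icc 0 ℓ := ⟨le_rfl, hℓ0.le⟩
  have htlim : Tendsto t atTop (𝓝 0) :=
    tendsto_const_nhds.div_atTop (tendsto_atTop_add_const_right _ _ tendsto_natCast_atTop_atTop)
  -- the coefficient of `sin`
  set B : ℕ → Ω → ℝ := fun n ω => ((X (pt (t n)) ω - m (t n)) -
    Real.cos (κ * t n) * (X (pt 0) ω - m 0)) / Real.sin (κ * t n) with hB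
  have hBeq : ∀ n, B n =ᵐ[P] B 0 := by
    intro n
    set y := centeredLp hM.memLp with hy
    have hin : ∀ a b : ℝ, a ∈ Icc 0 ℓ → b ∈ Icc 0 ℓ →
        inner ℝ (y (pt a)) (y (pt b)) = σ * Real.cos (κ * (a - b)) := fun a b ha hb => by
      rw [hy, inner_centeredLp, hcov a b ha hb]
    have hsn := (hsin _ (htmem n)).ne'
    have hs0 := (hsin _ (htmem 0)).ne'
    -- Both times give the same coefficient of the sine: the squared norm of the difference,
    -- expanded with the cosine covariance, vanishes identically.
    have hD : (Real.sin (κ * t 0)) • (y (pt (t n)) - Real.cos (κ * t n) • y (pt 0)) -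
        (Real.sin (κ * t n)) • (y (pt (t 0)) - Real.cos (κ * t 0) • y (pt 0)) = 0 := by
      rw [← inner_self_eq_zero (𝕜 := ℝ)]
      simp only [inner_sub_left, inner_sub_right, real_inner_smul_left, real_inner_smul_right,
        hin _ _ (htℓ n) (htℓ n), hin _ _ (htℓ n) (htℓ 0), hin _ _ (htℓ 0) (htℓ n),
        hin _ _ (htℓ 0) (htℓ 0), hin _ _ (htℓ n) h0ℓ, hin _ _ h0ℓ (htℓ n), hin _ _ (htℓ 0) h0ℓ,
        hin _ _ h0ℓ (htℓ 0), hin _ _ h0ℓ h0ℓ, mul_sub, Real.cos_sub, mul_zero, Real.cos_zero,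
        Real.sin_zero]
      ring
    have hD' := (Lp.eq_zero_iff_ae_eq_zero.1 hD)
    filter_upwards [hD', Lp.coeFn_sub ((Real.sin (κ * t 0)) • (y (pt (t n)) -
        Real.cos (κ * t n) • y (pt 0))) ((Real.sin (κ * t n)) • (y (pt (t 0)) -
        Real.cos (κ * t 0) • y (pt 0))),
      Lp.coeFn_smul (Real.sin (κ * t 0)) (y (pt (t n)) - Real.cos (κ * t n) • y (pt 0)),
      Lp.coeFn_smul (Real.sin (κ * t n)) (y (pt (t 0)) - Real.cos (κ * t 0) • y (pt 0)),
      Lp.coeFn_sub (y (pt (t n))) (Real.cos (κ * t n) • y (pt 0)),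
      Lp.coeFn_sub (y (pt (t 0))) (Real.cos (κ * t 0) • y (pt 0)),
      Lp.coeFn_smul (Real.cos (κ * t n)) (y (pt 0)), Lp.coeFn_smul (Real.cos (κ * t 0)) (y (pt 0)),
      coeFn_centeredLp hM.memLp (pt (t n)), coeFn_centeredLp hM.memLp (pt (t 0)),
      coeFn_centeredLp hM.memLp (pt 0)] with ω a1 a2 a3 a4 a5 a6 a7 a8 a9 a10 a11
    rw [a2] at a1
    simp only [Pi.sub_apply, Pi.smul_apply, smul_eq_mul, Pi.zero_apply, a3, a4, a5, a6, a7, a8]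
      at a1
    rw [hy, a9, a10, a11] at a1
    simp only [hB]
    rw [div_eq_div_iff hsn hs0]
    linarith
  -- the event that `B > 0` belongs to the germ field at `pt 0`
  set S := Φ.arc ℓ with hS
  have hSopen := Φ.isOpen_arc le_rfl hℓ0
  have hptℓ : pt ℓ = pt 0 := by simp [hpt, AddCircle.coe_period]
  have hSc : Sᶜ = {pt 0} := by
    rw [hS, Φ.compl_arc le_rfl hℓ0, Icc_self, image_singleton, ← hptℓ]
  have hfr : frontier S ⊆ {pt 0} := by
    have h1 := Φ.frontier_arc_subset le_rfl hℓ0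
    rwa [show Φ.symm (ℓ : AddCircle ℓ) = pt 0 from hptℓ,
      show Φ.symm ((0 : ℝ) : AddCircle ℓ) = pt 0 from rfl, pair_eq_singleton] at h1
  have hcl : Sᶜ ⊆ closure S := by
    rw [hSc, hS, Φ.closure_arc hℓ0, singleton_subset_iff]
    exact ⟨0, h0ℓ, rfl⟩
  -- The tail form depends only on arbitrarily small times, which puts `A` exactly, not just up to
  -- null sets, into the germ field.
  set A : Set Ω := {ω | ∀ᶠ n in atTop, 0 < B n ω} with hA
  have hAmeas : MeasurableSet[fieldSigmaPlus X Sᶜ] A := by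
    rw [hSc]
    simp only [MeasurableSpace.measurableSet_iInf]
    intro ε hε
    obtain ⟨N, hN⟩ : ∃ N, ∀ n ≥ N, pt (t n) ∈ Metric.thickening ε {pt 0} := by
      have h1 : Tendsto (fun n => pt (t n)) atTop (𝓝 (pt 0)) :=
        (Φ.continuous_symm_coe.tendsto 0).comp htlim
      have h2 := h1.eventually (Metric.isOpen_thickening.mem_nhds
        (Metric.self_subset_thickening hε {pt 0} rfl))
      exact eventually_atTop.1 h2
    have hAeq : A = ⋃ k : ℕ, ⋂ n : ℕ, {ω | 0 < B (n + k + N) ω} := by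
      ext ω
      simp only [hA, mem_ofPred_eq, mem_iUnion, mem_iInter, eventually_atTop]
      constructor
      · rintro ⟨k, hk⟩
        exact ⟨k, fun n => hk _ (by omega)⟩
      · rintro ⟨k, hk⟩
        refine ⟨k + N, fun n hn => ?_⟩
        have := hk (n - (k + N))
        rwa [show n - (k + N) + k + N = n by omega] at this
    rw [hAeq]
    refine MeasurableSet.iUnion fun k => MeasurableSet.iInter fun n => ?_
    have hBm : Measurable[fieldSigma X (Metric.thickening ε {pt 0})] (B (n + k + N)) := by
      have h1 := measurable_fieldSigma X (hN (n + k + N) (by omega))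
      have h2 := measurable_fieldSigma X (Metric.self_subset_thickening hε {pt 0} rfl)
      exact ((h1.sub_const _).sub ((h2.sub_const _).const_mul _)).div_const _
    exact hBm measurableSet_Ioi
  have hAae : A =ᵐ[P] {ω | 0 < B 0 ω} := by
    filter_upwards [ae_all_iff.2 hBeq] with ω hω
    refine propext ?_
    change (∀ᶠ n in atTop, 0 < B n ω) ↔ 0 < B 0 ω
    simp_rw [hω]
    exact eventually_const
  -- independence of `X (pt 0)`
  set p : Fin 2 → T := ![pt (t 0), pt 0] with hp
  set c : Fin 2 → ℝ := ![1, -Real.cos (κ * t 0)] with hc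
  set Z : Ω → ℝ := fun ω => ∑ i, c i * X (p i) ω with hZ
  have hZeq : ∀ ω, Z ω = X (pt (t 0)) ω - Real.cos (κ * t 0) * X (pt 0) ω := fun ω => by
    simp [hZ, hp, hc]
    ring
  have hset : {ω | 0 < B 0 ω} = Z ⁻¹' Ioi (m (t 0) - Real.cos (κ * t 0) * m 0) := by
    ext ω
    simp only [mem_ofPred_eq, mem_preimage, mem_Ioi, hB, hZeq]
    rw [lt_div_iff₀ (hsin _ (htmem 0)), zero_mul, ← sub_pos (b := m (t 0) - _)]
    ring_nf
  have hcov' : ∀ a b : ℝ, a ∈ Icc 0 ℓ → b ∈ Icc 0 ℓ →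
      cov[X (pt a), X (pt b); P] = σ * Real.cos (κ * (a - b)) := hcov
  have hZm : Measurable Z := Finset.measurable_sum _ fun i _ => (hX _).const_mul _
  have hZ0 : ∀ s ∈ frontier S, cov[Z, X s; P] = 0 := by
    intro s hs
    obtain rfl : s = pt 0 := hfr hs
    rw [covariance_linearCombination hM.memLp]
    simp [hp, hc, hcov' _ _ (htℓ 0) h0ℓ, hcov' _ _ h0ℓ h0ℓ]
    ring
  have hind := hgauss.indep_linearCombination hX p c (frontier S) hZ0
  -- `Sᶜ ⊆ closure S` places `A` in both split sigma-algebras, so it may be paired with itself: a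
  -- zero-one law.
  have hPA : P A * P A = P A := by
    have h1 := (hM.splits S hSopen).measure_inter_eq_mul (fieldSigma_le hX _)
      (fieldSigmaPlus_mono X hcl _ hAmeas) hAmeas (fieldSigmaPlus_le hX _ _ hAmeas)
      (fieldSigmaPlus_le hX _ _ hAmeas) fun C hC => by
        have h2 := (Indep_iff _ _ _).1 hind _ _
          ⟨Ioi (m (t 0) - Real.cos (κ * t 0) * m 0), measurableSet_Ioi, rfl⟩ hC
        rw [← hset] at h2
        rw [measure_congr hAae, measure_congr (hAae.inter (ae_eq_refl C)), h2]
    rw [inter_self] at h1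
    exact h1.symm
  -- but `Z` has a nondegenerate Gaussian law
  have hZvar : Var[Z; P] = σ * Real.sin (κ * t 0) ^ 2 := by
    rw [← covariance_self hZm.aemeasurable]
    have h1 : cov[Z, Z; P] = ∑ i, c i * cov[Z, X (p i); P] := by
      rw [show cov[Z, Z; P] = cov[Z, fun ω => ∑ i, c i * X (p i) ω; P] from rfl,
        covariance_fun_sum_right (fun i => (hM.memLp _).const_mul _)
          (memLp_linearCombination hM.memLp p c)]
      simp_rw [covariance_const_mul_right]
      rfl
    rw [h1]
    simp only [hZ, covariance_linearCombination hM.memLp]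
    simp [hp, hc, hcov' _ _ (htℓ 0) h0ℓ, hcov' _ _ h0ℓ h0ℓ, hcov' _ _ h0ℓ (htℓ 0),
      hcov' _ _ (htℓ 0) (htℓ 0)]
    rw [Real.sin_sq]
    ring
  have hlaw : P.map Z = gaussianReal (P[Z]) (Var[Z; P]).toNNReal :=
    ((hgauss.sumElim_linearCombination p c ∅).hasGaussianLaw_eval (.inl ())).map_eq_gaussianReal
  have hv : (Var[Z; P]).toNNReal ≠ 0 := by
    rw [hZvar, ne_eq, Real.toNNReal_eq_zero, not_le]
    have := hsin _ (htmem 0)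
    positivity
  -- Lebesgue measure is absolutely continuous with respect to the law of `Z`, so neither a
  -- half-line nor its complement can be null.
  have hac : volume ≪ P.map Z := by
    rw [hlaw]
    exact gaussianReal_absolutelyContinuous' _ hv
  have hPA' : P A = P.map Z (Ioi (m (t 0) - Real.cos (κ * t 0) * m 0)) := by
    rw [measure_congr hAae, hset, Measure.map_apply hZm measurableSet_Ioi]
  have hne0 : P A ≠ 0 := by
    rw [hPA']
    intro h
    simpa using hac h
  have hone : P A = 1 := by
    have h1 : P A * P A = P A * 1 := by rw [hPA, mul_one]
    exact (ENNReal.mul_right_inj hne0 (measure_ne_top _ _)).1 h1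
  have hprob : IsProbabilityMeasure (P.map Z) := Measure.isProbabilityMeasure_map hZm.aemeasurable
  have h2 : P.map Z (Ioi (m (t 0) - Real.cos (κ * t 0) * m 0))ᶜ = 0 := by
    rw [prob_compl_eq_zero_iff measurableSet_Ioi, ← hPA', hone]
  simpa using hac h2

include Φ in
/-- The covariance function of an isotropic nondegenerate Gaussian Markov field on a circle. -/
theorem IsMarkovOfOrderOne.exists_covariance_eq_cosh (hM : IsMarkovOfOrderOne P X)
    (hgauss : IsGaussianProcess X P) (hX : ∀ s, Measurable (X s)) (R : ℝ → ℝ)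
    (hR : ∀ s s', cov[X s, X s'; P] = R (dist s s'))
    (hnd : ∃ s s', Var[fun ω => X s ω - X s' ω; P] ≠ 0) :
    ∃ A κ, 0 < A ∧ 0 < κ ∧
      ∀ s s', cov[X s, X s'; P] = A * Real.cosh (κ * (dist s s' - ℓ / 2)) := by
  have hℓ0 := hℓ.out
  set pt : ℝ → T := fun a => Φ.symm (a : AddCircle ℓ) with hpt
  set ρ : ℝ → ℝ := fun w => R ‖(w : AddCircle ℓ)‖ with hρ_def
  have hρ : ∀ a b : ℝ, cov[X (pt a), X (pt b); P] = ρ (a - b) := fun a b => by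
    rw [hR, hpt, Φ.dist_symm_coe]
  have heven : ∀ w, ρ (-w) = ρ w := fun w => by
    simp only [hρ_def, AddCircle.coe_neg, norm_neg]
  have hsymm : ∀ w, ρ (ℓ - w) = ρ w := fun w => by
    simp only [hρ_def, AddCircle.coe_sub, AddCircle.coe_period, zero_sub, norm_neg]
  have hin : ∀ w, ρ w = inner ℝ (centeredLp hM.memLp (pt w)) (centeredLp hM.memLp (pt 0)) :=
    fun w => by rw [inner_centeredLp, hρ, sub_zero]
  have hnorm : ∀ w, ‖centeredLp hM.memLp (pt w)‖ ^ 2 = ρ 0 := fun w => by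
    rw [← real_inner_self_eq_norm_sq, inner_centeredLp, hρ, sub_self]
  have hle : ∀ w, |ρ w| ≤ ρ 0 := fun w => by
    have h1 := abs_real_inner_le_norm (centeredLp hM.memLp (pt w)) (centeredLp hM.memLp (pt 0))
    rw [← hin w] at h1
    have h2 : ‖centeredLp hM.memLp (pt w)‖ = ‖centeredLp hM.memLp (pt 0)‖ := by
      rw [← sq_eq_sq₀ (norm_nonneg _) (norm_nonneg _), hnorm w, hnorm 0]
    rwa [h2, ← sq, hnorm 0] at h1
  have hc : Continuous ρ := by
    rw [show ρ = _ from funext hin]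
    exact (hM.continuous_centeredLp.comp Φ.continuous_symm_coe).inner continuous_const
  have hvar : ∀ s s', Var[fun ω => X s ω - X s' ω; P] = 2 * (ρ 0 - R (dist s s')) := by
    intro s s'
    rw [← covariance_self (show AEMeasurable (fun ω => X s ω - X s' ω) P from
        ((hX s).sub (hX s')).aemeasurable),
      covariance_fun_sub_fun_sub (hM.memLp s) (hM.memLp s') (hM.memLp s) (hM.memLp s'),
      hR, hR, hR, hR, dist_self, dist_self, dist_comm s' s]
    simp only [hρ_def, AddCircle.coe_zero, norm_zero]
    ring
  have hdist : ∀ s s' : T, dist s s' ∈ Icc 0 ℓ ∧ R (dist s s') = ρ (dist s s') := by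
    intro s s'
    have h1 : dist s s' ≤ ℓ / 2 := by
      rw [← Φ.isometry.dist_eq, dist_eq_norm]
      have := AddCircle.norm_le_half_period (p := ℓ) (x := Φ s - Φ s') hℓ0.ne'
      rwa [abs_of_pos hℓ0] at this
    refine ⟨⟨dist_nonneg, by linarith⟩, ?_⟩
    simp only [hρ_def]
    rw [(AddCircle.norm_coe_eq_abs_iff ℓ hℓ0.ne').2, abs_of_nonneg dist_nonneg]
    rwa [abs_of_nonneg dist_nonneg, abs_of_pos hℓ0]
  have h0 : 0 < ρ 0 := by
    obtain ⟨s, s', h⟩ := hnd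
    have h1 : 0 ≤ ρ 0 := (abs_nonneg _).trans (hle 0)
    refine h1.lt_of_ne' fun h2 => h ?_
    have h3 := hle (dist s s')
    rw [h2] at h3
    have h4 := abs_eq_zero.1 (le_antisymm h3 (abs_nonneg _))
    rw [hvar, (hdist s s').2, h2, h4]
    simp
  -- By reflection symmetry of the arc, `k` serves as regression coefficient for both end points.
  -- The position `h + w` runs through `[2h, ℓ]`, the complement of the arc.
  have hmarkov : ∀ h, 0 < h → 2 * h < ℓ → ρ 0 + ρ (2 * h) ≠ 0 → ∀ w, h ≤ w → w ≤ ℓ - h →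
      ρ w = ρ h / (ρ 0 + ρ (2 * h)) * (ρ (w + h) + ρ (w - h)) := by
    intro h hh hh2 hne w hw hw'
    set k := ρ h / (ρ 0 + ρ (2 * h)) with hk
    have hb0 : 0 < 2 * h := by linarith
    have hk' : k * (ρ 0 + ρ (2 * h)) = ρ h := div_mul_cancel₀ _ hne
    have h1 := hM.covariance_eq_zero hgauss hX (Φ.isOpen_arc hh2.le hb0)
      ![pt h, pt 0, pt (2 * h)] ![1, -k, -k] (fun i => ?_) (fun s hs => ?_)
      (Φ.symm_coe_notMem_arc (w := h + w) hh2.le hb0 ⟨by linarith, by linarith⟩)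
    · change ∑ i, ![1, -k, -k] i * cov[X (![pt h, pt 0, pt (2 * h)] i), X (pt (h + w)); P] = 0 at h1
      simp only [Fin.sum_univ_three, Matrix.cons_val_zero, Matrix.cons_val_one, Matrix.cons_val,
        hρ] at h1
      rw [show h - (h + w) = -w by ring, show 0 - (h + w) = -(w + h) by ring,
        show 2 * h - (h + w) = -(w - h) by ring, heven, heven, heven] at h1
      linarith
    · rw [Φ.closure_arc hb0]
      fin_cases i
      · exact ⟨h, ⟨hh.le, by linarith⟩, rfl⟩
      · exact ⟨0, ⟨le_rfl, hb0.le⟩, rfl⟩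
      · exact ⟨2 * h, ⟨hb0.le, le_rfl⟩, rfl⟩
    · rcases Φ.frontier_arc_subset hh2.le hb0 hs with rfl | rfl
      · change ∑ i, ![1, -k, -k] i * cov[X (![pt h, pt 0, pt (2 * h)] i), X (pt 0); P] = 0
        simp only [Fin.sum_univ_three, Matrix.cons_val_zero, Matrix.cons_val_one, Matrix.cons_val,
          hρ, sub_zero]
        linarith
      · change ∑ i, ![1, -k, -k] i *
          cov[X (![pt h, pt 0, pt (2 * h)] i), X (pt (2 * h)); P] = 0
        simp only [Fin.sum_univ_three, Matrix.cons_val_zero, Matrix.cons_val_one, Matrix.cons_val,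
          hρ, sub_self]
        rw [show h - 2 * h = -h by ring, zero_sub, heven, heven]
        linarith
  rcases cosh_or_cos_of_markov_relation hℓ0 hc.continuousOn (fun w _ => hsymm w) h0
    (fun w _ => hle w) hmarkov with ⟨A, κ, hA, hκ, h⟩ | ⟨κ, hκ, h⟩
  · refine ⟨A, κ, hA, hκ, fun s s' => ?_⟩
    rw [hR, (hdist s s').2, h _ (hdist s s').1]
  · exfalso
    rcases hκ.eq_or_lt with rfl | hκ
    · obtain ⟨s, s', hne⟩ := hnd
      refine hne ?_
      rw [hvar, (hdist s s').2, h _ (hdist s s').1]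
      simp
    · refine hM.not_covariance_cos Φ hgauss hX h0 hκ fun a b ha hb => ?_
      change cov[X (pt a), X (pt b); P] = _
      rw [hρ]
      rcases le_total b a with hab | hab
      · exact h _ ⟨by linarith, by linarith [ha.2, hb.1]⟩
      · rw [← heven, h _ ⟨by linarith, by linarith [ha.1, hb.2]⟩, neg_sub, ← Real.cos_neg,
          ← mul_neg, neg_sub]

end Circle

/-! ### Gaussian spaces -/

section GaussianSpace

variable {Ω : Type*} {mΩ : MeasurableSpace Ω} {P : Measure Ω} [IsProbabilityMeasure P]

theorem integrable_cexp_mul_I {Z : Ω → ℝ} (hZ : AEStronglyMeasurable Z P) :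
    Integrable (fun ω => Complex.exp (Z ω * Complex.I)) P := by
  refine Integrable.of_bound (C := 1) ?_ (Eventually.of_forall fun ω => ?_)
  · exact Continuous.comp_aestronglyMeasurable (g := fun x : ℝ => Complex.exp (x * Complex.I))
      (by fun_prop) hZ
  · rw [Complex.norm_exp_ofReal_mul_I]

/-- The map `x ↦ exp (i x)` is 1-Lipschitz, and the `L₁` norm is at most the `L₂` norm on a
probability space. -/
theorem continuous_integral_cexp_mul_I :
    Continuous fun Z : Lp ℝ 2 P => ∫ ω, Complex.exp (Z ω * Complex.I) ∂P := by
  refine (LipschitzWith.of_dist_le_mul (K := 1) fun Z Z' => ?_).continuous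
  have hZ := integrable_cexp_mul_I (Lp.memLp Z).1
  have hZ' := integrable_cexp_mul_I (Lp.memLp Z').1
  rw [NNReal.coe_one, one_mul, dist_eq_norm, ← integral_sub hZ hZ']
  have h1 : ∀ a b : ℝ, ‖Complex.exp (a * Complex.I) - Complex.exp (b * Complex.I)‖ ≤ ‖a - b‖ := by
    intro a b
    have h := Real.norm_exp_I_mul_ofReal_sub_one_le (x := a - b)
    calc ‖Complex.exp (a * Complex.I) - Complex.exp (b * Complex.I)‖
        = ‖Complex.exp (b * Complex.I) * (Complex.exp (Complex.I * (a - b : ℝ)) - 1)‖ := by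
          rw [mul_sub, ← Complex.exp_add, mul_one]
          congr 3
          push_cast
          ring
      _ ≤ _ := by rw [norm_mul, Complex.norm_exp_ofReal_mul_I, one_mul]; exact h
  have hint : Integrable (fun ω => ‖Z ω - Z' ω‖) P :=
    (((Lp.memLp Z).integrable (by norm_num)).sub ((Lp.memLp Z').integrable (by norm_num))).norm
  refine (norm_integral_le_of_norm_le hint (Eventually.of_forall fun ω => h1 _ _)).trans ?_
  have h2 : eLpNorm (Z - Z' : Lp ℝ 2 P) 1 P ≤ eLpNorm (Z - Z' : Lp ℝ 2 P) 2 P :=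
    eLpNorm_le_eLpNorm_of_exponent_le (by norm_num) (Lp.memLp _).1
  have h3 := ENNReal.toReal_mono (Lp.memLp (Z - Z')).2.ne h2
  rw [dist_eq_norm, Lp.norm_def]
  refine le_trans (le_of_eq ?_) h3
  rw [eLpNorm_one_eq_lintegral_enorm, ← integral_norm_eq_lintegral_enorm (Lp.memLp _).1]
  refine integral_congr_ae ?_
  filter_upwards [Lp.coeFn_sub Z Z'] with ω h
  rw [h, Pi.sub_apply]

/-- `K` consists of centred random variables with Gaussian characteristic functions. -/
def IsGaussianSpace (P : Measure Ω) (K : Submodule ℝ (Lp ℝ 2 P)) : Prop :=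
  ∀ Z ∈ K, ∫ ω, Z ω ∂P = 0 ∧
    ∫ ω, Complex.exp (Z ω * Complex.I) ∂P = Complex.exp (-(‖Z‖ ^ 2 / 2 : ℝ))

theorem continuous_integral_Lp_two : Continuous fun Z : Lp ℝ 2 P => ∫ ω, Z ω ∂P := by
  have h : (fun Z : Lp ℝ 2 P => ∫ ω, Z ω ∂P) = fun Z =>
      inner ℝ ((memLp_const (1 : ℝ)).toLp (fun _ : Ω => (1 : ℝ)) : Lp ℝ 2 P) Z := by
    funext Z
    rw [L2.inner_def]
    refine integral_congr_ae ?_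
    filter_upwards [(memLp_const (1 : ℝ) : MemLp (fun _ : Ω => (1 : ℝ)) 2 P).coeFn_toLp] with ω e
    rw [e]
    simp
  rw [h]
  fun_prop

/-- Both defining conditions compare continuous functions on `L₂(Ω)`, so they survive limits. -/
theorem IsGaussianSpace.topologicalClosure {K : Submodule ℝ (Lp ℝ 2 P)}
    (hK : IsGaussianSpace P K) : IsGaussianSpace P K.topologicalClosure := by
  have hc : IsClosed {Z : Lp ℝ 2 P | ∫ ω, Z ω ∂P = 0 ∧
      ∫ ω, Complex.exp (Z ω * Complex.I) ∂P = Complex.exp (-(‖Z‖ ^ 2 / 2 : ℝ))} :=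
    (isClosed_eq continuous_integral_Lp_two continuous_const).inter
      (isClosed_eq continuous_integral_cexp_mul_I (by fun_prop))
  exact fun Z hZ => closure_minimal hK hc hZ

/-- Every linear functional of finitely many members lies again in `K`. As `K` is closed under
scaling, characteristic functions at the argument `1` already determine the joint law. -/
theorem IsGaussianSpace.isGaussianProcess {K : Submodule ℝ (Lp ℝ 2 P)}
    (hK : IsGaussianSpace P K) {ι : Type*} (Z : ι → Lp ℝ 2 P) (hZ : ∀ i, Z i ∈ K) :
    IsGaussianProcess (fun i ω => Z i ω) P := by
  classical
  refine ⟨fun I => ?_⟩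
  have hm : AEMeasurable (fun ω => I.restrict fun i => Z i ω) P :=
    aemeasurable_pi_lambda _ fun i => (Lp.memLp (Z i)).1.aemeasurable
  rw [hasGaussianLaw_iff_charFunDual_map_eq hm]
  intro L
  set S : Lp ℝ 2 P := ∑ i : I, L (Pi.single i 1) • Z i with hS
  have hSK : S ∈ K := Submodule.sum_mem _ fun i _ => K.smul_mem _ (hZ i)
  have hSL : S =ᵐ[P] fun ω => L (I.restrict fun i => Z i ω) := by
    have h1 : ∀ᵐ ω ∂P, ∀ i : I, (L (Pi.single i 1) • Z i : Lp ℝ 2 P) ω =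
        L (Pi.single i 1) * Z i ω := by
      rw [ae_all_iff]
      intro i
      filter_upwards [Lp.coeFn_smul (L (Pi.single i 1)) (Z i)] with ω h
      rw [h, Pi.smul_apply, smul_eq_mul]
    have h2 : S =ᵐ[P] fun ω => ∑ i : I, (L (Pi.single i 1) • Z i : Lp ℝ 2 P) ω :=
      (Lp.coeFn_finsetSum _ _).trans (Eventually.of_forall fun ω => Finset.sum_apply _ _ _)
    filter_upwards [h1, h2] with ω h1 h2
    rw [h2]
    conv_rhs => rw [← Finset.univ_sum_single (I.restrict fun i => Z i ω)]
    rw [map_sum]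
    refine Finset.sum_congr rfl fun i _ => ?_
    rw [h1, mul_comm, ← smul_eq_mul, ← map_smul, ← Pi.single_smul, smul_eq_mul, mul_one]
    rfl
  obtain ⟨h0, h1⟩ := hK S hSK
  have hmean : P[L ∘ fun ω => I.restrict fun i => Z i ω] = 0 := by
    rw [← h0]
    exact integral_congr_ae hSL.symm
  have hvar : Var[L ∘ fun ω => I.restrict fun i => Z i ω; P] = ‖S‖ ^ 2 := by
    rw [variance_congr (show L ∘ (fun ω => I.restrict fun i => Z i ω) =ᵐ[P] S from hSL.symm), variance_of_integral_eq_zero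
      (Lp.memLp S).1.aemeasurable h0, ← real_inner_self_eq_norm_sq, L2.inner_def]
    refine integral_congr_ae (Eventually.of_forall fun ω => ?_)
    simp [sq]
  rw [hmean, hvar, charFunDual_apply, integral_map hm (by fun_prop)]
  rw [show Complex.exp (((0 : ℝ) : ℂ) * Complex.I - ((‖S‖ ^ 2 : ℝ) : ℂ) / 2) =
    Complex.exp (-(‖S‖ ^ 2 / 2 : ℝ)) by push_cast; ring_nf, ← h1]
  refine integral_congr_ae ?_
  filter_upwards [hSL] with ω h
  rw [h]

theorem isGaussianSpace_span_centeredLp {T : Type*} {X : T → Ω → ℝ}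
    (hX : ∀ s, MemLp (X s) 2 P) (hgauss : IsGaussianProcess X P) :
    IsGaussianSpace P (Submodule.span ℝ (range (centeredLp hX))) := by
  intro Z hZ
  obtain ⟨c, rfl⟩ := (Finsupp.mem_span_range_iff_exists_finsupp).1 hZ
  set Y : Ω → ℝ := fun ω => ∑ s ∈ c.support, c s * X s ω with hY
  set m : ℝ := ∑ s ∈ c.support, c s * ∫ ω, X s ω ∂P with hm
  set Z : Lp ℝ 2 P := c.sum fun s a => a • centeredLp hX s with hZdef
  have hZY : Z =ᵐ[P] fun ω => Y ω - m := by
    have h1 : ∀ s, (c s • centeredLp hX s : Lp ℝ 2 P) =ᵐ[P]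
        fun ω => c s * (X s ω - ∫ ω, X s ω ∂P) := by
      intro s
      filter_upwards [Lp.coeFn_smul (c s) (centeredLp hX s), coeFn_centeredLp hX s] with ω h h'
      rw [h, Pi.smul_apply, h', smul_eq_mul]
    have h2 : Z =ᵐ[P] fun ω => ∑ s ∈ c.support, (c s • centeredLp hX s : Lp ℝ 2 P) ω :=
      (Lp.coeFn_finsetSum _ _).trans (Eventually.of_forall fun ω => Finset.sum_apply _ _ _)
    have h3 : ∀ᵐ ω ∂P, ∀ s ∈ c.support, (c s • centeredLp hX s : Lp ℝ 2 P) ω =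
        c s * (X s ω - ∫ ω, X s ω ∂P) :=
      (Finset.eventually_all _).2 fun s _ => h1 s
    filter_upwards [h2, h3] with ω h2 h3
    rw [h2, Finset.sum_congr rfl h3, hY, hm, ← Finset.sum_sub_distrib]
    exact Finset.sum_congr rfl fun s _ => by ring
  have hYg : HasGaussianLaw Y P := by
    have := (hgauss.smul c).hasGaussianLaw_fun_sum (I := c.support)
    simpa [hY] using this
  have hYL : MemLp Y 2 P := hYg.memLp_two
  have hmean : ∫ ω, Y ω ∂P = m := by
    rw [hY, hm, integral_finsetSum _ fun s _ => ((hX s).integrable (by norm_num)).const_mul _]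
    simp_rw [integral_const_mul]
  have h0 : ∫ ω, Z ω ∂P = 0 := by
    rw [integral_congr_ae hZY, integral_sub (hYL.integrable (by norm_num)) (integrable_const _),
      hmean]
    simp
  refine ⟨h0, ?_⟩
  have hvar : Var[Y; P] = ‖Z‖ ^ 2 := by
    have h1 : Var[Z; P] = Var[Y; P] := by
      rw [variance_congr hZY, variance_sub_const hYL.1]
    rw [← h1, variance_of_integral_eq_zero
      (Lp.memLp Z).1.aemeasurable h0, ← real_inner_self_eq_norm_sq, L2.inner_def]
    refine integral_congr_ae (Eventually.of_forall fun ω => ?_)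
    simp [sq]
  have h2 := hYg.charFun_map_eq 1
  simp only [RCLike.inner_apply, conj_trivial, mul_one] at h2
  rw [charFun_apply_real, integral_map hYL.1.aemeasurable (by fun_prop), hmean, hvar] at h2
  have h3 : ∫ ω, Complex.exp (Z ω * Complex.I) ∂P =
      (∫ ω, Complex.exp (1 * Y ω * Complex.I) ∂P) * Complex.exp (-m * Complex.I) := by
    rw [← integral_mul_const]
    refine integral_congr_ae ?_
    filter_upwards [hZY] with ω h
    rw [h, ← Complex.exp_add]
    congr 1
    push_cast
    ring
  push_cast at h2 h3 ⊢
  rw [h3, h2, ← Complex.exp_add]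
  congr 1
  ring

end GaussianSpace

/-! ### White noise from an eigenbasis of a covariance operator -/

section Hilbert

variable {T H ι : Type*} [TopologicalSpace T] [CompactSpace T] [SecondCountableTopology T]
  [MeasurableSpace T] [OpensMeasurableSpace T] {μ : Measure T} [IsFiniteMeasure μ]
  [NormedAddCommGroup H] [InnerProductSpace ℝ H] [CompleteSpace H] {y : T → H}

omit [CompleteSpace H] in
theorem integrable_smul_of_continuous (hy : Continuous y) (ψ : Lp ℝ 2 μ) :
    Integrable (fun s => ψ s • y s) μ := by
  obtain ⟨C, hC⟩ := isCompact_univ.exists_bound_of_continuousOn hy.continuousOn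
  exact ((Lp.memLp ψ).integrable (by norm_num)).smul_bdd C hy.aestronglyMeasurable
    (Eventually.of_forall fun s => hC s (mem_univ s))

theorem inner_integral_smul (hy : Continuous y) (ψ : Lp ℝ 2 μ) (z : H) :
    inner ℝ (∫ s, ψ s • y s ∂μ) z = ∫ s, ψ s * inner ℝ (y s) z ∂μ := by
  rw [real_inner_comm, ← integral_inner (integrable_smul_of_continuous hy ψ)]
  refine integral_congr_ae (Eventually.of_forall fun s => ?_)
  simp only [inner_smul_right, real_inner_comm]

/-- A vector orthogonal to all `y s` is orthogonal to the integral, and `K` is its own double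
orthogonal complement. -/
theorem integral_smul_mem (hy : Continuous y) (ψ : Lp ℝ 2 μ) :
    ∫ s, ψ s • y s ∂μ ∈ (Submodule.span ℝ (range y)).topologicalClosure := by
  set K := (Submodule.span ℝ (range y)).topologicalClosure with hK
  have : CompleteSpace K := (Submodule.isClosed_topologicalClosure _).completeSpace_coe
  rw [← K.orthogonal_orthogonal, Submodule.mem_orthogonal']
  intro z hz
  rw [inner_integral_smul hy]
  refine integral_eq_zero_of_ae (Eventually.of_forall fun s => ?_)
  have : inner ℝ (y s) z = 0 := hz _
    (Submodule.le_topologicalClosure _ (Submodule.subset_span (mem_range_self s)))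
  simp [this]

/-- Let the integral operator with kernel `⟪y s, y t⟫` be diagonal in a Hilbert basis `b` of
`L₂(μ)`, with positive eigenvalues `c n`. Then there is an isometry `W` of `L₂(μ)` into the closed
span of the `y s` such that `∫ ψ s • y s = W φ` if the coefficients of `φ` are those of `ψ`
multiplied by `√(c n)`. -/
theorem exists_isometry_integral_smul_eq (hy : Continuous y) (b : HilbertBasis ι ℝ (Lp ℝ 2 μ))
    (e : ι → T → ℝ) (he : ∀ n, b n =ᵐ[μ] e n) (c : ι → ℝ) (hc : ∀ n, 0 < c n)
    (heig : ∀ n t, ∫ s, e n s * inner ℝ (y s) (y t) ∂μ = c n * e n t) :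
    ∃ W : Lp ℝ 2 μ →ₗᵢ[ℝ] H,
      (∀ φ, W φ ∈ (Submodule.span ℝ (range y)).topologicalClosure) ∧
      ∀ φ ψ : Lp ℝ 2 μ, (∀ n, inner ℝ (b n) φ = √(c n) * inner ℝ (b n) ψ) →
        ∫ s, ψ s • y s ∂μ = W φ := by
  classical
  set K := (Submodule.span ℝ (range y)).topologicalClosure with hK
  have : CompleteSpace K := (Submodule.isClosed_topologicalClosure _).completeSpace_coe
  set U : Lp ℝ 2 μ → H := fun ψ => ∫ s, ψ s • y s ∂μ with hU
  have hUy : ∀ n t, inner ℝ (U (b n)) (y t) = c n * e n t := by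
    intro n t
    rw [hU, inner_integral_smul hy, ← heig]
    refine integral_congr_ae ?_
    filter_upwards [he n] with s hs
    rw [hs]
  have hUU : ∀ n ψ, inner ℝ (U ψ) (U (b n)) = c n * inner ℝ (b n) ψ := by
    intro n ψ
    rw [hU, inner_integral_smul hy, L2.inner_def, ← integral_const_mul]
    refine integral_congr_ae ?_
    filter_upwards [he n] with s hs
    rw [real_inner_comm, show ∫ s, (b n : T → ℝ) s • y s ∂μ = U (b n) from rfl, hUy, hs]
    simp only [RCLike.inner_apply, conj_trivial]
    ring
  -- The vectors `U (b n)` are orthogonal with squared norms `c n`. Normalised, they serve as the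
  -- images of the basis under `W`.
  set g : ι → H := fun n => (√(c n))⁻¹ • U (b n) with hg
  have hsq : ∀ n, √(c n) ≠ 0 := fun n => (Real.sqrt_pos.2 (hc n)).ne'
  have hcsq : ∀ n, c n = √(c n) * √(c n) := fun n => (Real.mul_self_sqrt (hc n).le).symm
  have hgo : Orthonormal ℝ g := by
    rw [orthonormal_iff_ite]
    intro n m
    simp only [hg, inner_smul_left, inner_smul_right, hUU, conj_trivial,
      orthonormal_iff_ite.1 b.orthonormal]
    by_cases h : n = m
    · subst h
      simp only [if_true, mul_one]
      nth_rewrite 3 [hcsq n]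
      field_simp [hsq n]
    · rw [if_neg h, if_neg (Ne.symm h)]
      simp
  set V := hgo.orthogonalFamily.linearIsometry with hV
  set W : Lp ℝ 2 μ →ₗᵢ[ℝ] H := V.comp b.repr.toLinearIsometry with hW
  have hsum : ∀ φ, HasSum (fun n => inner ℝ (b n) φ • g n) (W φ) := by
    intro φ
    have := hgo.orthogonalFamily.hasSum_linearIsometry (b.repr φ)
    simp only [b.repr_apply_apply, LinearIsometry.toSpanSingleton_apply] at this
    exact this
  have hgK : ∀ n, g n ∈ K := fun n => K.smul_mem _ (integral_smul_mem hy _)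
  have hWK : ∀ φ, W φ ∈ K := fun φ => by
    have hcl : IsClosed (K : Set H) := Submodule.isClosed_topologicalClosure _
    exact hcl.mem_of_tendsto (hsum φ)
      (Eventually.of_forall fun s => Submodule.sum_mem _ fun n _ => K.smul_mem _ (hgK n))
  refine ⟨W, hWK, fun φ ψ hφψ => ?_⟩
  -- Parseval for `ψ` and the kernel section at `t` gives the same series as the expansion of `W φ`.
  -- Since the difference also lies in the closed span of the `y t`, it vanishes.
  have horth : ∀ t, inner ℝ (U ψ - W φ) (y t) = 0 := by
    intro t
    have hCm : MemLp (fun s => inner ℝ (y s) (y t)) 2 μ := by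
      obtain ⟨C, hC⟩ := isCompact_univ.exists_bound_of_continuousOn
        (f := fun s => inner ℝ (y s) (y t)) (by fun_prop)
      exact MemLp.of_bound (by fun_prop) C (Eventually.of_forall fun s => hC s (mem_univ s))
    have hin : ∀ ψ : Lp ℝ 2 μ, inner ℝ ψ (hCm.toLp _) = inner ℝ (U ψ) (y t) := by
      intro ψ
      rw [hU, inner_integral_smul hy, L2.inner_def]
      refine integral_congr_ae ?_
      filter_upwards [hCm.coeFn_toLp] with s hs
      rw [hs]
      simp [mul_comm]
    have h1 := b.hasSum_inner_mul_inner ψ (hCm.toLp _)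
    simp only [hin, hUy] at h1
    have h2 := (hsum φ).mapL (innerSL ℝ (y t))
    rw [inner_sub_left, sub_eq_zero]
    refine h1.unique ?_
    have h3 : inner ℝ (W φ) (y t) = innerSL ℝ (y t) (W φ) := real_inner_comm _ _
    rw [h3]
    refine h2.congr_fun fun n => ?_
    have h4 : inner ℝ (y t) (U (b n)) = c n * e n t := by rw [real_inner_comm, hUy]
    rw [innerSL_apply_apply, inner_smul_right, hg, inner_smul_right, h4, hφψ, real_inner_comm]
    field_simp [hsq n]
  have hmem : U ψ - W φ ∈ K := K.sub_mem (integral_smul_mem hy _) (hWK φ)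
  have hz : U ψ - W φ ∈ Kᗮ := by
    rw [hK, Submodule.orthogonal_closure, Submodule.mem_orthogonal']
    intro u hu
    induction hu using Submodule.span_induction with
    | mem x hx => obtain ⟨t, rfl⟩ := hx; exact horth t
    | zero => simp
    | add x z _ _ hx hz => rw [inner_add_right, hx, hz, add_zero]
    | smul a x _ hx => rw [inner_smul_right, hx, mul_zero]
  exact sub_eq_zero.1 (Submodule.disjoint_def.1 K.orthogonal_disjoint _ hmem hz)

end Hilbert

/-! ### Jointly measurable modifications -/

section Modification

variable {T Ω : Type*} [TopologicalSpace T] [SecondCountableTopology T] [MeasurableSpace T]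
  [OpensMeasurableSpace T] {mΩ : MeasurableSpace Ω} {P : Measure Ω} {Y : T → Ω → ℝ}
  {y : T → Lp ℝ 2 P}

-- The second moments of the errors are summable, so almost surely the squared errors are summable
-- and tend to zero.
omit [TopologicalSpace T] [SecondCountableTopology T] [MeasurableSpace T]
  [OpensMeasurableSpace T] in
theorem ae_tendsto_of_dist_le {Z : ℕ → Lp ℝ 2 P} {Z' : Lp ℝ 2 P}
    (h : ∀ j, dist (Z j) Z' ≤ (1 / 2) ^ j) :
    ∀ᵐ ω ∂P, Tendsto (fun j => Z j ω) atTop (𝓝 (Z' ω)) := by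
  have h1 : ∀ j, ∫⁻ ω, ‖Z j ω - Z' ω‖ₑ ^ 2 ∂P ≤ ENNReal.ofReal ((1 / 4) ^ j) := by
    intro j
    have h2 : eLpNorm (fun ω => Z j ω - Z' ω) 2 P ≤ ENNReal.ofReal ((1 / 2) ^ j) := by
      change eLpNorm (Z j - Z' : Ω → ℝ) 2 P ≤ _
      rw [← eLpNorm_congr_ae (Lp.coeFn_sub (Z j) Z'), ← Lp.enorm_def, ← ofReal_norm]
      exact ENNReal.ofReal_le_ofReal ((dist_eq_norm (Z j) Z').symm.le.trans (h j))
    have h3 := eLpNorm_nnreal_pow_eq_lintegral (f := fun ω => Z j ω - Z' ω) (μ := P)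
      (p := 2) (by norm_num)
    simp only [NNReal.coe_ofNat, ENNReal.rpow_ofNat, ENNReal.coe_ofNat] at h3
    rw [← h3]
    calc _ ≤ ENNReal.ofReal ((1 / 2) ^ j) ^ 2 := by gcongr
      _ = _ := by
        rw [← ENNReal.ofReal_pow (by positivity), ← pow_mul, mul_comm, pow_mul]
        norm_num
  have hsum : ∑' j, ∫⁻ ω, ‖Z j ω - Z' ω‖ₑ ^ 2 ∂P ≠ ⊤ := by
    refine ne_top_of_le_ne_top ?_ (ENNReal.tsum_le_tsum h1)
    rw [← ENNReal.ofReal_tsum_of_nonneg (fun j => by positivity)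
      (summable_geometric_of_lt_one (by norm_num) (by norm_num))]
    exact ENNReal.ofReal_ne_top
  have hm : ∀ j, AEMeasurable (fun ω => ‖Z j ω - Z' ω‖ₑ ^ 2) P := fun j =>
    (((Lp.memLp (Z j)).1.sub (Lp.memLp Z').1).enorm).pow_const 2
  rw [← lintegral_tsum hm] at hsum
  filter_upwards [ae_lt_top' (AEMeasurable.tsum hm) hsum] with ω hω
  have h4 := ENNReal.tendsto_atTop_zero_of_tsum_ne_top hω.ne
  rw [tendsto_iff_edist_tendsto_0]
  have h5 : Tendsto (fun j => (‖Z j ω - Z' ω‖ₑ ^ 2) ^ (1 / 2 : ℝ)) atTop (𝓝 (0 ^ (1 / 2 : ℝ))) :=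
    h4.ennrpow_const _
  rw [ENNReal.zero_rpow_of_pos (by norm_num)] at h5
  refine h5.congr fun j => ?_
  rw [← ENNReal.rpow_natCast, ← ENNReal.rpow_mul, edist_eq_enorm_sub]
  norm_num

/-- At stage `j`, replace `s` by the first point of a dense sequence whose value is within `2⁻ʲ` in
`L₂`. This depends on `s` through a measurable index, so each stage is jointly measurable; the
limsup is defined everywhere and agrees almost surely with the field at each `s`. -/
theorem exists_measurable_modification (hY : ∀ s, Measurable (Y s)) (hy : Continuous y)
    (hyY : ∀ s, y s =ᵐ[P] Y s) :
    ∃ u : T → Ω → ℝ, Measurable (Function.uncurry u) ∧ ∀ s, u s =ᵐ[P] Y s := by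
  classical
  rcases isEmpty_or_nonempty T with hT | hT
  · exact ⟨Y, measurable_of_empty _, fun s => isEmptyElim s⟩
  set d := TopologicalSpace.denseSeq T
  have hex : ∀ (j : ℕ) (s : T), ∃ n, dist (y (d n)) (y s) < (1 / 2) ^ j := by
    intro j s
    have ho : IsOpen {t | dist (y t) (y s) < (1 / 2) ^ j} := isOpen_lt (by fun_prop) (by fun_prop)
    exact (TopologicalSpace.denseRange_denseSeq T).exists_mem_open ho ⟨s, by simp⟩
  have hN : ∀ j, Measurable fun s => Nat.find (hex j s) := fun j =>
    measurable_find (hex j) fun n =>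
      (isOpen_lt (f := fun s => dist (y (d n)) (y s)) (by fun_prop) continuous_const).measurableSet
  set v : ℕ → T × Ω → ℝ := fun j p => Y (d (Nat.find (hex j p.1))) p.2
  have hv : ∀ j, Measurable (v j) := fun j => by
    have h1 : Measurable fun p : ℕ × Ω => Y (d p.1) p.2 :=
      measurable_from_prod_countable_right fun n => hY (d n)
    exact h1.comp (((hN j).comp measurable_fst).prodMk measurable_snd)
  refine ⟨fun s ω => limsup (fun j => v j (s, ω)) atTop, Measurable.limsup hv, fun s => ?_⟩
  have h1 := ae_tendsto_of_dist_le (Z := fun j => y (d (Nat.find (hex j s)))) (Z' := y s)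
    fun j => (Nat.find_spec (hex j s)).le
  have h2 : ∀ᵐ ω ∂P, ∀ j, y (d (Nat.find (hex j s))) ω = v j (s, ω) :=
    ae_all_iff.2 fun j => hyY _
  filter_upwards [h1, h2, hyY s] with ω h1 h2 h3
  simp only [h2, h3] at h1
  exact h1.limsup_eq

variable [CompactSpace T] {μ : Measure T} [IsFiniteMeasure μ] [IsProbabilityMeasure P]
  {u : T → Ω → ℝ}

theorem memLp_uncurry (hy : Continuous y) (hu : Measurable (Function.uncurry u))
    (huy : ∀ s, u s =ᵐ[P] y s) : MemLp (Function.uncurry u) 2 (μ.prod P) := by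
  rw [memLp_two_iff_integrable_sq hu.aestronglyMeasurable,
    integrable_prod_iff (hu.pow_const 2).aestronglyMeasurable]
  constructor
  · refine Eventually.of_forall fun s => ?_
    exact ((memLp_congr_ae (huy s)).2 (Lp.memLp (y s))).integrable_sq
  · have h : ∀ s, ∫ ω, ‖Function.uncurry u (s, ω) ^ 2‖ ∂P = ‖y s‖ ^ 2 := by
      intro s
      rw [← real_inner_self_eq_norm_sq, L2.inner_def]
      refine integral_congr_ae ?_
      filter_upwards [huy s] with ω h
      simp [h, sq]
    simp_rw [h]
    obtain ⟨C, hC⟩ := isCompact_univ.exists_bound_of_continuousOn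
      (f := fun s => ‖y s‖ ^ 2) (by fun_prop)
    exact Integrable.of_bound (by fun_prop) C (Eventually.of_forall fun s => hC s (mem_univ s))

/-- The pathwise integral and the integral in `L₂(Ω)` agree over every event: by Fubini for the
former, by the inner product with the indicator for the latter. -/
theorem integral_mul_ae_eq (hy : Continuous y) (hu : Measurable (Function.uncurry u))
    (huy : ∀ s, u s =ᵐ[P] y s) (ψ : Lp ℝ 2 μ) :
    (fun ω => ∫ s, u s ω * ψ s ∂μ) =ᵐ[P] (∫ s, ψ s • y s ∂μ : Lp ℝ 2 P) := by
  have hψ : MemLp (fun p : T × Ω => ψ p.1) 2 (μ.prod P) :=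
    (Lp.memLp ψ).comp_fst P
  have hint : Integrable (fun p : T × Ω => u p.1 p.2 * ψ p.1) (μ.prod P) :=
    (memLp_uncurry (μ := μ) hy hu huy).integrable_mul hψ
  refine Integrable.ae_eq_of_forall_setIntegral_eq _ _ hint.integral_prod_right
    ((Lp.memLp _).integrable (by norm_num)) fun A hA _ => ?_
  have hA1 : MemLp (A.indicator fun _ => (1 : ℝ)) 2 P :=
    (memLp_const (1 : ℝ)).indicator hA
  have hin : ∀ Z : Lp ℝ 2 P, inner ℝ Z (hA1.toLp _) = ∫ ω in A, Z ω ∂P := by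
    intro Z
    rw [L2.inner_def, ← integral_indicator hA]
    refine integral_congr_ae ?_
    filter_upwards [hA1.coeFn_toLp] with ω h
    rw [h]
    by_cases hω : ω ∈ A <;> simp [hω]
  rw [← hin, inner_integral_smul hy]
  have hint' : Integrable (fun p : T × Ω => u p.1 p.2 * ψ p.1) (μ.prod (P.restrict A)) :=
    hint.mono_measure (Measure.prod_mono le_rfl Measure.restrict_le_self)
  rw [← integral_prod_symm _ hint', integral_prod _ hint']
  refine integral_congr_ae (Eventually.of_forall fun s => ?_)
  simp only [hin]
  rw [mul_comm, ← integral_mul_const]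
  refine integral_congr_ae (ae_restrict_of_ae ?_)
  filter_upwards [huy s] with ω h
  rw [h]

end Modification

/-! ### The Hartley basis of the circle -/

section Hartley

variable {ℓ : ℝ} [hℓ : Fact (0 < ℓ)]

/-- The function `cos + sin` of frequency `n` on the circle. -/
noncomputable def hartley (n : ℤ) (x : AddCircle ℓ) : ℝ := (fourier n x).re + (fourier n x).im

omit hℓ in
theorem continuous_hartley (n : ℤ) : Continuous (hartley n : AddCircle ℓ → ℝ) :=
  (Complex.continuous_re.comp (map_continuous _)).add
    (Complex.continuous_im.comp (map_continuous _))

omit hℓ in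
theorem fourier_coe_eq_cos_add_sin (n : ℤ) (x : ℝ) :
    fourier n (x : AddCircle ℓ) =
      (Real.cos (2 * Real.pi * n / ℓ * x) : ℂ) + Real.sin (2 * Real.pi * n / ℓ * x) * Complex.I := by
  rw [fourier_coe_apply, Complex.ofReal_cos, Complex.ofReal_sin, ← Complex.exp_mul_I]
  congr 1
  push_cast
  ring

omit hℓ in
theorem hartley_coe (n : ℤ) (x : ℝ) : hartley n (x : AddCircle ℓ) =
    Real.cos (2 * Real.pi * n / ℓ * x) + Real.sin (2 * Real.pi * n / ℓ * x) := by
  simp only [hartley, fourier_coe_eq_cos_add_sin, Complex.add_re, Complex.add_im,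
    Complex.ofReal_re, Complex.ofReal_im, Complex.re_ofReal_mul, Complex.im_ofReal_mul,
    Complex.I_re, Complex.I_im]
  ring

-- After integration the sine part drops out and orthogonality remains. One family indexed by all
-- integers, with equal norms, thus replaces separate cosines and sines.
omit hℓ in
theorem hartley_mul_hartley (n m : ℤ) (x : AddCircle ℓ) :
    hartley n x * hartley m x = (fourier (n - m) x).re + (fourier (n + m) x).im := by
  rw [sub_eq_add_neg, fourier_add, fourier_add, fourier_neg]
  simp only [hartley, Complex.mul_re, Complex.mul_im, Complex.conj_re, Complex.conj_im]
  ring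

omit hℓ in
theorem hartley_apply_add (n : ℤ) (x y : AddCircle ℓ) : hartley n (x + y) =
    (fourier n x).re * hartley n y + (fourier n x).im * ((fourier n y).re - (fourier n y).im) := by
  have : fourier n (x + y) = fourier n x * fourier n y := by
    simp only [fourier_apply, smul_add, AddCircle.toCircle_add, Circle.coe_mul]
  simp only [hartley, this, Complex.mul_re, Complex.mul_im]
  ring

theorem integral_fourier (k : ℤ) :
    ∫ x : AddCircle ℓ, fourier k x = if k = 0 then (ℓ : ℂ) else 0 := by
  have h0 : (ℓ : ℂ) ≠ 0 := by exact_mod_cast hℓ.out.ne'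
  have h1 := congrFun (fourierCoeff_fourier (T := ℓ) k) 0
  rw [fourierCoeff, AddCircle.integral_haarAddCircle] at h1
  simp only [neg_zero, fourier_zero, one_smul, Complex.real_smul, Complex.ofReal_inv] at h1
  rw [inv_mul_eq_iff_eq_mul₀ h0] at h1
  rw [h1]
  by_cases hk : k = 0
  · subst hk
    simp
  · rw [if_neg hk, Pi.single_eq_of_ne (Ne.symm hk), mul_zero]

theorem integral_hartley_mul_hartley (n m : ℤ) :
    ∫ x : AddCircle ℓ, hartley n x * hartley m x = if n = m then ℓ else 0 := by
  have hint : ∀ k : ℤ, Integrable (fun x : AddCircle ℓ => fourier k x) volume := fun k =>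
    (map_continuous (fourier k)).integrable_of_hasCompactSupport (HasCompactSupport.of_compactSpace _)
  simp_rw [hartley_mul_hartley]
  have hre : ∀ k : ℤ, Integrable (fun x : AddCircle ℓ => (fourier k x).re) volume :=
    fun k => (hint k).re
  have him : ∀ k : ℤ, Integrable (fun x : AddCircle ℓ => (fourier k x).im) volume :=
    fun k => (hint k).im
  rw [integral_add (hre _) (him _)]
  have h1 : ∀ k : ℤ, ∫ x : AddCircle ℓ, (fourier k x).re = if k = 0 then ℓ else 0 := fun k => by
    have := integral_re (hint k)
    simp only [RCLike.re_to_complex] at this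
    rw [this, integral_fourier]
    split_ifs <;> simp
  have h2 : ∀ k : ℤ, ∫ x : AddCircle ℓ, (fourier k x).im = 0 := fun k => by
    have := integral_im (hint k)
    simp only [RCLike.im_to_complex] at this
    rw [this, integral_fourier]
    split_ifs <;> simp
  rw [h1, h2, add_zero]
  simp only [sub_eq_zero]

/-- The frequencies `n` and `-n` give `cos + sin` and `cos - sin`, so all complex Fourier
coefficients vanish. -/
theorem ae_eq_zero_of_integral_mul_hartley {g : AddCircle ℓ → ℝ} (hg : MemLp g 2 volume)
    (h : ∀ n, ∫ x, g x * hartley n x = 0) : g =ᵐ[volume] 0 := by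
  have hgint : Integrable g volume := hg.integrable (by norm_num)
  have hbdd : ∀ {a : AddCircle ℓ → ℝ}, Continuous a → Integrable (fun x => g x * a x) volume := by
    intro a ha
    obtain ⟨C, hC⟩ := isCompact_univ.exists_bound_of_continuousOn ha.continuousOn
    exact hgint.mul_bdd (c := C) ha.aestronglyMeasurable (Eventually.of_forall fun s => hC s (mem_univ s))
  have hre : ∀ n : ℤ, Continuous fun x : AddCircle ℓ => (fourier n x).re := fun n =>
    Complex.continuous_re.comp (map_continuous _)
  have him : ∀ n : ℤ, Continuous fun x : AddCircle ℓ => (fourier n x).im := fun n =>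
    Complex.continuous_im.comp (map_continuous _)
  have h1 : ∀ n : ℤ, ∫ x, g x * (fourier n x).re = 0 ∧ ∫ x, g x * (fourier n x).im = 0 := by
    intro n
    have e1 := h n
    have e2 := h (-n)
    simp only [hartley, fourier_neg, Complex.conj_re, Complex.conj_im, mul_add, mul_neg] at e1 e2
    rw [integral_add (hbdd (hre n)) (hbdd (him n))] at e1
    simp only [← sub_eq_add_neg] at e2
    rw [integral_sub (hbdd (hre n)) (hbdd (him n))] at e2
    constructor <;> linarith
  have hG : MemLp (fun x => (g x : ℂ)) 2 (AddCircle.haarAddCircle (T := ℓ)) :=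
    memLp_haarAddCircle_iff.2 hg.ofReal
  have h2 : hG.toLp _ = 0 := by
    refine fourierBasis.repr.injective (lp.ext (funext fun n => ?_))
    rw [fourierBasis_repr, fourierCoeff_congr_ae hG.coeFn_toLp, map_zero, fourierCoeff,
      AddCircle.integral_haarAddCircle]
    have h3 : ∀ x : AddCircle ℓ, fourier (-n) x • (g x : ℂ) =
        ((g x * (fourier n x).re : ℝ) : ℂ) - ((g x * (fourier n x).im : ℝ) : ℂ) * Complex.I := by
      intro x
      rw [fourier_neg]
      apply Complex.ext <;> simp <;> ring
    simp_rw [h3]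
    rw [integral_sub (hbdd (hre n)).ofReal ((hbdd (him n)).ofReal.mul_const _),
      integral_mul_const, integral_complex_ofReal, integral_complex_ofReal, (h1 n).1, (h1 n).2]
    simp
  have h4 : (fun x => (g x : ℂ)) =ᵐ[AddCircle.haarAddCircle] 0 := by
    have := hG.coeFn_toLp
    rw [h2] at this
    exact this.symm.trans (Lp.coeFn_zero _ _ _)
  have h5 : (fun x => (g x : ℂ)) =ᵐ[volume] 0 := by
    rw [AddCircle.volume_eq_smul_haarAddCircle]
    exact Measure.ae_smul_measure h4 _
  filter_upwards [h5] with x hx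
  simpa using hx

theorem integral_cosh_mul_cos (κ ω : ℝ) (hκ : κ ≠ 0) (ℓ : ℝ) (hω : Real.cos (ω * ℓ) = 1)
    (hω' : Real.sin (ω * ℓ) = 0) :
    ∫ x in (0 : ℝ)..ℓ, Real.cos (ω * x) * Real.cosh (κ * (x - ℓ / 2)) =
      2 * κ * Real.sinh (κ * ℓ / 2) / (κ ^ 2 + ω ^ 2) := by
  have hpos : κ ^ 2 + ω ^ 2 ≠ 0 := by positivity
  have hd : ∀ x : ℝ, HasDerivAt (fun x => (κ * (Real.sinh (κ * (x - ℓ / 2)) * Real.cos (ω * x)) +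
      ω * (Real.cosh (κ * (x - ℓ / 2)) * Real.sin (ω * x))) / (κ ^ 2 + ω ^ 2))
      (Real.cos (ω * x) * Real.cosh (κ * (x - ℓ / 2))) x := by
    intro x
    have d1 : HasDerivAt (fun x : ℝ => κ * (x - ℓ / 2)) κ x := by
      simpa using ((hasDerivAt_id x).sub_const (ℓ / 2)).const_mul κ
    have d2 : HasDerivAt (fun x : ℝ => ω * x) ω x := by
      simpa using (hasDerivAt_id x).const_mul ω
    have := (((d1.sinh.mul d2.cos).const_mul κ).add
      ((d1.cosh.mul d2.sin).const_mul ω)).div_const (κ ^ 2 + ω ^ 2)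
    refine this.congr_deriv ?_
    field_simp
    ring
  rw [intervalIntegral.integral_eq_sub_of_hasDerivAt (fun x _ => hd x)
    (Continuous.intervalIntegrable (by fun_prop) _ _), hω, hω']
  rw [show κ * (ℓ - ℓ / 2) = κ * ℓ / 2 by ring, show κ * (0 - ℓ / 2) = -(κ * ℓ / 2) by ring,
    Real.sinh_neg]
  simp only [mul_zero, Real.cos_zero, Real.sin_zero]
  field_simp
  ring

/-- The kernel is symmetric about `ℓ/2`, so it does not matter which arc is measured. -/
theorem cosh_norm_coe (κ : ℝ) {x : ℝ} (hx : x ∈ Icc 0 ℓ) :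
    Real.cosh (κ * (‖(x : AddCircle ℓ)‖ - ℓ / 2)) = Real.cosh (κ * (x - ℓ / 2)) := by
  have hℓ0 := hℓ.out
  rcases le_total x (ℓ / 2) with h | h
  · rw [(AddCircle.norm_coe_eq_abs_iff ℓ hℓ0.ne').2, abs_of_nonneg hx.1]
    rwa [abs_of_nonneg hx.1, abs_of_pos hℓ0]
  · have h1 : ‖(x : AddCircle ℓ)‖ = ℓ - x := by
      have h2 : ((ℓ - x : ℝ) : AddCircle ℓ) = -(x : AddCircle ℓ) := by
        rw [AddCircle.coe_sub, AddCircle.coe_period, zero_sub]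
      have h3 : |ℓ - x| = ℓ - x := abs_of_nonneg (by linarith [hx.2])
      rw [← norm_neg, ← h2, (AddCircle.norm_coe_eq_abs_iff ℓ hℓ0.ne').2, h3]
      rw [h3, abs_of_pos hℓ0]
      linarith
    rw [h1, ← Real.cosh_neg]
    congr 1
    ring

/-- A convolution with an even kernel: after translation by `y` the addition formula applies, the
sine part is odd and integrates to zero, and the cosine integral is the eigenvalue. -/
theorem integral_hartley_mul_cosh {κ : ℝ} (hκ : κ ≠ 0) (n : ℤ) (y : AddCircle ℓ) :
    ∫ x : AddCircle ℓ, hartley n x * Real.cosh (κ * (‖x - y‖ - ℓ / 2)) =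
      2 * κ * Real.sinh (κ * ℓ / 2) / (κ ^ 2 + (2 * Real.pi * n / ℓ) ^ 2) * hartley n y := by
  have hℓ0 := hℓ.out
  set k : AddCircle ℓ → ℝ := fun x => Real.cosh (κ * (‖x‖ - ℓ / 2)) with hk
  have hkc : Continuous k := by fun_prop
  have hint : ∀ {a : AddCircle ℓ → ℝ}, Continuous a → Integrable a volume := fun ha =>
    ha.integrable_of_hasCompactSupport (HasCompactSupport.of_compactSpace _)
  have hre : Continuous fun x : AddCircle ℓ => (fourier n x).re :=
    Complex.continuous_re.comp (map_continuous _)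
  have him : Continuous fun x : AddCircle ℓ => (fourier n x).im :=
    Complex.continuous_im.comp (map_continuous _)
  have hsin : ∫ x, (fourier n x).im * k x = 0 := by
    have h1 := integral_neg_eq_self (fun x : AddCircle ℓ => (fourier n x).im * k x) volume
    have h2 : ∀ x : AddCircle ℓ, (fourier n (-x)).im * k (-x) = -((fourier n x).im * k x) := by
      intro x
      have h3 : fourier n (-x) = (starRingEnd ℂ) (fourier n x) := by
        rw [← fourier_neg]
        simp [fourier_apply]
      simp only [h3, hk, norm_neg, Complex.conj_im, neg_mul]
    simp_rw [h2] at h1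
    rw [integral_neg] at h1
    linarith
  have hcos : ∫ x, (fourier n x).re * k x =
      2 * κ * Real.sinh (κ * ℓ / 2) / (κ ^ 2 + (2 * Real.pi * n / ℓ) ^ 2) := by
    rw [← AddCircle.intervalIntegral_preimage ℓ 0, zero_add]
    have hωℓ : 2 * Real.pi * n / ℓ * ℓ = n * (2 * Real.pi) := by field_simp
    rw [← integral_cosh_mul_cos κ (2 * Real.pi * n / ℓ) hκ ℓ
      (by rw [hωℓ, Real.cos_int_mul_two_pi])
      (by rw [hωℓ, ← zero_add ((n : ℝ) * (2 * Real.pi)), Real.sin_add_int_mul_two_pi, Real.sin_zero])]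
    refine intervalIntegral.integral_congr fun x hx => ?_
    rw [uIcc_of_le hℓ0.le] at hx
    simp only [hk, cosh_norm_coe κ hx, fourier_coe_eq_cos_add_sin, Complex.add_re,
      Complex.ofReal_re, Complex.re_ofReal_mul, Complex.I_re, mul_zero, add_zero]
  rw [← integral_add_right_eq_self _ y]
  simp only [add_sub_cancel_right, hartley_apply_add, add_mul]
  have e1 : ∀ x : AddCircle ℓ, (fourier n x).re * hartley n y * Real.cosh (κ * (‖x‖ - ℓ / 2)) =
      ((fourier n x).re * k x) * hartley n y := fun x => by simp only [hk]; ring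
  have e2 : ∀ x : AddCircle ℓ, (fourier n x).im * ((fourier n y).re - (fourier n y).im) *
      Real.cosh (κ * (‖x‖ - ℓ / 2)) =
      ((fourier n x).im * k x) * ((fourier n y).re - (fourier n y).im) :=
    fun x => by simp only [hk]; ring
  simp_rw [e1, e2]
  rw [integral_add (hint (a := fun x => (fourier n x).re * k x * hartley n y) (by fun_prop))
      (hint (a := fun x => (fourier n x).im * k x * ((fourier n y).re - (fourier n y).im))
        (by fun_prop)),
    integral_mul_const, integral_mul_const, hsin, hcos, zero_mul, add_zero]

end Hartley

/-! ### Transport of the Hartley basis to the cycle -/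

section Transfer

variable {T : Type*} [TopologicalSpace T] [CompactSpace T] [MeasurableSpace T] [BorelSpace T]
  {μ : Measure T} [IsFiniteMeasure μ] {ℓ : ℝ} [hℓ : Fact (0 < ℓ)]

theorem exists_hartleyBasis (Φ : T ≃ₜ AddCircle ℓ) (hΦ : MeasurePreserving Φ μ volume) :
    ∃ b : HilbertBasis ℤ ℝ (Lp ℝ 2 μ),
      ∀ n, b n =ᵐ[μ] fun s => (√ℓ)⁻¹ * hartley n (Φ s) := by
  have hℓ0 := hℓ.out
  have hmem : ∀ n, MemLp (fun s => (√ℓ)⁻¹ * hartley n (Φ s)) 2 μ := by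
    intro n
    have hc : Continuous fun s => (√ℓ)⁻¹ * hartley n (Φ s) :=
      continuous_const.mul ((continuous_hartley n).comp Φ.continuous)
    obtain ⟨C, hC⟩ := isCompact_univ.exists_bound_of_continuousOn hc.continuousOn
    exact MemLp.of_bound hc.aestronglyMeasurable C (Eventually.of_forall fun s => hC s (mem_univ s))
  set v : ℤ → Lp ℝ 2 μ := fun n => (hmem n).toLp _ with hv
  have hv' : ∀ n, v n =ᵐ[μ] fun s => (√ℓ)⁻¹ * hartley n (Φ s) := fun n => (hmem n).coeFn_toLp
  have hemb : MeasurableEmbedding Φ := Φ.measurableEmbedding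
  have hvo : Orthonormal ℝ v := by
    rw [orthonormal_iff_ite]
    intro n m
    rw [L2.inner_def]
    have h1 : ∫ s, inner ℝ (v n s) (v m s) ∂μ =
        ∫ s, (fun x => ℓ⁻¹ * (hartley n x * hartley m x)) (Φ s) ∂μ := by
      refine integral_congr_ae ?_
      filter_upwards [hv' n, hv' m] with s h2 h3
      rw [h2, h3]
      simp only [RCLike.inner_apply, conj_trivial]
      have : ℓ⁻¹ = (√ℓ)⁻¹ * (√ℓ)⁻¹ := by rw [← mul_inv, Real.mul_self_sqrt hℓ0.le]
      rw [this]
      ring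
    rw [h1, hΦ.integral_comp hemb (fun x => ℓ⁻¹ * (hartley n x * hartley m x)),
      integral_const_mul, integral_hartley_mul_hartley]
    split_ifs
    · exact inv_mul_cancel₀ hℓ0.ne'
    · exact mul_zero _
  have hsp : (Submodule.span ℝ (range v))ᗮ = ⊥ := by
    rw [Submodule.eq_bot_iff]
    intro f hf
    have hΦs : MeasurePreserving Φ.symm volume μ := hΦ.symm Φ.toMeasurableEquiv
    have hg : MemLp (fun x => f (Φ.symm x)) 2 volume := (Lp.memLp f).comp_measurePreserving hΦs
    have h1 := ae_eq_zero_of_integral_mul_hartley hg fun n => by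
      have h2 : inner ℝ (v n) f = 0 := hf _ (Submodule.subset_span (mem_range_self n))
      rw [L2.inner_def] at h2
      have h3 : ∫ s, inner ℝ (v n s) (f s) ∂μ =
          ∫ s, (√ℓ)⁻¹ * (fun x => f (Φ.symm x) * hartley n x) (Φ s) ∂μ := by
        refine integral_congr_ae ?_
        filter_upwards [hv' n] with s h
        simp only [h, RCLike.inner_apply, conj_trivial, Φ.symm_apply_apply]
        ring
      rw [h3, integral_const_mul,
        hΦ.integral_comp hemb (fun x => f (Φ.symm x) * hartley n x)] at h2
      exact (mul_eq_zero.1 h2).resolve_left (inv_ne_zero (Real.sqrt_pos.2 hℓ0).ne')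
    rw [Lp.eq_zero_iff_ae_eq_zero]
    have h4 := hΦ.quasiMeasurePreserving.ae h1
    filter_upwards [h4] with s hs
    simpa using hs
  refine ⟨HilbertBasis.mkOfOrthogonalEqBot hvo hsp, fun n => ?_⟩
  rw [HilbertBasis.coe_mkOfOrthogonalEqBot]
  exact hv' n

end Transfer

/-! ### Kirchhoff eigenfunctions and the Whittle–Matérn equation -/

namespace MetricGraph

namespace CyclicOrder

variable {V E : Type*} [Fintype E] {Γ : MetricGraph V E} {n : ℕ} (c : Γ.CyclicOrder n)

include c in
/-- Smooth periodic functions of the position on the cycle are in the domain of the Kirchhoff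
Laplacian, which acts on them as the second derivative. -/
theorem isKirchhoffLaplacian {f g : Γ.Point → ℝ} {G G' G'' : ℝ → ℝ} (hf : Continuous f)
    (hfG : ∀ k < n, ∀ t ∈ Icc 0 (c.len k), f (c.point k t) = G (c.pos k + t))
    (hgG : ∀ k < n, ∀ t ∈ Icc 0 (c.len k), g (c.point k t) = G'' (c.pos k + t))
    (hd : ∀ x, HasDerivAt G (G' x) x) (hd' : ∀ x, HasDerivAt G' (G'' x) x)
    (hG'' : Continuous G'') (hper : G' Γ.totalLength = G' 0) : Γ.IsKirchhoffLaplacian f g := by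
  classical
  have hG' : Continuous G' := continuous_iff_continuousAt.2 fun x => (hd' x).continuousAt
  have key : ∀ (e : E) (H H' H'' : ℝ → ℝ), (∀ t ∈ Icc 0 (Γ.len e), f (Γ.loc e t) = H t) →
      (∀ t ∈ Icc 0 (Γ.len e), g (Γ.loc e t) = H'' t) → (∀ x, HasDerivAt H (H' x) x) →
      (∀ x, HasDerivAt H' (H'' x) x) → Continuous H' → Continuous H'' →
      MemLp (fun t => g (Γ.loc e t)) 2 (volume.restrict (Icc 0 (Γ.len e))) ∧
      (∀ t ∈ Icc 0 (Γ.len e), f (Γ.loc e t) = f (Γ.loc e 0) + ∫ s in (0 : ℝ)..t, H' s) ∧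
      (∀ t ∈ Icc 0 (Γ.len e), H' t = H' 0 + ∫ s in (0 : ℝ)..t, g (Γ.loc e s)) := by
    intro e H H' H'' h1 h2 h3 h4 h5 h6
    have hl := (Γ.len_pos e).le
    refine ⟨?_, fun t ht => ?_, fun t ht => ?_⟩
    · have h7 : (fun t => g (Γ.loc e t)) =ᵐ[volume.restrict (Icc 0 (Γ.len e))] H'' := by
        filter_upwards [ae_restrict_mem measurableSet_Icc] with t ht
        exact h2 t ht
      rw [memLp_congr_ae h7]
      obtain ⟨C, hC⟩ := (isCompact_Icc (a := (0 : ℝ)) (b := Γ.len e)).exists_bound_of_continuousOn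
        h6.continuousOn
      refine MemLp.of_bound h6.aestronglyMeasurable C ?_
      filter_upwards [ae_restrict_mem measurableSet_Icc] with t ht
      exact hC t ht
    · rw [intervalIntegral.integral_eq_sub_of_hasDerivAt (fun x _ => h3 x)
        (h5.intervalIntegrable _ _), h1 t ht, h1 0 ⟨le_rfl, hl⟩]
      ring
    · have h7 : ∫ s in (0 : ℝ)..t, g (Γ.loc e s) = ∫ s in (0 : ℝ)..t, H'' s := by
        refine intervalIntegral.integral_congr fun s hs => ?_
        rw [uIcc_of_le ht.1] at hs
        exact h2 s ⟨hs.1, hs.2.trans ht.2⟩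
      rw [h7, intervalIntegral.integral_eq_sub_of_hasDerivAt (fun x _ => h4 x)
        (h6.intervalIntegrable _ _)]
      ring
  -- Reversing an edge changes the sign of the derivative and swaps the ends, so its contribution to
  -- the vertex condition is the same for both orientations.
  have hex : ∀ e, ∃ ψ : ℝ → ℝ,
      (MemLp (fun t => g (Γ.loc e t)) 2 (volume.restrict (Icc 0 (Γ.len e))) ∧
      (∀ t ∈ Icc 0 (Γ.len e), f (Γ.loc e t) = f (Γ.loc e 0) + ∫ s in (0 : ℝ)..t, ψ s) ∧
      (∀ t ∈ Icc 0 (Γ.len e), ψ t = ψ 0 + ∫ s in (0 : ℝ)..t, g (Γ.loc e s))) ∧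
      ∀ k < n, c.edge k = e → ∀ v,
        (if Γ.src e = v then ψ 0 else 0) - (if Γ.tgt e = v then ψ (Γ.len e) else 0) =
        (if c.vert k = v then G' (c.pos k) else 0) -
          (if c.vert (k + 1) = v then G' (c.pos (k + 1)) else 0) := by
    intro e
    obtain ⟨k, hk, rfl⟩ := c.edge_surj e
    have hl : Γ.len (c.edge k) = c.len k := rfl
    rcases c.ends_cases hk with ⟨h1, h2, h3⟩ | ⟨h1, h2, h3⟩
    · refine ⟨fun t => G' (c.pos k + t), key _ (fun t => G (c.pos k + t)) _
        (fun t => G'' (c.pos k + t)) (fun t ht => ?_) (fun t ht => ?_)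
        (fun x => (hd _).comp_const_add _ _) (fun x => (hd' _).comp_const_add _ _)
        (by fun_prop) (by fun_prop), fun k' hk' hkk v => ?_⟩
      · rw [← h3, hfG k hk t ht]
      · rw [← h3, hgG k hk t ht]
      · obtain rfl := c.edge_inj _ hk' _ hk hkk
        simp only [h1, h2, hl, add_zero, pos_succ]
    · have hloc : ∀ t, Γ.loc (c.edge k) t = c.point k (c.len k - t) := fun t => by
        rw [h3, sub_sub_cancel]
      have hmem : ∀ t ∈ Icc 0 (Γ.len (c.edge k)), c.len k - t ∈ Icc 0 (c.len k) := fun t ht =>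
        ⟨sub_nonneg.2 ht.2, by linarith [ht.1]⟩
      refine ⟨fun t => -G' (c.pos (k + 1) - t), key _ (fun t => G (c.pos (k + 1) - t)) _
        (fun t => G'' (c.pos (k + 1) - t)) (fun t ht => ?_) (fun t ht => ?_)
        (fun x => (hd _).comp_const_sub _ _)
        (fun x => ((hd' _).comp_const_sub _ _).neg.congr_deriv (neg_neg _))
        (by fun_prop) (by fun_prop), fun k' hk' hkk v => ?_⟩
      · rw [hloc, hfG k hk _ (hmem t ht), pos_succ, add_sub_assoc]
      · rw [hloc, hgG k hk _ (hmem t ht), pos_succ, add_sub_assoc]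
      · obtain rfl := c.edge_inj _ hk' _ hk hkk
        simp only [h1, h2, hl, sub_zero, pos_succ, add_sub_cancel_right]
        split_ifs <;> ring
  choose ψ hψ hv using hex
  refine ⟨hf, ψ, fun e => (hψ e).1, fun e => (hψ e).2.1, fun e => (hψ e).2.2, fun v => ?_⟩
  -- The vertex condition telescopes around the cycle and is closed up by the periodicity of `G'`.
  rw [← Finset.sum_sub_distrib, c.sum_edge, Finset.sum_congr rfl fun k hk =>
    hv _ k (Finset.mem_range.1 hk) rfl v,
    Finset.sum_range_sub' (fun k => if c.vert k = v then G' (c.pos k) else 0), c.vert_period,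
    ← c.totalLength_eq, hper, pos_zero, sub_self]

theorem isEigenfunction_hartley (κ a : ℝ) (m : ℤ) :
    Γ.IsEigenfunction κ (κ ^ 2 + (2 * Real.pi * m / Γ.totalLength) ^ 2)
      (fun s => a * hartley m (c.circleEquiv s)) := by
  set ω := 2 * Real.pi * m / Γ.totalLength with hω
  have hωℓ : ω * Γ.totalLength = m * (2 * Real.pi) := by
    have := c.totalLength_pos.ne'
    rw [hω]
    field_simp
  have hval : ∀ k < n, ∀ t ∈ Icc 0 (c.len k), hartley m (c.circleEquiv (c.point k t)) =
      Real.cos (ω * (c.pos k + t)) + Real.sin (ω * (c.pos k + t)) := fun k hk t ht => by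
    rw [c.circleEquiv_point hk ht, hartley_coe]
  have hlin : ∀ x, HasDerivAt (fun x => ω * x) ω x := fun x => by
    simpa using (hasDerivAt_id x).const_mul ω
  refine c.isKirchhoffLaplacian (G := fun x => a * (Real.cos (ω * x) + Real.sin (ω * x)))
    (G' := fun x => a * ω * (Real.cos (ω * x) - Real.sin (ω * x)))
    (G'' := fun x => -(a * ω ^ 2 * (Real.cos (ω * x) + Real.sin (ω * x))))
    (continuous_const.mul ((continuous_hartley m).comp c.circleEquiv.continuous))
    (fun k hk t ht => by rw [hval k hk t ht]) (fun k hk t ht => ?_) (fun x => ?_) (fun x => ?_)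
    (by fun_prop) ?_
  · simp only [hval k hk t ht]
    ring
  · refine (((hlin x).cos.add (hlin x).sin).const_mul a).congr_deriv ?_
    ring
  · refine (((hlin x).cos.sub (hlin x).sin).const_mul (a * ω)).congr_deriv ?_
    ring
  · simp only [hωℓ, Real.cos_int_mul_two_pi, mul_zero, Real.cos_zero, Real.sin_zero]
    rw [← zero_add ((m : ℝ) * (2 * Real.pi)), Real.sin_add_int_mul_two_pi, Real.sin_zero]

include c in
theorem compactSpace : CompactSpace Γ.Point := by
  have : Fact (0 < Γ.totalLength) := ⟨c.totalLength_pos⟩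
  exact c.circleEquiv.symm.toHomeomorph.compactSpace

end CyclicOrder

/-- A Gaussian field on a Euclidean cycle with covariance function
`cosh (κ (d - ℓ / 2)) / (2 κ τ² sinh (κ ℓ / 2))` is a Whittle-Matérn field with `α = 1`. -/
theorem CyclicOrder.isWhittleMatern {V E Ω : Type*} [Fintype E] {Γ : MetricGraph V E} {n : ℕ}
    (c : Γ.CyclicOrder n) [MeasurableSpace Ω] {P : Measure Ω} [IsProbabilityMeasure P]
    {X : Γ.Point → Ω → ℝ} (hmeas : ∀ s, Measurable (X s)) (hgauss : IsGaussianProcess X P)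
    (hM : IsMarkovOfOrderOne P X) {κ τ : ℝ} (hκ : 0 < κ) (hτ : 0 < τ)
    (hcov : ∀ s s', cov[X s, X s'; P] = Real.cosh (κ * (dist s s' - Γ.totalLength / 2)) /
      (2 * κ * τ ^ 2 * Real.sinh (κ * Γ.totalLength / 2))) :
    Γ.IsWhittleMatern κ τ 1 P (fun s ω => X s ω - ∫ ω', X s ω' ∂P) := by
  have hℓ : Fact (0 < Γ.totalLength) := ⟨c.totalLength_pos⟩
  have hℓ0 := hℓ.out
  have := c.compactSpace
  have : SecondCountableTopology Γ.Point := inferInstance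
  have hΦ := c.measurePreserving_circleEquiv hℓ
  have : IsFiniteMeasure Γ.lebesgue := ⟨by
    rw [← preimage_univ (f := c.circleEquiv), hΦ.measure_preimage MeasurableSet.univ.nullMeasurableSet]
    exact measure_lt_top _ _⟩
  have hy := hM.continuous_centeredLp
  obtain ⟨u, hu, huX⟩ := exists_measurable_modification
    (Y := fun s ω => X s ω - ∫ ω', X s ω' ∂P) (fun s => (hmeas s).sub_const _) hy
    (coeFn_centeredLp hM.memLp)
  have huy : ∀ s, u s =ᵐ[P] centeredLp hM.memLp s := fun s =>
    (huX s).trans (coeFn_centeredLp hM.memLp s).symm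
  refine ⟨u, hu, huX, memLp_uncurry hy hu huy, ?_⟩
  obtain ⟨b, hb⟩ := exists_hartleyBasis c.circleEquiv.toHomeomorph hΦ
  have hsinh : 0 < Real.sinh (κ * Γ.totalLength / 2) := Real.sinh_pos_iff.2 (by positivity)
  set lam : ℤ → ℝ := fun m => κ ^ 2 + (2 * Real.pi * m / Γ.totalLength) ^ 2 with hlam
  have hlam0 : ∀ m, 0 < lam m := fun m => by positivity
  have hτ2 : ∀ m, 0 < (τ ^ 2 * lam m)⁻¹ := fun m => inv_pos.2 (mul_pos (by positivity) (hlam0 m))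
  -- The factor `1/(2 κ τ² sinh (κ ℓ/2))` of the covariance cancels the numerator `2 κ sinh (κ ℓ/2)`
  -- of the kernel's eigenvalue and leaves `(τ² lam m)⁻¹`.
  obtain ⟨W, hWK, hW⟩ := exists_isometry_integral_smul_eq hy b
    (fun m s => (√Γ.totalLength)⁻¹ * hartley m (c.circleEquiv s)) hb
    (fun m => (τ ^ 2 * lam m)⁻¹) hτ2 fun m t => by
      have h1 : ∀ s, (√Γ.totalLength)⁻¹ * hartley m (c.circleEquiv s) *
          inner ℝ (centeredLp hM.memLp s) (centeredLp hM.memLp t) =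
          ((√Γ.totalLength)⁻¹ / (2 * κ * τ ^ 2 * Real.sinh (κ * Γ.totalLength / 2))) *
          (fun x => hartley m x * Real.cosh (κ * (‖x - c.circleEquiv t‖ - Γ.totalLength / 2)))
            (c.circleEquiv s) := fun s => by
        rw [inner_centeredLp, hcov, ← c.circleEquiv.isometry.dist_eq, dist_eq_norm]
        ring
      simp_rw [h1]
      rw [integral_const_mul, hΦ.integral_comp c.circleEquiv.toHomeomorph.measurableEmbedding
        (fun x => hartley m x * Real.cosh (κ * (‖x - c.circleEquiv t‖ - Γ.totalLength / 2))),
        integral_hartley_mul_cosh hκ.ne', mul_inv]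
      change _ = (τ ^ 2)⁻¹ * (κ ^ 2 + (2 * Real.pi * m / Γ.totalLength) ^ 2)⁻¹ * _
      have h2 := (hlam0 m).ne'
      simp only [hlam] at h2
      field_simp
  have hK := (isGaussianSpace_span_centeredLp hM.memLp hgauss).topologicalClosure
  refine ⟨fun φ => W φ, ⟨hK.isGaussianProcess _ hWK, fun φ => (hK _ (hWK φ)).1, fun φ ψ => ?_⟩,
    fun φ ψ hφψ => ?_⟩
  · rw [← W.inner_map_map, L2.inner_def]
    refine integral_congr_ae (Eventually.of_forall fun ω => ?_)
    simp [mul_comm]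
  -- The fractional power, tested on the Hartley eigenfunctions alone, gives coefficients `√(lam m)
  -- ⟨b m, φ⟩` for `ψ`. The root of the covariance eigenvalue, `1/(τ √(lam m))`, undoes this
  -- together with the factor `τ`.
  have hcoef : ∀ m, inner ℝ (b m) φ = √((τ ^ 2 * lam m)⁻¹) * inner ℝ (b m) (τ • ψ) := by
    intro m
    have h1 : ∀ χ : Lp ℝ 2 Γ.lebesgue, inner ℝ (b m) χ = ∫ s, χ s *
        ((√Γ.totalLength)⁻¹ * hartley m (c.circleEquiv s)) ∂Γ.lebesgue := by
      intro χ
      rw [L2.inner_def]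
      refine integral_congr_ae ?_
      filter_upwards [hb m] with s hs
      rw [hs]
      simp
    have h2 := hφψ _ _ (c.isEigenfunction_hartley κ (√Γ.totalLength)⁻¹ m)
    rw [← h1, ← h1] at h2
    change _ = lam m ^ _ * _ at h2
    rw [inner_smul_right, h2, ← Real.sqrt_eq_rpow, Real.sqrt_inv, Real.sqrt_mul (by positivity),
      Real.sqrt_sq hτ.le]
    have h3 := (Real.sqrt_pos.2 (hlam0 m)).ne'
    field_simp
  have h1 := integral_mul_ae_eq hy hu huy (τ • ψ)
  rw [hW φ (τ • ψ) hcoef] at h1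
  filter_upwards [h1] with ω h2
  rw [← h2]
  refine integral_congr_ae ?_
  filter_upwards [Lp.coeFn_smul τ ψ] with s hs
  rw [hs, Pi.smul_apply, smul_eq_mul]
  ring

end MetricGraph

theorem mainTheorem4 {V E Ω : Type*} [Fintype V] [Fintype E] [MeasurableSpace Ω]
    (P : Measure Ω) [IsProbabilityMeasure P]
    (Γ : MetricGraph V E) (hΓ : Γ.IsEuclideanCycle) (v₀ : V)
    (X : Γ.Point → Ω → ℝ) (hmeas : ∀ s, Measurable (X s)) (hgauss : IsGaussianProcess X P)
    (r : ℝ → ℝ) (hiso : ∀ s s', covariance (X s) (X s') P = r (Γ.resistDist v₀ s s'))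
    (hnondeg : ∃ s s', variance (fun ω => X s ω - X s' ω) P ≠ 0)
    (hMarkov : IsMarkovOfOrderOne P X) :
    ∃ κ τ : ℝ, 0 < κ ∧ 0 < τ ∧
      Γ.IsWhittleMatern κ τ 1 P (fun s ω => X s ω - ∫ ω', X s ω' ∂P) ∧
      ∀ s s', r (Γ.resistDist v₀ s s') =
        Real.cosh (κ * (dist s s' - Γ.totalLength / 2)) /
          (2 * κ * τ ^ 2 * Real.sinh (κ * Γ.totalLength / 2)) := by
  obtain ⟨n, ⟨c⟩⟩ := hΓ.exists_cyclicOrder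
  have hℓ : Fact (0 < Γ.totalLength) := ⟨c.totalLength_pos⟩
  have hℓ0 := hℓ.out
  obtain ⟨A, κ, hA, hκ, hcov⟩ := hMarkov.exists_covariance_eq_cosh c.circleEquiv hgauss hmeas
    (fun d => r (MetricGraph.circleResistance Γ.totalLength d))
    (fun s s' => by rw [hiso, c.resistDist_eq hΓ.1]) hnondeg
  have hsinh : 0 < Real.sinh (κ * Γ.totalLength / 2) := Real.sinh_pos_iff.2 (by positivity)
  -- This `τ` solves `A = 1/(2 κ τ² sinh (κ ℓ/2))`, matching the amplitude of the covariance.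
  set τ := √(2 * κ * A * Real.sinh (κ * Γ.totalLength / 2))⁻¹ with hτ
  have hτ2 : τ ^ 2 = (2 * κ * A * Real.sinh (κ * Γ.totalLength / 2))⁻¹ :=
    Real.sq_sqrt (by positivity)
  have hcov' : ∀ s s', cov[X s, X s'; P] =
      Real.cosh (κ * (dist s s' - Γ.totalLength / 2)) /
        (2 * κ * τ ^ 2 * Real.sinh (κ * Γ.totalLength / 2)) := fun s s' => by
    rw [hcov, hτ2]
    field_simp
  have hτ0 : 0 < τ := Real.sqrt_pos.2 (by positivity)
  exact ⟨κ, τ, hκ, hτ0, c.isWhittleMatern hmeas hgauss hMarkov hκ hτ0 hcov',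
    fun s s' => by rw [← hiso, hcov']⟩
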